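/- **Definitions.** For positive reals $a,b,c,d$ let $$F(a,b,c,d)=(a+b+c+d)^2\lim_{v\to\infty}\sum_{n_1=-v}^{v}\sum_{n_2=-v}^{v}\sum_{n_3=-v}^{v}\sum_{n_4=-v}^{v}\frac{(-1)^{n_1+n_2+n_3+n_4}}{\left(a(6n_1+1)^2+b(6n_2+1)^2+c(6n_3+1)^2+d(6n_4+1)^2\right)^2},$$ and for $x>0$ let $$F_{(1,2)}(x)=\sum_{n\in\mathbb Z,\;k\ge 0}\frac{(-1)^{n+k}(2k+1)}{\left((2k+1)^2+x^2(2n)^2\right)^2},\qquad F_{(1,4)}(x)=25\sum_{n,k\in\mathbb Z}\frac{(-1)^n(3k+1)}{\left(4(3k+1)^2+x^2(6n+1)^2\right)^2},$$ $$F_{(2,2)}(x)=9\sum_{n,k\ge 0}\frac{(-1)^{n(n+1)/2+k}(2k+1)}{\left(2(2k+1)^2+x^2(2n+1)^2\right)^2}.$$ For $|q|<1$ let $$\varphi(q)=\sum_{n=-\infty}^{\infty}q^{n^2},\qquad \psi(q)=\sum_{n=0}^{\infty}q^{n(n+1)/2},\qquad f(-q)=\prod_{n=1}^{\infty}(1-q^n).$$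 Integrals with a complex endpoint are taken along the straight segment from $0$ to that endpoint. **Theorem.** Let $x>0$. The limit defining $F(1,1,1,x^2)$ exists, the double series defining $F_{(1,2)}(x)$, $F_{(1,4)}(x)$ and $F_{(2,2)}(x)$ converge absolutely, the integrands below are integrable, and the following hold. 1. If $q=e^{-\pi x/\sqrt{12}}$, then $$\frac{F(1,1,1,x^2)}{(3+x^2)^2}=\frac{\pi^2}{24\sqrt3\,x}\,\operatorname{Im}\int_0^{iq}\frac{f^9(-u^3)}{f^3(-u)}\,du.$$ 2. If $q=e^{-\pi x}$, then $$F_{(1,2)}(x)=\frac{\pi^3}{32}-\frac{\pi^2}{32x}\int_0^q\frac{\varphi^2(-u)\varphi^4(u)-1}{u}\,du.$$ 3. If $q=e^{-\pi x/3}$ and $\rho=e^{2\pi i/3}$, then $$F_{(1,4)}(x)=\frac{25\pi^2}{36x}\,\operatorname{Im}\int_0^{\rho q}\varphi^2(u)\,\psi^4(u^2)\,du.$$ 4. If $q=e^{-\pi x/\sqrt8}$, then $$F_{(2,2)}(x)=\frac{9\pi^2}{32\sqrt2\,x}\int_0^q\varphi(-u^2)\,\varphi(u^4)\left(3\psi^4(-u^2)-\psi^4(u^2)\right)du.$$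 -/

import Mathlib

open Real Filter Topology MeasureTheory

noncomputable section

/-- The cubic partial sum over `-v ≤ n₁, n₂, n₃, n₄ ≤ v` of the four-dimensional lattice sum. -/
def latticePartialSum (a b c d : ℝ) (v : ℕ) : ℝ :=
  ∑ n₁ ∈ Finset.Icc (-(v : ℤ)) v, ∑ n₂ ∈ Finset.Icc (-(v : ℤ)) v,
    ∑ n₃ ∈ Finset.Icc (-(v : ℤ)) v, ∑ n₄ ∈ Finset.Icc (-(v : ℤ)) v,
      (-1 : ℝ) ^ (n₁ + n₂ + n₃ + n₄) /
        (a * (6 * n₁ + 1) ^ 2 + b * (6 * n₂ + 1) ^ 2 + c * (6 * n₃ + 1) ^ 2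
          + d * (6 * n₄ + 1) ^ 2) ^ 2

/-- `F(a,b,c,d)`; the lattice sum is only conditionally convergent, and is by definition
the limit of its cubic partial sums. -/
def latticeF (a b c d : ℝ) : ℝ :=
  (a + b + c + d) ^ 2 * limUnder atTop (latticePartialSum a b c d)

/-- The terms of the two-dimensional sum `F_{(1,2)}(x)`, indexed by `(n, k)`. -/
def term12 (x : ℝ) (p : ℤ × ℕ) : ℝ :=
  (-1 : ℝ) ^ (p.1 + (p.2 : ℤ)) * (2 * p.2 + 1) /
    ((2 * p.2 + 1) ^ 2 + x ^ 2 * (2 * p.1) ^ 2) ^ 2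

/-- `F_{(1,2)}(x)`. -/
def F12 (x : ℝ) : ℝ := ∑' p : ℤ × ℕ, term12 x p

/-- The terms of the two-dimensional sum in `F_{(1,4)}(x)`, indexed by `(n, k)`. -/
def term14 (x : ℝ) (p : ℤ × ℤ) : ℝ :=
  (-1 : ℝ) ^ p.1 * (3 * p.2 + 1) /
    (4 * (3 * p.2 + 1) ^ 2 + x ^ 2 * (6 * p.1 + 1) ^ 2) ^ 2

/-- `F_{(1,4)}(x)`. -/
def F14 (x : ℝ) : ℝ := 25 * ∑' p : ℤ × ℤ, term14 x p

/-- The terms of the two-dimensional sum in `F_{(2,2)}(x)`, indexed by `(n, k)`. -/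
def term22 (x : ℝ) (p : ℕ × ℕ) : ℝ :=
  (-1 : ℝ) ^ (p.1 * (p.1 + 1) / 2 + p.2) * (2 * p.2 + 1) /
    (2 * (2 * p.2 + 1) ^ 2 + x ^ 2 * (2 * p.1 + 1) ^ 2) ^ 2

/-- `F_{(2,2)}(x)`. -/
def F22 (x : ℝ) : ℝ := 9 * ∑' p : ℕ × ℕ, term22 x p

/-- Ramanujan's theta function `φ(q) = ∑_{n ∈ ℤ} q^{n²}`, for real or complex `|q| < 1`. -/
def ramanujanPhi {𝕜 : Type*} [RCLike 𝕜] (q : 𝕜) : 𝕜 := ∑' n : ℤ, q ^ (n.natAbs ^ 2)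

/-- Ramanujan's theta function `ψ(q) = ∑_{n ≥ 0} q^{n(n+1)/2}`, for real or complex `|q| < 1`. -/
def ramanujanPsi {𝕜 : Type*} [RCLike 𝕜] (q : 𝕜) : 𝕜 := ∑' n : ℕ, q ^ (n * (n + 1) / 2)

/-- Ramanujan's function `f`, normalised by `f(-q) = ∏_{n ≥ 1} (1 - q^n)`, for `|q| < 1`. -/
def ramanujanF (q : ℂ) : ℂ := ∏' n : ℕ, (1 - (-q) ^ (n + 1))

/-- The complex one-form `g(u) du`. -/
def complexForm (g : ℂ → ℂ) (u : ℂ) : ℂ →L[ℂ] ℂ := ContinuousLinearMap.toSpanSingleton ℂ (g u)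

/-- `∫_a^b g(u) du` along the straight segment from `a` to `b` in the complex plane. -/
def segmentIntegral (g : ℂ → ℂ) (a b : ℂ) : ℂ :=
  curveIntegral (complexForm g) (Path.segment a b)

/-- Integrability of `g(u) du` along the straight segment from `a` to `b`. -/
def SegmentIntegrable (g : ℂ → ℂ) (a b : ℂ) : Prop :=
  CurveIntegrable (complexForm g) (Path.segment a b)

end

/-! Both sides of each formula are the same double series, the sum of α(J) ε(m) (J/m) q^(Jm) over J,
m ≥ 1, where α and ε are periodic sign sequences; it is called `dualTerm` below.

Lattice side. In a two-dimensional sum the inner series over k has terms c / (c² + y²)² with c in an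
arithmetic progression. Partial fractions and the Lipschitz formula turn it into a constant over y
times the sum of J sin(2πJ/r) e^(-2πJy/r). The sines are a character value χ(J), and y is
proportional to the outer variable m, which produces J/m and q^(Jm). In `F12` the row n = 0 has y =
0 and contributes L(3, χ₄) = π³/32 separately.

The four-dimensional sum is first made two-dimensional. Since 1/r² is the integral of t e^(-rt),
each cubic partial sum is the integral of t times four one-dimensional alternating theta sums. Each
of these is bounded by 2e^(-s) uniformly in the cutoff, so dominated convergence gives the limit. By
the pentagonal number theorem the limiting theta function is e^(-s) ∏(1 - e^(-24ns)), and Jacobi's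
formula for the cube of Euler's product (`qProd_cube`) collapses three of the four variables into
one.

Integral side. Each integrand times u is, up to a constant, a Lambert series of weight three, the
sum of α(J) ε(m) J² u^(Jm). Dividing by u and integrating termwise from 0 to b gives (J/m) b^(Jm).
For b = iq or b = ρq the imaginary part multiplies the term by a character of Jm, which splits over
J and m and yields the required twist.

It remains to identify the theta quotients with Lambert series. All four cases follow from one
identity (`thetaSeries_pow_four_mul_lambertSeries`), the product formula for ℘' in multiplicative
form: with θ(w) the theta series of base Q and L(w) the Lambert expansion of ℘', θ(w)⁴ L(w) = (Q;Q)⁹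
w θ(w²). The Laurent coefficients of the left side obey c(n+4) = Qⁿ c(n) and c(4-n) = -c(n). The
solutions form a line, spanned by the coefficients of w θ(w²), and the limit w → 1 fixes the
constant. The specialisations (Q, w) = (u³, u), (u⁴, u), (-q, i) and the pair (-u⁴, ±iu) give the
four integrands. -/

/-! ### Theta series and convolution of Laurent coefficients -/

/-- The coefficients of the theta series `∑ (-1)^n Q^{n(n-1)/2} w^n`. -/
noncomputable def thetaCoeff (Q : ℂ) (n : ℤ) : ℂ := (-1) ^ n * Q ^ (n * (n - 1) / 2)

/-- The theta series `∑ (-1)^n Q^{n(n-1)/2} w^n`. -/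
noncomputable def thetaSeries (Q w : ℂ) : ℂ := ∑' n : ℤ, thetaCoeff Q n * w ^ n

/-- Coefficient form of the quasi-periodicity θ(Qw) = -θ(w)/w. The next lemma is likewise θ(1/w) =
-θ(w)/w. Later theta identities are derived from such recursions. -/
lemma thetaCoeff_succ {Q : ℂ} (hQ : Q ≠ 0) (n : ℤ) :
    thetaCoeff Q (n + 1) = -Q ^ n * thetaCoeff Q n := by
  have h : (n + 1) * (n + 1 - 1) / 2 = n * (n - 1) / 2 + n := by
    rw [show (n + 1) * (n + 1 - 1) = n * (n - 1) + n * 2 by ring,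
      Int.add_mul_ediv_right _ _ two_ne_zero]
  rw [thetaCoeff, thetaCoeff, h, zpow_add₀ hQ, zpow_add₀ (by norm_num)]
  simp
  ring

lemma thetaCoeff_one_sub (Q : ℂ) (n : ℤ) : thetaCoeff Q (1 - n) = -thetaCoeff Q n := by
  rw [thetaCoeff, thetaCoeff, show (1 - n) * (1 - n - 1) = n * (n - 1) by ring,
    zpow_sub₀ (by norm_num)]
  rcases Int.even_or_odd n with h | h <;> simp [h.neg_one_zpow]

/-- Laurent coefficients whose series converges absolutely on the punctured plane. -/
def EntireLaurent (a : ℤ → ℂ) : Prop := ∀ r : ℝ, 0 < r → Summable fun n => ‖a n‖ * r ^ n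

lemma summable_norm_thetaCoeff_nat {Q : ℂ} (hQ0 : Q ≠ 0) (hQ : ‖Q‖ < 1) {r : ℝ} (hr : 0 < r) :
    Summable fun n : ℕ => ‖thetaCoeff Q n‖ * r ^ n := by
  have hne (n : ℤ) : thetaCoeff Q n ≠ 0 :=
    mul_ne_zero (zpow_ne_zero _ (by norm_num)) (zpow_ne_zero _ hQ0)
  refine summable_of_ratio_test_tendsto_lt_one (l := 0) zero_lt_one
    (Eventually.of_forall fun n => mul_ne_zero (norm_ne_zero_iff.mpr (hne n)) (by positivity)) ?_
  have : Tendsto (fun n : ℕ => ‖Q‖ ^ n * r) atTop (𝓝 0) := by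
    simpa using (tendsto_pow_atTop_nhds_zero_of_lt_one (norm_nonneg Q) hQ).mul_const r
  refine this.congr fun n => ?_
  have h1 : ‖thetaCoeff Q n‖ ≠ 0 := norm_ne_zero_iff.mpr (hne n)
  push_cast
  rw [thetaCoeff_succ hQ0]
  simp only [norm_mul, norm_neg, zpow_natCast, norm_pow, norm_norm, norm_of_nonneg hr.le]
  field_simp
  ring

lemma entireLaurent_thetaCoeff {Q : ℂ} (hQ0 : Q ≠ 0) (hQ : ‖Q‖ < 1) :
    EntireLaurent (thetaCoeff Q) := by
  intro r hr
  refine Summable.of_nat_of_neg (by simpa using summable_norm_thetaCoeff_nat hQ0 hQ hr) ?_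
  -- The reflection n ↦ 1 - n carries the negative indices at radius r to positive ones at radius
  -- r⁻¹, shifted by one.
  have := ((summable_nat_add_iff 1).mpr
    (summable_norm_thetaCoeff_nat hQ0 hQ (inv_pos.mpr hr))).mul_left r
  refine this.congr fun n => ?_
  rw [show (-(n : ℤ)) = 1 - ((n + 1 : ℕ) : ℤ) by push_cast; ring, thetaCoeff_one_sub, norm_neg,
    zpow_sub₀ hr.ne', zpow_natCast, inv_pow]
  have : r ^ (n + 1) ≠ 0 := by positivity
  simp only [zpow_one]
  field_simp

lemma EntireLaurent.summable {a : ℤ → ℂ} (ha : EntireLaurent a) {w : ℂ} (hw : w ≠ 0) :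
    Summable fun n => a n * w ^ n := by
  refine .of_norm ((ha ‖w‖ (norm_pos_iff.mpr hw)).congr fun n => ?_)
  simp

lemma EntireLaurent.summable_coeff {a : ℤ → ℂ} (ha : EntireLaurent a) : Summable a := by
  simpa using ha.summable one_ne_zero

lemma EntireLaurent.int_mul {a : ℤ → ℂ} (ha : EntireLaurent a) :
    EntireLaurent fun n => n * a n := by
  intro r hr
  refine .of_nonneg_of_le (fun n => by positivity) (fun n => ?_)
    ((ha (2 * r) (by positivity)).add (ha (r / 2) (by positivity)))
  -- Since |n| ≤ 2ⁿ + 2⁻ⁿ, the factor n at radius r is absorbed by convergence at the radii 2r and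
  -- r/2.
  have hn : |(n : ℝ)| ≤ 2 ^ n + (2 ^ n)⁻¹ := by
    have key (m : ℕ) : (m : ℝ) ≤ 2 ^ m := by exact_mod_cast Nat.lt_two_pow_self.le
    obtain ⟨m, rfl | rfl⟩ := n.eq_nat_or_neg
    · have := key m
      simp only [Int.cast_natCast, Nat.abs_cast, zpow_natCast]
      have : (0 : ℝ) < (2 ^ m)⁻¹ := by positivity
      linarith
    · have := key m
      simp only [Int.cast_neg, Int.cast_natCast, abs_neg, Nat.abs_cast, zpow_neg, zpow_natCast,
        inv_inv]
      have : (0 : ℝ) < (2 ^ m)⁻¹ := by positivity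
      linarith
  have h2 : ‖(n : ℂ)‖ = |(n : ℝ)| := by simp
  rw [norm_mul, h2, mul_zpow, div_zpow]
  have := mul_le_mul_of_nonneg_right hn (show 0 ≤ ‖a n‖ * r ^ n by positivity)
  have h3 : (2 : ℝ) ^ n ≠ 0 := by positivity
  calc |(n : ℝ)| * ‖a n‖ * r ^ n = |(n : ℝ)| * (‖a n‖ * r ^ n) := by ring
    _ ≤ _ := this
    _ = _ := by field_simp

/-- Convolution of Laurent coefficients. -/
noncomputable def laurentConv (a b : ℤ → ℂ) (n : ℤ) : ℂ := ∑' k, a (n - k) * b k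

/-- The shear `(n, k) ↦ (n - k, k)` of `ℤ × ℤ`. -/
def intShear : ℤ × ℤ ≃ ℤ × ℤ where
  toFun p := (p.1 - p.2, p.2)
  invFun p := (p.1 + p.2, p.2)
  left_inv p := by simp
  right_inv p := by simp

lemma summable_laurentConv_prod {a b : ℤ → ℂ} {r : ℝ} (hr : 0 < r)
    (ha : Summable fun n => ‖a n‖ * r ^ n) (hb : Summable fun n => ‖b n‖ * r ^ n) :
    Summable fun p : ℤ × ℤ => ‖a (p.1 - p.2) * b p.2‖ * r ^ p.1 := by
  have h := ha.mul_of_nonneg hb (fun n => by positivity) (fun n => by positivity)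
  rw [← intShear.summable_iff] at h
  refine h.congr fun p => ?_
  simp only [intShear, Function.comp_apply, Equiv.coe_fn_mk, norm_mul]
  rw [zpow_sub₀ hr.ne']
  field_simp

lemma summable_laurentConv_term {a b : ℤ → ℂ} {r : ℝ} (hr : 0 < r)
    (ha : Summable fun n => ‖a n‖ * r ^ n) (hb : Summable fun n => ‖b n‖ * r ^ n) (n : ℤ) :
    Summable fun k => a (n - k) * b k := by
  have := (summable_laurentConv_prod hr ha hb).prod_factor n
  refine .of_norm ((this.mul_right ((r ^ n)⁻¹)).congr fun k => ?_)
  have : r ^ n ≠ 0 := by positivity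
  field_simp

lemma summable_laurentConv {a b : ℤ → ℂ} {r : ℝ} (hr : 0 < r)
    (ha : Summable fun n => ‖a n‖ * r ^ n) (hb : Summable fun n => ‖b n‖ * r ^ n) :
    Summable fun n => ‖laurentConv a b n‖ * r ^ n := by
  have h := summable_laurentConv_prod hr ha hb
  refine .of_nonneg_of_le (fun n => by positivity) (fun n => ?_) h.prod
  simp only [tsum_mul_right]
  gcongr
  exact norm_tsum_le_tsum_norm (summable_laurentConv_term hr ha hb n).norm

lemma EntireLaurent.conv {a b : ℤ → ℂ} (ha : EntireLaurent a) (hb : EntireLaurent b) :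
    EntireLaurent (laurentConv a b) :=
  fun r hr => summable_laurentConv hr (ha r hr) (hb r hr)

lemma tsum_laurentConv {a b : ℤ → ℂ} {w : ℂ} (hw : w ≠ 0)
    (ha : Summable fun n => ‖a n‖ * ‖w‖ ^ n) (hb : Summable fun n => ‖b n‖ * ‖w‖ ^ n) :
    ∑' n, laurentConv a b n * w ^ n = (∑' n, a n * w ^ n) * ∑' n, b n * w ^ n := by
  have hr : 0 < ‖w‖ := norm_pos_iff.mpr hw
  rw [tsum_mul_tsum_of_summable_norm (ha.congr fun n => by simp) (hb.congr fun n => by simp),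
    ← intShear.tsum_eq]
  have h : ∀ p : ℤ × ℤ, a (intShear p).1 * w ^ (intShear p).1 *
      (b (intShear p).2 * w ^ (intShear p).2) = a (p.1 - p.2) * b p.2 * w ^ p.1 := by
    intro p
    simp only [intShear, Equiv.coe_fn_mk]
    rw [zpow_sub₀ hw]
    field_simp
  simp_rw [h]
  rw [Summable.tsum_prod]
  · simp_rw [tsum_mul_right]
    rfl
  · exact .of_norm ((summable_laurentConv_prod hr ha hb).congr fun p => by simp)

lemma EntireLaurent.tsum_conv {a b : ℤ → ℂ} (ha : EntireLaurent a) (hb : EntireLaurent b)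
    {w : ℂ} (hw : w ≠ 0) :
    ∑' n, laurentConv a b n * w ^ n = (∑' n, a n * w ^ n) * ∑' n, b n * w ^ n :=
  tsum_laurentConv hw (ha _ (norm_pos_iff.mpr hw)) (hb _ (norm_pos_iff.mpr hw))

lemma EntireLaurent.tsum_conv_one {a b : ℤ → ℂ} (ha : EntireLaurent a) (hb : EntireLaurent b) :
    ∑' n, laurentConv a b n = (∑' n, a n) * ∑' n, b n := by
  simpa using ha.tsum_conv hb one_ne_zero

lemma EntireLaurent.summable_term {a b : ℤ → ℂ} (ha : EntireLaurent a) (hb : EntireLaurent b)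
    (n : ℤ) : Summable fun k => a (n - k) * b k :=
  summable_laurentConv_term one_pos (ha 1 one_pos) (hb 1 one_pos) n

lemma EntireLaurent.int_mul_conv {a b : ℤ → ℂ} (ha : EntireLaurent a) (hb : EntireLaurent b)
    (n : ℤ) : n * laurentConv a b n =
      laurentConv (fun k => k * a k) b n + laurentConv a (fun k => k * b k) n := by
  rw [laurentConv, laurentConv, laurentConv,
    ← (ha.int_mul.summable_term hb n).tsum_add (ha.summable_term hb.int_mul n), ← tsum_mul_left]
  refine tsum_congr fun k => ?_
  push_cast
  ring

lemma EntireLaurent.tsum_int_mul_conv {a b : ℤ → ℂ} (ha : EntireLaurent a)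
    (hb : EntireLaurent b) : ∑' n : ℤ, n * laurentConv a b n =
      (∑' n : ℤ, n * a n) * (∑' n, b n) + (∑' n, a n) * ∑' n : ℤ, n * b n := by
  simp_rw [ha.int_mul_conv hb]
  rw [(ha.int_mul.conv hb).summable_coeff.tsum_add (ha.conv hb.int_mul).summable_coeff,
    ha.int_mul.tsum_conv_one hb, ha.tsum_conv_one hb.int_mul]

lemma EntireLaurent.tsum_int_mul_int_mul_conv {a b : ℤ → ℂ} (ha : EntireLaurent a)
    (hb : EntireLaurent b) : ∑' n : ℤ, n * (n * laurentConv a b n) =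
      (∑' n : ℤ, n * (n * a n)) * (∑' n, b n) + 2 * ((∑' n : ℤ, n * a n) * ∑' n : ℤ, n * b n)
        + (∑' n, a n) * ∑' n : ℤ, n * (n * b n) := by
  simp_rw [ha.int_mul_conv hb, mul_add]
  rw [(ha.int_mul.conv hb).int_mul.summable_coeff.tsum_add
    (ha.conv hb.int_mul).int_mul.summable_coeff,
    ha.int_mul.tsum_int_mul_conv hb, ha.tsum_int_mul_conv hb.int_mul]
  ring

/-- Quasi-periodicity is multiplicative: under products degrees add and multipliers multiply. The
substitution k ↦ k + q scales every term by the same factor, so no convergence is needed. -/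
lemma laurentConv_shift {Q : ℂ} (hQ : Q ≠ 0) {a b : ℤ → ℂ} {p q : ℤ} {ε δ : ℂ}
    (ha : ∀ n, a (n + p) = ε * Q ^ n * a n) (hb : ∀ n, b (n + q) = δ * Q ^ n * b n) (n : ℤ) :
    laurentConv a b (n + (p + q)) = ε * δ * Q ^ n * laurentConv a b n := by
  rw [laurentConv, laurentConv, ← (Equiv.addRight q).tsum_eq, ← tsum_mul_left]
  refine tsum_congr fun k => ?_
  simp only [Equiv.coe_addRight]
  rw [show n + (p + q) - (k + q) = (n - k) + p by ring, ha, hb, zpow_sub₀ hQ]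
  have := zpow_ne_zero k hQ
  field_simp

lemma laurentConv_reflect {a b : ℤ → ℂ} {p q : ℤ} {ε δ : ℂ}
    (ha : ∀ n, a (p - n) = ε * a n) (hb : ∀ n, b (q - n) = δ * b n) (n : ℤ) :
    laurentConv a b (p + q - n) = ε * δ * laurentConv a b n := by
  rw [laurentConv, laurentConv, ← (Equiv.subLeft q).tsum_eq, ← tsum_mul_left]
  refine tsum_congr fun k => ?_
  simp only [Equiv.subLeft_apply]
  rw [show p + q - n - (q - k) = p - (n - k) by ring, ha, hb]
  ring

/-- The recursion has invertible factors, so it propagates zeros in both directions. Hence a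
quasi-periodic series of degree p is determined by p consecutive coefficients; this is the
uniqueness principle used below. -/
lemma eq_zero_of_shift {Q : ℂ} (hQ : Q ≠ 0) {p : ℕ} (hp : 0 < p) {ε : ℂ} (hε : ε ≠ 0) {d : ℤ → ℂ}
    (hd : ∀ n, d (n + p) = ε * Q ^ n * d n) (h0 : ∀ n : ℤ, 0 ≤ n → n < p → d n = 0) (n : ℤ) :
    d n = 0 := by
  have key (m : ℤ) : ∀ r : ℤ, 0 ≤ r → r < p → d (r + p * m) = 0 := by
    induction m using Int.induction_on with
    | zero => simpa using h0
    | succ i ih =>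
      intro r h1 h2
      rw [show r + p * ((i : ℤ) + 1) = (r + p * i) + p by ring, hd, ih r h1 h2, mul_zero]
    | pred i ih =>
      intro r h1 h2
      have := hd (r + p * (-(i : ℤ) - 1))
      rw [show r + p * (-(i : ℤ) - 1) + p = r + p * (-i) by ring, ih r h1 h2] at this
      rcases mul_eq_zero.mp this.symm with h | h
      · exact absurd h (mul_ne_zero hε (zpow_ne_zero _ hQ))
      · exact h
  have h := key (n / p) (n % p) (Int.emod_nonneg _ (by omega)) (Int.emod_lt_of_pos _ (by omega))
  rwa [Int.emod_add_mul_ediv] at h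

/-- The antisymmetry n ↦ 1 - n forces θ(1) = 0. -/
lemma tsum_thetaCoeff (Q : ℂ) : ∑' n, thetaCoeff Q n = 0 := by
  have h := (Equiv.subLeft (1 : ℤ)).tsum_eq (thetaCoeff Q)
  simp only [Equiv.subLeft_apply, thetaCoeff_one_sub, tsum_neg] at h
  have h2 : (2 : ℂ) * ∑' n, thetaCoeff Q n = 0 := by linear_combination -h
  simpa using h2

/-- The Laurent coefficients of the square of the theta series. -/
noncomputable def thetaSqCoeff (Q : ℂ) : ℤ → ℂ := laurentConv (thetaCoeff Q) (thetaCoeff Q)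

/-- The Laurent coefficients of the fourth power of the theta series. -/
noncomputable def thetaFourCoeff (Q : ℂ) : ℤ → ℂ :=
  laurentConv (thetaSqCoeff Q) (thetaSqCoeff Q)

section
variable {Q : ℂ} (hQ0 : Q ≠ 0) (hQ : ‖Q‖ < 1)
include hQ0

lemma thetaSqCoeff_shift (n : ℤ) : thetaSqCoeff Q (n + 2) = Q ^ n * thetaSqCoeff Q n := by
  have := laurentConv_shift hQ0 (p := 1) (q := 1) (ε := -1) (δ := -1) (a := thetaCoeff Q)
    (b := thetaCoeff Q) (fun n => by rw [thetaCoeff_succ hQ0]; ring)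
    (fun n => by rw [thetaCoeff_succ hQ0]; ring) n
  simpa [thetaSqCoeff] using this

lemma thetaFourCoeff_shift (n : ℤ) :
    thetaFourCoeff Q (n + 4) = Q ^ n * thetaFourCoeff Q n := by
  have h (n : ℤ) : thetaSqCoeff Q (n + 2) = 1 * Q ^ n * thetaSqCoeff Q n := by
    rw [thetaSqCoeff_shift hQ0, one_mul]
  have := laurentConv_shift hQ0 h h n
  simpa [thetaFourCoeff] using this

omit hQ0 in
lemma thetaSqCoeff_reflect (n : ℤ) : thetaSqCoeff Q (2 - n) = thetaSqCoeff Q n := by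
  have h (n : ℤ) : thetaCoeff Q (1 - n) = -1 * thetaCoeff Q n := by
    rw [thetaCoeff_one_sub, neg_one_mul]
  have := laurentConv_reflect h h n
  simpa [thetaSqCoeff] using this

omit hQ0 in
lemma thetaFourCoeff_reflect (n : ℤ) : thetaFourCoeff Q (4 - n) = thetaFourCoeff Q n := by
  have h (n : ℤ) : thetaSqCoeff Q (2 - n) = 1 * thetaSqCoeff Q n := by
    rw [thetaSqCoeff_reflect, one_mul]
  have := laurentConv_reflect h h n
  simpa [thetaFourCoeff] using this

include hQ

lemma entireLaurent_thetaSqCoeff : EntireLaurent (thetaSqCoeff Q) :=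
  (entireLaurent_thetaCoeff hQ0 hQ).conv (entireLaurent_thetaCoeff hQ0 hQ)

lemma entireLaurent_thetaFourCoeff : EntireLaurent (thetaFourCoeff Q) :=
  (entireLaurent_thetaSqCoeff hQ0 hQ).conv (entireLaurent_thetaSqCoeff hQ0 hQ)

lemma tsum_thetaSqCoeff_mul_zpow {w : ℂ} (hw : w ≠ 0) :
    ∑' n, thetaSqCoeff Q n * w ^ n = thetaSeries Q w ^ 2 := by
  have h := entireLaurent_thetaCoeff hQ0 hQ
  rw [thetaSqCoeff, h.tsum_conv h hw, sq, thetaSeries]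

lemma tsum_thetaFourCoeff_mul_zpow {w : ℂ} (hw : w ≠ 0) :
    ∑' n, thetaFourCoeff Q n * w ^ n = thetaSeries Q w ^ 4 := by
  have h := entireLaurent_thetaSqCoeff hQ0 hQ
  rw [thetaFourCoeff, h.tsum_conv h hw, tsum_thetaSqCoeff_mul_zpow hQ0 hQ hw]
  ring

/-- θ⁴ vanishes to order four at w = 1, so the moments of orders 0, 1 and 2 of its coefficients
vanish; expanding (N - k)² leaves nothing. This annihilates the k² defect in the recursions of the
Lambert coefficients. -/
lemma tsum_thetaFourCoeff_mul_sq (N : ℤ) :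
    ∑' k : ℤ, thetaFourCoeff Q (N - k) * (k : ℂ) ^ 2 = 0 := by
  have h1 := entireLaurent_thetaCoeff hQ0 hQ
  have h2 := entireLaurent_thetaSqCoeff hQ0 hQ
  have h4 := entireLaurent_thetaFourCoeff hQ0 hQ
  have s0 : ∑' n, thetaSqCoeff Q n = 0 := by
    rw [thetaSqCoeff, h1.tsum_conv_one h1, tsum_thetaCoeff, zero_mul]
  have s1 : ∑' n : ℤ, n * thetaSqCoeff Q n = 0 := by
    rw [thetaSqCoeff, h1.tsum_int_mul_conv h1, tsum_thetaCoeff]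
    simp
  have m0 : ∑' n, thetaFourCoeff Q n = 0 := by
    rw [thetaFourCoeff, h2.tsum_conv_one h2, s0, zero_mul]
  have m1 : ∑' n : ℤ, n * thetaFourCoeff Q n = 0 := by
    rw [thetaFourCoeff, h2.tsum_int_mul_conv h2, s0]
    simp
  have m2 : ∑' n : ℤ, n * (n * thetaFourCoeff Q n) = 0 := by
    rw [thetaFourCoeff, h2.tsum_int_mul_int_mul_conv h2, s0, s1]
    simp
  rw [← (Equiv.subLeft N).tsum_eq]
  simp only [Equiv.subLeft_apply, sub_sub_cancel]
  have hs0 := h4.summable_coeff.mul_left ((N : ℂ) ^ 2)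
  have hs1 := h4.int_mul.summable_coeff.mul_left (-2 * (N : ℂ))
  have hs2 := h4.int_mul.int_mul.summable_coeff
  have := (hs0.add hs1).tsum_add hs2
  rw [hs0.tsum_add hs1, tsum_mul_left, tsum_mul_left, m0, m1, m2] at this
  simp only [mul_zero, add_zero] at this
  rw [← this]
  refine tsum_congr fun k => ?_
  push_cast
  ring

end

/-! ### Infinite products and the Jacobi triple product -/

/-- The infinite `q`-Pochhammer symbol `∏_{n ≥ 0} (1 - a Q^n)`. -/
noncomputable def qProd (a Q : ℂ) : ℂ := ∏' n : ℕ, (1 - a * Q ^ n)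

lemma summable_norm_mul_pow (a : ℂ) {Q : ℂ} (hQ : ‖Q‖ < 1) :
    Summable fun n : ℕ => ‖-(a * Q ^ n)‖ := by
  simpa using (summable_geometric_of_lt_one (norm_nonneg Q) hQ).mul_left ‖a‖

lemma multipliable_qProd (a : ℂ) {Q : ℂ} (hQ : ‖Q‖ < 1) :
    Multipliable fun n : ℕ => 1 - a * Q ^ n := by
  simpa [sub_eq_add_neg] using multipliable_one_add_of_summable (summable_norm_mul_pow a hQ)

lemma tendsto_qProd (a : ℂ) {Q : ℂ} (hQ : ‖Q‖ < 1) :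
    Tendsto (fun N => ∏ n ∈ Finset.range N, (1 - a * Q ^ n)) atTop (𝓝 (qProd a Q)) :=
  (multipliable_qProd a hQ).tendsto_prod_tprod_nat

lemma qProd_ne_zero {a Q : ℂ} (hQ : ‖Q‖ < 1) (h : ∀ n : ℕ, a * Q ^ n ≠ 1) : qProd a Q ≠ 0 := by
  have := tprod_one_add_ne_zero_of_summable (f := fun n : ℕ => -(a * Q ^ n))
    (fun n => by
      rw [← sub_eq_add_neg]
      exact sub_ne_zero.mpr (h n).symm) (summable_norm_mul_pow a hQ)
  simpa [qProd, sub_eq_add_neg] using this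

lemma qProd_ne_zero_of_norm_lt {a Q : ℂ} (hQ : ‖Q‖ < 1) (ha : ‖a‖ < 1) : qProd a Q ≠ 0 := by
  refine qProd_ne_zero hQ fun n h => ?_
  have h1 : ‖a * Q ^ n‖ < 1 := by
    rw [norm_mul, norm_pow]
    exact (mul_le_of_le_one_right (norm_nonneg _) (pow_le_one₀ (norm_nonneg _) hQ.le)).trans_lt ha
  rw [h] at h1
  simp at h1

lemma qProd_eq_mul (a : ℂ) {Q : ℂ} (hQ : ‖Q‖ < 1) : qProd a Q = (1 - a) * qProd (a * Q) Q := by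
  have h := tendsto_qProd a hQ
  rw [← tendsto_add_atTop_iff_nat 1] at h
  refine tendsto_nhds_unique h (((tendsto_qProd (a * Q) hQ).const_mul (1 - a)).congr fun N => ?_)
  rw [Finset.prod_range_succ', mul_comm]
  simp [pow_succ', mul_assoc]

lemma norm_pow_lt_one {Q : ℂ} (hQ : ‖Q‖ < 1) {k : ℕ} (hk : k ≠ 0) : ‖Q ^ k‖ < 1 := by
  rw [norm_pow]
  exact pow_lt_one₀ (norm_nonneg _) hQ hk

lemma qProd_split_two (a : ℂ) {Q : ℂ} (hQ : ‖Q‖ < 1) :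
    qProd a Q = qProd a (Q ^ 2) * qProd (a * Q) (Q ^ 2) := by
  have hQ2 := norm_pow_lt_one hQ two_ne_zero
  have h := (tendsto_qProd a hQ).comp (tendsto_id.const_mul_atTop' (two_pos : 0 < 2))
  refine tendsto_nhds_unique h
    (((tendsto_qProd a hQ2).mul (tendsto_qProd (a * Q) hQ2)).congr fun N => ?_)
  rw [← Finset.prod_mul_distrib]
  simp only [Function.comp_apply, id]
  induction N with
  | zero => simp
  | succ N ih =>
    rw [Finset.prod_range_succ, ih, show 2 * (N + 1) = 2 * N + 1 + 1 by ring,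
      Finset.prod_range_succ, Finset.prod_range_succ]
    ring

lemma qProd_split_three (a : ℂ) {Q : ℂ} (hQ : ‖Q‖ < 1) :
    qProd a Q = qProd a (Q ^ 3) * qProd (a * Q) (Q ^ 3) * qProd (a * Q ^ 2) (Q ^ 3) := by
  have hQ3 := norm_pow_lt_one hQ three_ne_zero
  have h := (tendsto_qProd a hQ).comp (tendsto_id.const_mul_atTop' (three_pos : 0 < 3))
  refine tendsto_nhds_unique h ((((tendsto_qProd a hQ3).mul (tendsto_qProd (a * Q) hQ3)).mul
    (tendsto_qProd (a * Q ^ 2) hQ3)).congr fun N => ?_)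
  rw [← Finset.prod_mul_distrib, ← Finset.prod_mul_distrib]
  simp only [Function.comp_apply, id]
  induction N with
  | zero => simp
  | succ N ih =>
    rw [Finset.prod_range_succ, ih, show 3 * (N + 1) = 3 * N + 1 + 1 + 1 by ring,
      Finset.prod_range_succ, Finset.prod_range_succ, Finset.prod_range_succ]
    ring

lemma qProd_mul_neg (a : ℂ) {Q : ℂ} (hQ : ‖Q‖ < 1) :
    qProd a Q * qProd (-a) Q = qProd (a ^ 2) (Q ^ 2) := by
  have hQ2 := norm_pow_lt_one hQ two_ne_zero
  refine tendsto_nhds_unique ((tendsto_qProd a hQ).mul (tendsto_qProd (-a) hQ))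
    ((tendsto_qProd (a ^ 2) hQ2).congr fun N => ?_)
  rw [← Finset.prod_mul_distrib]
  refine Finset.prod_congr rfl fun n _ => ?_
  ring

lemma continuous_qProd {Q : ℂ} (hQ : ‖Q‖ < 1) : Continuous fun a => qProd a Q := by
  refine continuous_iff_continuousAt.mpr fun a => ?_
  have h := tendsto_tprod_one_add_of_dominated_convergence (𝓕 := 𝓝 a)
    (f := fun b (n : ℕ) => -(b * Q ^ n)) (g := fun n => -(a * Q ^ n))
    (bound := fun n => (‖a‖ + 1) * ‖Q‖ ^ n)
    ((summable_geometric_of_lt_one (norm_nonneg Q) hQ).mul_left _)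
    (fun n => (by fun_prop : Continuous fun b : ℂ => -(b * Q ^ n)).tendsto a) ?_
  · simpa [ContinuousAt, qProd, sub_eq_add_neg] using h
  · have : ∀ᶠ b in 𝓝 a, ‖b‖ < ‖a‖ + 1 :=
      continuous_norm.continuousAt.eventually_lt continuousAt_const (by linarith)
    filter_upwards [this] with b hb n
    rw [norm_neg, norm_mul, norm_pow]
    gcongr

/-- The reciprocal of `∏_{1 ≤ i ≤ k} (1 - Q^i)`, extended by zero to negative `k`. -/
noncomputable def qFactInv (Q : ℂ) (k : ℤ) : ℂ :=
  if k < 0 then 0 else (∏ i ∈ Finset.range k.toNat, (1 - Q * Q ^ i))⁻¹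

lemma one_sub_zpow_ne_zero {Q : ℂ} (hQ : ‖Q‖ < 1) {k : ℤ} (hk : k ≠ 0) :
    1 - Q ^ k ≠ 0 := by
  intro h
  have h1 : ‖Q‖ ^ k = 1 := by rw [← norm_zpow, ← sub_eq_zero.mp h, norm_one]
  exact hk ((zpow_eq_one_iff_right₀ (norm_nonneg Q) hQ.ne).mp h1)

/-- With the value zero at negative indices the recursion holds for every integer k: at k = 0 the
factor 1 - Q⁰ vanishes. -/
lemma qFactInv_pred {Q : ℂ} (hQ0 : Q ≠ 0) (hQ : ‖Q‖ < 1) (k : ℤ) :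
    qFactInv Q (k - 1) = (1 - Q ^ k) * qFactInv Q k := by
  rcases lt_trichotomy k 0 with h | rfl | h
  · simp [qFactInv, h, show k < 1 by omega]
  · simp [qFactInv]
  · obtain ⟨n, rfl⟩ : ∃ n : ℕ, k = n + 1 := ⟨(k - 1).toNat, by omega⟩
    have h1 := one_sub_zpow_ne_zero hQ h.ne'
    have h2 : ((n : ℤ) + 1).toNat = n + 1 := by omega
    rw [qFactInv, qFactInv, if_neg (by omega), if_neg (by omega), h2, Finset.prod_range_succ,
      mul_inv]
    have h3 : Q * Q ^ n = Q ^ ((n : ℤ) + 1) := by rw [zpow_add_one₀ hQ0, zpow_natCast, mul_comm]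
    rw [h3]
    simp only [add_sub_cancel_right, Int.toNat_natCast]
    field_simp

/-- The finite form of the Jacobi triple product. -/
lemma hasSum_finite_tripleProduct {Q : ℂ} (hQ0 : Q ≠ 0) (hQ : ‖Q‖ < 1) {w : ℂ} (hw : w ≠ 0)
    (N : ℕ) :
    HasSum (fun n : ℤ => thetaCoeff Q n * w ^ n *
        ((∏ i ∈ Finset.range (2 * N), (1 - Q * Q ^ i)) * qFactInv Q (N - n) * qFactInv Q (N + n)))
      (∏ n ∈ Finset.range N, ((1 - w * Q ^ n) * (1 - Q / w * Q ^ n))) := by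
  induction N with
  | zero =>
    simp only [Finset.range_zero, Finset.prod_empty]
    convert hasSum_ite_eq (0 : ℤ) (1 : ℂ) using 1
    funext n
    rcases lt_trichotomy n 0 with h | rfl | h
    · simp [qFactInv, h, h.ne]
    · simp [thetaCoeff, qFactInv]
    · simp [qFactInv, h, h.ne']
  | succ N ih =>
    -- The new factor expands as (1 - wQ^N)(1 - Q^(N+1)/w) = 1 + Q^(2N+1) - wQ^N - Q^(N+1)/w; the
    -- last two terms shift the index n by one.
    have e1 := ih.mul_left (1 + Q ^ (2 * N + 1))
    have e2 := ((Equiv.subRight (1 : ℤ)).hasSum_iff.mpr ih).mul_left (-(w * Q ^ N))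
    have e3 := ((Equiv.addRight (1 : ℤ)).hasSum_iff.mpr ih).mul_left (-(Q ^ (N + 1) / w))
    rw [Finset.prod_range_succ]
    convert! (e1.add e2).add e3 using 1
    · ext n
      simp only [Function.comp_apply, Equiv.subRight_apply, Equiv.coe_addRight]
      have t1 := thetaCoeff_succ hQ0 (n - 1)
      rw [sub_add_cancel] at t1
      have hA : ((N + 1 : ℕ) : ℤ) - n = N + 1 - n := by push_cast; ring
      have hB : ((N + 1 : ℕ) : ℤ) + n = N + 1 + n := by push_cast; ring
      -- All shifted reciprocals are expressed through those at N + 1 - n and N + 1 + n, which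
      -- leaves a rational identity in Qⁿ, Q^N and wⁿ.
      have a1 := qFactInv_pred hQ0 hQ (N + 1 - n)
      have a2 := qFactInv_pred hQ0 hQ (N + 1 - n - 1)
      have b1 := qFactInv_pred hQ0 hQ (N + 1 + n)
      have b2 := qFactInv_pred hQ0 hQ (N + 1 + n - 1)
      rw [hA, hB, show (N : ℤ) - n = N + 1 - n - 1 by ring, show (N : ℤ) + n = N + 1 + n - 1 by ring,
        show (N : ℤ) - (n - 1) = N + 1 - n by ring, show (N : ℤ) + (n - 1) = N + 1 + n - 1 - 1 by ring,
        show (N : ℤ) - (n + 1) = N + 1 - n - 1 - 1 by ring, show (N : ℤ) + (n + 1) = N + 1 + n by ring,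
        a2, b2, a1, b1, thetaCoeff_succ hQ0 n, t1]
      generalize qFactInv Q (N + 1 - n) = X
      generalize qFactInv Q (N + 1 + n) = Y
      generalize thetaCoeff Q (n - 1) = t
      rw [show 2 * (N + 1) = 2 * N + 1 + 1 by ring, Finset.prod_range_succ, Finset.prod_range_succ]
      generalize ∏ i ∈ Finset.range (2 * N), (1 - Q * Q ^ i) = F
      have hn := zpow_ne_zero n hQ0
      have hwn := zpow_ne_zero n hw
      have hN := pow_ne_zero N hQ0
      simp only [zpow_add₀ hQ0, zpow_sub₀ hQ0, zpow_one, zpow_natCast, zpow_sub₀ hw, zpow_add₀ hw,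
        pow_succ, pow_mul']
      generalize Q ^ n = z at *
      generalize Q ^ N = s at *
      generalize w ^ n = v at *
      field_simp
      ring
    · have hN := pow_ne_zero N hQ0
      field_simp
      ring_nf

/-- The **Jacobi triple product**. -/
theorem thetaSeries_eq_qProd {Q : ℂ} (hQ0 : Q ≠ 0) (hQ : ‖Q‖ < 1) {w : ℂ} (hw : w ≠ 0) :
    thetaSeries Q w = qProd Q Q * (qProd w Q * qProd (Q / w) Q) := by
  have hE : qProd Q Q ≠ 0 := qProd_ne_zero_of_norm_lt hQ hQ
  have hF := tendsto_qProd Q hQ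
  have hI : Tendsto (fun N : ℕ => qFactInv Q N) atTop (𝓝 (qProd Q Q)⁻¹) := by
    refine (hF.inv₀ hE).congr fun N => ?_
    simp [qFactInv]
  obtain ⟨C, hC⟩ := (Metric.isBounded_range_of_tendsto _ hF).exists_norm_le
  obtain ⟨D, hD⟩ := (Metric.isBounded_range_of_tendsto _ hI).exists_norm_le
  have hD0 : 0 ≤ D := (norm_nonneg _).trans (hD _ ⟨0, rfl⟩)
  have hC0 : 0 ≤ C := (norm_nonneg _).trans (hC _ ⟨0, rfl⟩)
  have hD' (k : ℤ) : ‖qFactInv Q k‖ ≤ D := by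
    rcases lt_or_ge k 0 with h | h
    · simpa [qFactInv, h] using hD0
    · lift k to ℕ using h
      exact hD _ ⟨k, rfl⟩
  have hsum := (entireLaurent_thetaCoeff hQ0 hQ) ‖w‖ (norm_pos_iff.mpr hw)
  -- Tannery's theorem: C bounds the finite products and D their reciprocals, uniformly in N and n.
  have hlim := tendsto_tsum_of_dominated_convergence (𝓕 := atTop)
    (f := fun (N : ℕ) (n : ℤ) => thetaCoeff Q n * w ^ n *
        ((∏ i ∈ Finset.range (2 * N), (1 - Q * Q ^ i)) * qFactInv Q (N - n) * qFactInv Q (N + n)))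
    (g := fun n => thetaCoeff Q n * w ^ n * (qProd Q Q * (qProd Q Q)⁻¹ * (qProd Q Q)⁻¹))
    (bound := fun n => ‖thetaCoeff Q n‖ * ‖w‖ ^ n * (C * D * D)) (hsum.mul_right _) ?_ ?_
  · simp_rw [(hasSum_finite_tripleProduct hQ0 hQ hw _).tsum_eq] at hlim
    simp_rw [Finset.prod_mul_distrib] at hlim
    have h2 := tendsto_nhds_unique hlim ((tendsto_qProd w hQ).mul (tendsto_qProd (Q / w) hQ))
    rw [tsum_mul_right] at h2
    rw [← h2, thetaSeries]
    field_simp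
  · intro n
    have hcomp (m : ℤ) : Tendsto (fun N : ℕ => qFactInv Q (N + m)) atTop (𝓝 (qProd Q Q)⁻¹) := by
      have : Tendsto (fun N : ℕ => ((N : ℤ) + m).toNat) atTop atTop :=
        tendsto_atTop.mpr fun b => eventually_atTop.mpr ⟨b + m.natAbs, fun N hN => by omega⟩
      refine (hI.comp this).congr' (eventually_atTop.mpr ⟨m.natAbs, fun N hN => ?_⟩)
      simp only [Function.comp_apply]
      rw [Int.toNat_of_nonneg (by omega)]
    have h2 := hF.comp (tendsto_id.const_mul_atTop' (two_pos : 0 < 2))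
    have := ((h2.mul (hcomp (-n))).mul (hcomp n)).const_mul (thetaCoeff Q n * w ^ n)
    simpa [sub_eq_add_neg] using this
  · refine Eventually.of_forall fun N n => ?_
    simp only [norm_mul, norm_zpow]
    gcongr
    · exact hC _ ⟨2 * N, by simp⟩
    · exact hD' _
    · exact hD' _

lemma tendsto_ofReal_nhdsLT_one : Tendsto (fun r : ℝ => (r : ℂ)) (𝓝[<] 1) (𝓝 1) := by
  have := (Complex.continuous_ofReal.tendsto 1).mono_left (nhdsWithin_le_nhds (s := Set.Iio 1))
  simpa using this

lemma eventually_mem_Ioo_nhdsLT_one {a : ℝ} (ha : a < 1) : ∀ᶠ r : ℝ in 𝓝[<] 1, r ∈ Set.Ioo a 1 :=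
  Ioo_mem_nhdsLT ha

/-- The triple product contains the simple factor 1 - w; without it, three Euler products remain at
w = 1. This limit is the source of Jacobi's cube formula and of the constant in the ℘' formula. -/
lemma tendsto_thetaSeries_div {Q : ℂ} (hQ0 : Q ≠ 0) (hQ : ‖Q‖ < 1) :
    Tendsto (fun r : ℝ => thetaSeries Q r / (1 - r)) (𝓝[<] 1) (𝓝 (qProd Q Q ^ 3)) := by
  have h1 : Tendsto (fun w : ℂ => qProd Q Q * (qProd (w * Q) Q * qProd (Q / w) Q)) (𝓝 1)
      (𝓝 (qProd Q Q * (qProd (1 * Q) Q * qProd (Q / 1) Q))) := by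
    have c1 : ContinuousAt (fun w : ℂ => Q / w) 1 :=
      continuousAt_const.div continuousAt_id one_ne_zero
    refine ContinuousAt.tendsto (f := fun w : ℂ => qProd Q Q * (qProd (w * Q) Q * qProd (Q / w) Q))
      ?_
    exact continuousAt_const.mul (((continuous_qProd hQ).continuousAt.comp (by fun_prop)).mul
      ((continuous_qProd hQ).continuousAt.comp c1))
  rw [show qProd Q Q * (qProd (1 * Q) Q * qProd (Q / 1) Q) = qProd Q Q ^ 3 by
    rw [one_mul, div_one]; ring] at h1
  refine (h1.comp tendsto_ofReal_nhdsLT_one).congr' ?_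
  filter_upwards [eventually_mem_Ioo_nhdsLT_one (show (0 : ℝ) < 1 by norm_num)] with r hr
  have hr0 : (r : ℂ) ≠ 0 := by exact_mod_cast hr.1.ne'
  have hr1 : (1 : ℂ) - r ≠ 0 := sub_ne_zero.mpr (by exact_mod_cast hr.2.ne')
  simp only [Function.comp_apply]
  rw [thetaSeries_eq_qProd hQ0 hQ hr0, qProd_eq_mul r hQ]
  field_simp

/-- Pairing the index k + 1 with -k, whose coefficients are opposite, makes every term divisible by
1 - w. -/
lemma thetaSeries_eq_tsum_nat {Q : ℂ} (hQ0 : Q ≠ 0) (hQ : ‖Q‖ < 1) {w : ℂ} (hw : w ≠ 0) :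
    thetaSeries Q w = ∑' k : ℕ, thetaCoeff Q (k + 1) * (w ^ ((k : ℤ) + 1) - w ^ (-(k : ℤ))) := by
  have hs := (entireLaurent_thetaCoeff hQ0 hQ).summable hw
  obtain ⟨F, hF⟩ : ∃ F : ℤ → ℂ, F = fun n => thetaCoeff Q n * w ^ n := ⟨_, rfl⟩
  rw [← hF] at hs
  have s1 : Summable fun n : ℕ => F ((n : ℤ) + 1) :=
    hs.comp_injective (i := fun n : ℕ => (n : ℤ) + 1) fun a b h => by simpa using h
  have s2 : Summable fun n : ℕ => F (-((n : ℤ) + 1) + 1) :=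
    hs.comp_injective (i := fun n : ℕ => -((n : ℤ) + 1) + 1) fun a b h => by simpa using h
  have h := (HasSum.of_nat_of_neg_add_one (f := fun n : ℤ => F (n + 1)) s1.hasSum s2.hasSum).tsum_eq
  rw [thetaSeries, ← hF, ← (Equiv.addRight (1 : ℤ)).tsum_eq]
  simp only [Equiv.coe_addRight]
  rw [h, ← s1.tsum_add s2]
  refine tsum_congr fun k => ?_
  have : thetaCoeff Q (-((k : ℤ) + 1) + 1) = -thetaCoeff Q (k + 1) := by
    rw [← thetaCoeff_one_sub]
    congr 1
  simp only [hF, this]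
  rw [show -((k : ℤ) + 1) + 1 = -k by ring]
  ring

/-- Jacobi's identity for the cube of the Euler product. -/
theorem qProd_cube {Q : ℂ} (hQ0 : Q ≠ 0) (hQ : ‖Q‖ < 1) :
    qProd Q Q ^ 3 = ∑' k : ℕ, (-1) ^ k * (2 * k + 1) * Q ^ (k * (k + 1) / 2) := by
  have ht (k : ℕ) : thetaCoeff Q (k + 1) = -((-1) ^ k * Q ^ (k * (k + 1) / 2)) := by
    have : ((k : ℤ) + 1) * (k + 1 - 1) / 2 = ((k * (k + 1) / 2 : ℕ) : ℤ) := by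
      push_cast
      congr 1
      ring
    rw [thetaCoeff, this, zpow_natCast, zpow_add_one₀ (by norm_num), zpow_natCast]
    ring
  -- Up to sign, (r^(k+1) - r^(-k)) / (1 - r) is r^(-k) times a geometric sum of 2k + 1 terms. For
  -- 1/2 < r < 1 it is at most 2^k (2k + 1), and at r = 1 it equals 2k + 1.
  have hlim := tendsto_tsum_of_dominated_convergence (𝓕 := 𝓝[<] (1 : ℝ))
    (f := fun (r : ℝ) (k : ℕ) => (-1) ^ k * Q ^ (k * (k + 1) / 2) *
      (((r : ℂ) ^ k)⁻¹ * ∑ i ∈ Finset.range (2 * k + 1), (r : ℂ) ^ i))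
    (g := fun k => (-1) ^ k * Q ^ (k * (k + 1) / 2) * (((1 : ℂ) ^ k)⁻¹ *
      ∑ i ∈ Finset.range (2 * k + 1), (1 : ℂ) ^ i))
    (bound := fun k => ‖thetaCoeff Q (k + 1)‖ * (2 ^ k * (2 * k + 1))) ?_ ?_ ?_
  · have h3 : ∑' k : ℕ, (-1 : ℂ) ^ k * (2 * k + 1) * Q ^ (k * (k + 1) / 2) =
        ∑' k : ℕ, (-1) ^ k * Q ^ (k * (k + 1) / 2) * (((1 : ℂ) ^ k)⁻¹ *
      ∑ i ∈ Finset.range (2 * k + 1), (1 : ℂ) ^ i) := by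
      refine tsum_congr fun k => ?_
      simp
      ring
    rw [h3]
    refine tendsto_nhds_unique (tendsto_thetaSeries_div hQ0 hQ) (hlim.congr' ?_)
    filter_upwards [eventually_mem_Ioo_nhdsLT_one (show (0 : ℝ) < 1 by norm_num)] with r hr
    have hr0 : (r : ℂ) ≠ 0 := by exact_mod_cast hr.1.ne'
    have hr1' : (r : ℂ) ≠ 1 := by exact_mod_cast hr.2.ne
    have hr1 : (1 : ℂ) - r ≠ 0 := sub_ne_zero.mpr hr1'.symm
    rw [thetaSeries_eq_tsum_nat hQ0 hQ hr0, ← tsum_div_const]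
    refine tsum_congr fun k => ?_
    have hg := geom_sum_eq hr1' (2 * k + 1)
    have hr2 : (r : ℂ) - 1 ≠ 0 := sub_ne_zero.mpr hr1'
    rw [ht, hg, zpow_neg, zpow_natCast, zpow_add_one₀ hr0, zpow_natCast]
    have := pow_ne_zero k hr0
    field_simp
    ring
  -- Radius 4 suffices because 2^k (2k + 1) ≤ 4^(k+1).
  · have h := summable_norm_thetaCoeff_nat hQ0 hQ (show (0 : ℝ) < 4 by norm_num)
    have h' := ((summable_nat_add_iff 1).mpr h)
    refine .of_nonneg_of_le (fun k => by positivity) (fun k => ?_) h'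
    push_cast
    gcongr
    have : (k : ℝ) + 1 ≤ 2 ^ k := by exact_mod_cast Nat.lt_two_pow_self
    have h4 : (4 : ℝ) ^ (k + 1) = 4 * (2 ^ k * 2 ^ k) := by
      rw [← mul_pow, pow_succ']; norm_num
    have h2 : (0 : ℝ) < 2 ^ k := by positivity
    rw [h4]
    nlinarith
  · intro k
    have hc : ContinuousAt (fun w : ℂ => (-1) ^ k * Q ^ (k * (k + 1) / 2) *
      ((w ^ k)⁻¹ * ∑ i ∈ Finset.range (2 * k + 1), w ^ i)) 1 := by
      have : ContinuousAt (fun w : ℂ => (w ^ k)⁻¹) 1 :=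
        (continuousAt_id.pow k).inv₀ (by simp)
      fun_prop
    exact hc.tendsto.comp tendsto_ofReal_nhdsLT_one
  · filter_upwards [eventually_mem_Ioo_nhdsLT_one (show (1 / 2 : ℝ) < 1 by norm_num)] with r hr k
    have hr0 : 0 < r := by linarith [hr.1]
    have hn : ‖(r : ℂ)‖ = r := by simp [abs_of_pos hr0]
    have e1 : ‖((r : ℂ) ^ k)⁻¹‖ ≤ 2 ^ k := by
      rw [norm_inv, norm_pow, hn, ← inv_pow]
      exact pow_le_pow_left₀ (by positivity) (inv_le_of_inv_le₀ (by norm_num) (by linarith [hr.1])) k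
    have e2 : ‖∑ i ∈ Finset.range (2 * k + 1), (r : ℂ) ^ i‖ ≤ 2 * k + 1 := by
      refine (norm_sum_le_of_le (Finset.range (2 * k + 1)) (f := fun i => (r : ℂ) ^ i)
        (n := fun _ => 1) fun i _ => ?_).trans (by simp)
      rw [norm_pow, hn]
      exact pow_le_one₀ hr0.le hr.2.le
    rw [ht, norm_neg, norm_mul ((-1) ^ k * Q ^ (k * (k + 1) / 2)), norm_mul ((r : ℂ) ^ k)⁻¹]
    gcongr

/-! ### The product formula for the derivative of the Weierstrass function -/

lemma continuousAt_thetaSeries {Q : ℂ} (hQ0 : Q ≠ 0) (hQ : ‖Q‖ < 1) {w : ℂ} (hw : w ≠ 0) :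
    ContinuousAt (thetaSeries Q) w := by
  have h : ContinuousAt (fun w => qProd Q Q * (qProd w Q * qProd (Q / w) Q)) w :=
    continuousAt_const.mul ((continuous_qProd hQ).continuousAt.mul
      ((continuous_qProd hQ).continuousAt.comp (f := fun w => Q / w)
        (continuousAt_const.div continuousAt_id hw)))
  refine h.congr ?_
  filter_upwards [isOpen_ne.mem_nhds hw] with z hz
  exact (thetaSeries_eq_qProd hQ0 hQ hz).symm

/-- The Laurent coefficients `k² / (1 - Q^k)`. -/
noncomputable def lambertCoeff (Q : ℂ) (k : ℤ) : ℂ := k ^ 2 / (1 - Q ^ k)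

/-- The regular part `∑_J J² Q^J / (1 - Q^J) (w^J - w^{-J})` of the derivative of the Weierstrass
function. -/
noncomputable def lambertRegular (Q w : ℂ) : ℂ :=
  ∑' J : ℕ, (J : ℂ) ^ 2 / (1 - Q ^ J) * Q ^ J * (w ^ J - (w ^ J)⁻¹)

/-- The derivative of the Weierstrass function in the multiplicative coordinate `w`. -/
noncomputable def lambertSeries (Q w : ℂ) : ℂ :=
  w * (1 + w) / (1 - w) ^ 3 + lambertRegular Q w

lemma norm_sq_div_one_sub_pow_le {Q : ℂ} (hQ : ‖Q‖ < 1) (J : ℕ) :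
    ‖(J : ℂ) ^ 2 / (1 - Q ^ J)‖ ≤ (J : ℝ) ^ 2 / (1 - ‖Q‖) := by
  rcases J.eq_zero_or_pos with rfl | hJ
  · simp
  · rw [norm_div, norm_pow, Complex.norm_natCast]
    have h1 : ‖Q ^ J‖ ≤ ‖Q‖ := by
      rw [norm_pow]
      exact pow_le_of_le_one (norm_nonneg _) hQ.le hJ.ne'
    have h2 : 1 - ‖Q‖ ≤ ‖1 - Q ^ J‖ := by
      have := norm_sub_norm_le (1 : ℂ) (Q ^ J)
      rw [norm_one] at this
      linarith
    exact div_le_div_of_nonneg_left (by positivity) (by linarith) h2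

lemma summable_sq_mul_geometric {r : ℝ} (h0 : 0 ≤ r) (h1 : r < 1) (C : ℝ) :
    Summable fun J : ℕ => (J : ℝ) ^ 2 / C * r ^ J := by
  have := (summable_pow_mul_geometric_of_norm_lt_one 2
    (show ‖r‖ < 1 by rwa [Real.norm_of_nonneg h0])).div_const C
  exact this.congr fun J => by ring

lemma summable_lambert_nat {Q : ℂ} (hQ : ‖Q‖ < 1) {z : ℂ} (hz : ‖z‖ < 1) :
    Summable fun J : ℕ => ‖(J : ℂ) ^ 2 / (1 - Q ^ J) * z ^ J‖ := by
  refine .of_nonneg_of_le (fun J => norm_nonneg _) (fun J => ?_)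
    (summable_sq_mul_geometric (norm_nonneg z) hz (1 - ‖Q‖))
  rw [norm_mul, norm_pow]
  gcongr
  exact norm_sq_div_one_sub_pow_le hQ J

lemma hasSum_sq_mul_geometric {w : ℂ} (hw : ‖w‖ < 1) :
    HasSum (fun J : ℕ => (J : ℂ) ^ 2 * w ^ J) (w * (1 + w) / (1 - w) ^ 3) := by
  have h0 := (hasSum_choose_mul_geometric_of_norm_lt_one 2 hw).mul_left 2
  have h1 := (hasSum_choose_mul_geometric_of_norm_lt_one 1 hw).mul_left (-3)
  have h2 := hasSum_choose_mul_geometric_of_norm_lt_one 0 hw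
  have hne : 1 - w ≠ 0 := by
    intro h
    rw [← sub_eq_zero.mp h] at hw
    simp at hw
  have key := (h0.add h1).add h2
  have e : 2 * (1 / (1 - w) ^ (2 + 1)) + -3 * (1 / (1 - w) ^ (1 + 1)) + 1 / (1 - w) ^ (0 + 1) =
      w * (1 + w) / (1 - w) ^ 3 := by
    field_simp
    ring
  rw [e] at key
  convert! key using 1
  funext J
  rw [Nat.cast_choose_two, Nat.choose_one_right]
  push_cast
  simp
  ring

lemma lambertCoeff_natCast (Q : ℂ) (J : ℕ) : lambertCoeff Q J = (J : ℂ) ^ 2 / (1 - Q ^ J) := by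
  simp [lambertCoeff]

lemma lambertCoeff_neg {Q : ℂ} (hQ0 : Q ≠ 0) (hQ : ‖Q‖ < 1) (k : ℤ) :
    lambertCoeff Q (-k) = (k : ℂ) ^ 2 - lambertCoeff Q k := by
  rcases eq_or_ne k 0 with rfl | hk
  · simp [lambertCoeff]
  · have h1 := one_sub_zpow_ne_zero hQ hk
    have h2 := one_sub_zpow_ne_zero hQ (neg_ne_zero.mpr hk)
    have h3 := zpow_ne_zero k hQ0
    rw [zpow_neg] at h2
    rw [lambertCoeff, lambertCoeff, zpow_neg]
    have h4 : Q ^ k - 1 ≠ 0 := fun h => h1 (by linear_combination -h)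
    push_cast
    field_simp
    ring

/-- The function ℘' is invariant under w ↦ Qw, but its Laurent expansions in adjacent annuli differ
across the pole at w = 1. The defect k² is the coefficient sequence of a second derivative of the
formal delta function there. -/
lemma zpow_mul_lambertCoeff {Q : ℂ} (hQ : ‖Q‖ < 1) (k : ℤ) :
    Q ^ k * lambertCoeff Q k = lambertCoeff Q k - (k : ℂ) ^ 2 := by
  rcases eq_or_ne k 0 with rfl | hk
  · simp [lambertCoeff]
  · have h1 := one_sub_zpow_ne_zero hQ hk
    rw [lambertCoeff]
    field_simp
    ring

section
variable {Q : ℂ} (hQ0 : Q ≠ 0) (hQ : ‖Q‖ < 1)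
include hQ0 hQ

lemma lambertCoeff_neg_natCast (J : ℕ) :
    lambertCoeff Q (-(J : ℤ)) = -((J : ℂ) ^ 2 / (1 - Q ^ J) * Q ^ J) := by
  have h := zpow_mul_lambertCoeff hQ J
  rw [lambertCoeff_neg hQ0 hQ, ← lambertCoeff_natCast]
  rw [zpow_natCast] at h
  push_cast at h ⊢
  linear_combination h

lemma summable_lambertCoeff {w : ℂ} (h1 : ‖Q‖ < ‖w‖) (h2 : ‖w‖ < 1) :
    Summable fun k : ℤ => ‖lambertCoeff Q k‖ * ‖w‖ ^ k := by
  refine Summable.of_nat_of_neg ?_ ?_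
  · exact (summable_lambert_nat hQ h2).congr fun J => by
      rw [lambertCoeff_natCast]
      simp
  · have h3 : ‖Q / w‖ < 1 := by
      rw [norm_div]
      exact (div_lt_one ((norm_nonneg Q).trans_lt h1)).mpr h1
    refine (summable_lambert_nat hQ h3).congr fun J => ?_
    rw [lambertCoeff_neg_natCast hQ0 hQ]
    simp only [norm_mul, norm_neg, norm_div, div_pow, norm_pow, zpow_neg, zpow_natCast]
    ring

lemma tsum_lambertCoeff {w : ℂ} (h1 : ‖Q‖ < ‖w‖) (h2 : ‖w‖ < 1) :
    ∑' k : ℤ, lambertCoeff Q k * w ^ k = lambertSeries Q w := by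
  have h3 : ‖Q / w‖ < 1 := by
    rw [norm_div]
    exact (div_lt_one ((norm_nonneg Q).trans_lt h1)).mpr h1
  have h4 : ‖Q * w‖ < 1 := by
    rw [norm_mul]
    exact mul_lt_one_of_nonneg_of_lt_one_left (norm_nonneg _) hQ h2.le
  have hs := summable_lambertCoeff hQ0 hQ h1 h2
  have hs' : Summable fun k : ℤ => lambertCoeff Q k * w ^ k := .of_norm (hs.congr fun k => by simp)
  have s1 := (summable_lambert_nat hQ h4).of_norm
  have s2 := (summable_lambert_nat hQ h3).of_norm
  have s3 := hasSum_sq_mul_geometric h2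
  -- Writing 1/(1 - Q^J) = 1 + Q^J/(1 - Q^J) separates the polar part, the sum of J² w^J, from a
  -- series that still converges on the unit circle.
  have a1 : HasSum (fun J : ℕ => lambertCoeff Q J * w ^ (J : ℤ))
      (w * (1 + w) / (1 - w) ^ 3 + ∑' J : ℕ, (J : ℂ) ^ 2 / (1 - Q ^ J) * (Q * w) ^ J) := by
    convert! s3.add s1.hasSum using 1
    funext J
    have h := zpow_mul_lambertCoeff hQ J
    rw [zpow_natCast, lambertCoeff_natCast] at h
    push_cast at h
    rw [lambertCoeff_natCast, zpow_natCast, mul_pow]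
    linear_combination -w ^ J * h
  have a2 : HasSum (fun J : ℕ => lambertCoeff Q (-(J : ℤ)) * w ^ (-(J : ℤ)))
      (-∑' J : ℕ, (J : ℂ) ^ 2 / (1 - Q ^ J) * (Q / w) ^ J) := by
    convert! s2.hasSum.neg using 1
    funext J
    rw [lambertCoeff_neg_natCast hQ0 hQ, zpow_neg, zpow_natCast, div_pow]
    ring
  have h := (HasSum.of_nat_of_neg (f := fun k : ℤ => lambertCoeff Q k * w ^ k) a1 a2).tsum_eq
  rw [h, lambertSeries, lambertRegular]
  have : ∑' J : ℕ, (J : ℂ) ^ 2 / (1 - Q ^ J) * Q ^ J * (w ^ J - (w ^ J)⁻¹) =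
      ∑' J : ℕ, (J : ℂ) ^ 2 / (1 - Q ^ J) * (Q * w) ^ J -
      ∑' J : ℕ, (J : ℂ) ^ 2 / (1 - Q ^ J) * (Q / w) ^ J := by
    rw [← s1.tsum_sub s2]
    refine tsum_congr fun J => ?_
    rw [mul_pow, div_pow]
    ring
  rw [this]
  simp [lambertCoeff]
  ring

lemma conv_lambert_summable (n : ℤ) :
    Summable fun k => thetaFourCoeff Q (n - k) * lambertCoeff Q k := by
  obtain ⟨r, h1, h2⟩ := exists_between hQ
  have hr : 0 < r := (norm_nonneg Q).trans_lt h1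
  have hn : ‖(r : ℂ)‖ = r := by simp [abs_of_pos hr]
  have h := summable_lambertCoeff hQ0 hQ (w := r) (by rwa [hn]) (by rwa [hn])
  rw [hn] at h
  exact summable_laurentConv_term hr (entireLaurent_thetaFourCoeff hQ0 hQ r hr) h n

lemma summable_thetaFourCoeff_mul_sq (n : ℤ) :
    Summable fun k : ℤ => thetaFourCoeff Q (n - k) * (k : ℂ) ^ 2 := by
  have h4 := entireLaurent_thetaFourCoeff hQ0 hQ
  rw [← (Equiv.subLeft n).summable_iff]
  have hs := ((h4.summable_coeff.mul_left ((n : ℂ) ^ 2)).add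
    (h4.int_mul.summable_coeff.mul_left (-2 * (n : ℂ)))).add h4.int_mul.int_mul.summable_coeff
  refine hs.congr fun k => ?_
  simp only [Function.comp_apply, Equiv.subLeft_apply, sub_sub_cancel]
  push_cast
  ring

/-- θ⁴ has degree 4 and the Lambert coefficients have degree 0 up to the defect k²; convolution with
θ⁴ kills the defect by `tsum_thetaFourCoeff_mul_sq`. -/
lemma conv_lambert_shift (n : ℤ) :
    laurentConv (thetaFourCoeff Q) (lambertCoeff Q) (n + 4) =
      Q ^ n * laurentConv (thetaFourCoeff Q) (lambertCoeff Q) n := by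
  have h0 := tsum_thetaFourCoeff_mul_sq hQ0 hQ (n + 4)
  rw [laurentConv, laurentConv, ← tsum_mul_left, ← sub_zero (∑' k, _), ← h0,
    ← (conv_lambert_summable hQ0 hQ (n + 4)).tsum_sub (summable_thetaFourCoeff_mul_sq hQ0 hQ (n + 4))]
  refine tsum_congr fun k => ?_
  have h1 := zpow_mul_lambertCoeff hQ k
  have h2 := zpow_ne_zero k hQ0
  rw [show n + 4 - k = n - k + 4 by ring, thetaFourCoeff_shift hQ0, zpow_sub₀ hQ0, ← mul_sub, ← h1]
  field_simp

/-- θ⁴ is symmetric and ℘' is odd, again up to k², which θ⁴ annihilates. -/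
lemma conv_lambert_reflect (n : ℤ) :
    laurentConv (thetaFourCoeff Q) (lambertCoeff Q) (4 - n) =
      -laurentConv (thetaFourCoeff Q) (lambertCoeff Q) n := by
  have h0 := tsum_thetaFourCoeff_mul_sq hQ0 hQ n
  rw [laurentConv, laurentConv, ← (Equiv.neg ℤ).tsum_eq, ← zero_sub, ← h0,
    ← (summable_thetaFourCoeff_mul_sq hQ0 hQ n).tsum_sub (conv_lambert_summable hQ0 hQ n)]
  refine tsum_congr fun k => ?_
  simp only [Equiv.neg_apply]
  rw [show 4 - n - -k = 4 - (n - k) by ring, thetaFourCoeff_reflect, lambertCoeff_neg hQ0 hQ]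
  ring

end

/-- The Laurent coefficients of `w * thetaSeries Q (w ^ 2)`. -/
noncomputable def thetaDoubleCoeff (Q : ℂ) (n : ℤ) : ℂ :=
  if Even n then 0 else thetaCoeff Q ((n - 1) / 2)

lemma thetaDoubleCoeff_odd (Q : ℂ) (m : ℤ) : thetaDoubleCoeff Q (2 * m + 1) = thetaCoeff Q m := by
  simp [thetaDoubleCoeff]

lemma tsum_thetaDoubleCoeff {w : ℂ} (hw : w ≠ 0) (Q : ℂ) :
    ∑' n, thetaDoubleCoeff Q n * w ^ n = w * thetaSeries Q (w ^ 2) := by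
  have hinj : Function.Injective fun m : ℤ => 2 * m + 1 := fun a b h => by simpa using h
  rw [← hinj.tsum_eq, thetaSeries, ← tsum_mul_left]
  · refine tsum_congr fun m => ?_
    rw [thetaDoubleCoeff_odd, zpow_add_one₀ hw, zpow_mul]
    norm_cast
    ring
  · intro n hn
    rcases Int.even_or_odd n with h | ⟨m, rfl⟩
    · simp [thetaDoubleCoeff, h] at hn
    · exact ⟨m, rfl⟩

lemma thetaDoubleCoeff_shift {Q : ℂ} (hQ0 : Q ≠ 0) (n : ℤ) :
    thetaDoubleCoeff Q (n + 4) = Q ^ n * thetaDoubleCoeff Q n := by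
  rcases Int.even_or_odd n with h | ⟨m, rfl⟩
  · have h4 : Even (n + 4) := h.add (by decide)
    simp [thetaDoubleCoeff, h, h4]
  · rw [show 2 * m + 1 + 4 = 2 * (m + 1 + 1) + 1 by ring, thetaDoubleCoeff_odd,
      thetaDoubleCoeff_odd, thetaCoeff_succ hQ0, thetaCoeff_succ hQ0,
      show 2 * m + 1 = (m + 1) + m by ring]
    simp only [zpow_add₀ hQ0]
    ring

/-- Degree 4 leaves the coefficients at 0, 1, 2, 3 free. Comparing shift and reflection at 0 gives
c(0) = 0, reflection at 2 gives c(2) = 0, and c(3) = -c(1). The coefficients of w θ(w²) satisfy the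
same conditions with c(1) = 1. -/
lemma conv_lambert_eq {Q : ℂ} (hQ0 : Q ≠ 0) (hQ : ‖Q‖ < 1) (n : ℤ) :
    laurentConv (thetaFourCoeff Q) (lambertCoeff Q) n =
      laurentConv (thetaFourCoeff Q) (lambertCoeff Q) 1 * thetaDoubleCoeff Q n := by
  set h := laurentConv (thetaFourCoeff Q) (lambertCoeff Q) with hh
  have hs := conv_lambert_shift hQ0 hQ
  have hr := conv_lambert_reflect hQ0 hQ
  rw [← hh] at hs hr
  have h0 : h 0 = 0 := by
    have e1 := hs 0
    have e2 := hr 0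
    norm_num at e1 e2
    have : (2 : ℂ) * h 0 = 0 := by linear_combination e2 - e1
    simpa using this
  have h2 : h 2 = 0 := by
    have e2 := hr 2
    norm_num at e2
    have : (2 : ℂ) * h 2 = 0 := by linear_combination e2
    simpa using this
  have h3 : h 3 = -h 1 := by
    have e2 := hr 1
    norm_num at e2
    exact e2
  refine sub_eq_zero.mp (eq_zero_of_shift hQ0 (p := 4) (by norm_num) (ε := 1) one_ne_zero
    (d := fun n => h n - h 1 * thetaDoubleCoeff Q n) (fun n => ?_) (fun n hn1 hn2 => ?_) n)
  · push_cast
    rw [hs, thetaDoubleCoeff_shift hQ0]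
    ring
  · have e1 : thetaDoubleCoeff Q 1 = 1 := by
      simpa [thetaCoeff] using thetaDoubleCoeff_odd Q 0
    have e3 : thetaDoubleCoeff Q 3 = -1 := by
      simpa [thetaCoeff] using thetaDoubleCoeff_odd Q 1
    have e0 : thetaDoubleCoeff Q 0 = 0 := by simp [thetaDoubleCoeff]
    have e2 : thetaDoubleCoeff Q 2 = 0 := by simp [thetaDoubleCoeff]
    push_cast at hn2
    interval_cases n
    · simp [h0, e0]
    · simp [e1]
    · simp [h2, e2]
    · simp [h3, e3]

lemma thetaSeries_pow_four_mul_aux {Q : ℂ} (hQ0 : Q ≠ 0) (hQ : ‖Q‖ < 1) {w : ℂ}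
    (h1 : ‖Q‖ < ‖w‖) (h2 : ‖w‖ < 1) :
    thetaSeries Q w ^ 4 * lambertSeries Q w =
      laurentConv (thetaFourCoeff Q) (lambertCoeff Q) 1 * (w * thetaSeries Q (w ^ 2)) := by
  have hr : 0 < ‖w‖ := (norm_nonneg Q).trans_lt h1
  have hw : w ≠ 0 := norm_pos_iff.mp hr
  rw [← tsum_lambertCoeff hQ0 hQ h1 h2, ← tsum_thetaFourCoeff_mul_zpow hQ0 hQ hw,
    ← tsum_laurentConv hw (entireLaurent_thetaFourCoeff hQ0 hQ _ hr)
      (summable_lambertCoeff hQ0 hQ h1 h2), ← tsum_thetaDoubleCoeff hw, ← tsum_mul_left]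
  refine tsum_congr fun n => ?_
  rw [conv_lambert_eq hQ0 hQ n, mul_assoc]

/-- Without its polar part the series converges in an annulus containing the unit circle. For a < r
< 1 with ‖Q‖ < a, the ratio ‖Q‖/a dominates. The radial limit is needed at w = 1 for the constant
and at w = i for the third integrand. -/
lemma tendsto_lambertRegular {Q : ℂ} (hQ : ‖Q‖ < 1) {ζ : ℂ} (hζ : ‖ζ‖ = 1) :
    Tendsto (fun r : ℝ => lambertRegular Q (r * ζ)) (𝓝[<] 1) (𝓝 (lambertRegular Q ζ)) := by
  obtain ⟨a, hQa, ha1⟩ := exists_between hQ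
  have hQn := norm_nonneg Q
  have ha0 : 0 < a := hQn.trans_lt hQa
  have hζ0 : ζ ≠ 0 := by rintro rfl; simp at hζ
  refine tendsto_tsum_of_dominated_convergence
    (bound := fun J : ℕ => 2 * ((J : ℝ) ^ 2 / (1 - ‖Q‖) * (‖Q‖ / a) ^ J)) ?_ (fun J => ?_) ?_
  · exact (summable_sq_mul_geometric (by positivity) ((div_lt_one ha0).mpr hQa) _).mul_left 2
  · have hc : ContinuousAt (fun w : ℂ => (J : ℂ) ^ 2 / (1 - Q ^ J) * Q ^ J * (w ^ J - (w ^ J)⁻¹))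
        (1 * ζ) := by
      have : ContinuousAt (fun w : ℂ => (w ^ J)⁻¹) (1 * ζ) :=
        (continuousAt_id.pow J).inv₀ (by simpa using pow_ne_zero J hζ0)
      fun_prop
    have := hc.tendsto.comp (tendsto_ofReal_nhdsLT_one.mul_const ζ)
    rwa [one_mul] at this
  · filter_upwards [eventually_mem_Ioo_nhdsLT_one ha1] with r hr J
    have hr0 : 0 < r := ha0.trans hr.1
    have hn : ‖(r : ℂ) * ζ‖ = r := by simp [hζ, abs_of_pos hr0]
    have e : ‖((r : ℂ) * ζ) ^ J - (((r : ℂ) * ζ) ^ J)⁻¹‖ ≤ 2 * (1 / a) ^ J := by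
      refine (norm_sub_le _ _).trans ?_
      rw [norm_inv, norm_pow, hn, ← inv_pow, ← one_div]
      have i1 : r ^ J ≤ (1 / a) ^ J := by
        refine pow_le_pow_left₀ hr0.le (hr.2.le.trans ?_) J
        exact (one_le_div ha0).mpr ha1.le
      have i2 : (1 / r) ^ J ≤ (1 / a) ^ J :=
        pow_le_pow_left₀ (by positivity) (one_div_le_one_div_of_le ha0 hr.1.le) J
      linarith
    calc _ = ‖(J : ℂ) ^ 2 / (1 - Q ^ J)‖ * ‖Q‖ ^ J *
          ‖((r : ℂ) * ζ) ^ J - (((r : ℂ) * ζ) ^ J)⁻¹‖ := by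
          rw [norm_mul, norm_mul, norm_pow Q]
      _ ≤ (J : ℝ) ^ 2 / (1 - ‖Q‖) * ‖Q‖ ^ J * (2 * (1 / a) ^ J) := by
          have : 0 ≤ (J : ℝ) ^ 2 / (1 - ‖Q‖) := div_nonneg (by positivity) (by linarith)
          gcongr
          exact norm_sq_div_one_sub_pow_le hQ J
      _ = _ := by
          rw [div_pow, div_pow, one_pow]
          ring

/-- Let P = (Q;Q). As w → 1, θ(w) ~ P³(1 - w) and the Lambert series is ~ 2/(1 - w)³, so θ⁴ times it
is ~ 2P¹²(1 - w). The other side is ~ 2cP³(1 - w), hence c = P⁹. -/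
lemma conv_lambert_one {Q : ℂ} (hQ0 : Q ≠ 0) (hQ : ‖Q‖ < 1) :
    laurentConv (thetaFourCoeff Q) (lambertCoeff Q) 1 = qProd Q Q ^ 9 := by
  have hE : qProd Q Q ≠ 0 := qProd_ne_zero_of_norm_lt hQ hQ
  set h := laurentConv (thetaFourCoeff Q) (lambertCoeff Q) 1
  have t1 := tendsto_thetaSeries_div hQ0 hQ
  have hsq : Tendsto (fun r : ℝ => r ^ 2) (𝓝[<] 1) (𝓝[<] 1) := by
    refine tendsto_nhdsWithin_iff.mpr ⟨?_, ?_⟩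
    · have : Tendsto (fun r : ℝ => r ^ 2) (𝓝 1) (𝓝 (1 ^ 2)) := (continuous_pow 2).tendsto 1
      rw [one_pow] at this
      exact this.mono_left nhdsWithin_le_nhds
    · filter_upwards [eventually_mem_Ioo_nhdsLT_one (show (0 : ℝ) < 1 by norm_num)] with r hr
      exact pow_lt_one₀ hr.1.le hr.2 two_ne_zero
  have t2 := t1.comp hsq
  have t3 := tendsto_lambertRegular hQ (ζ := 1) norm_one
  have hc := tendsto_ofReal_nhdsLT_one
  have lhs : Tendsto (fun r : ℝ => (thetaSeries Q r / (1 - r)) ^ 4 *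
      ((r : ℂ) * (1 + r) + (1 - r) ^ 3 * lambertRegular Q (r * 1))) (𝓝[<] 1)
      (𝓝 ((qProd Q Q ^ 3) ^ 4 * (1 * (1 + 1) + (1 - 1) ^ 3 * lambertRegular Q 1))) :=
    (t1.pow 4).mul ((hc.mul (hc.const_add 1)).add (((hc.const_sub 1).pow 3).mul t3))
  have rhs : Tendsto (fun r : ℝ => h * ((r : ℂ) * ((1 + r) *
      (thetaSeries Q ((r ^ 2 : ℝ) : ℂ) / (1 - ((r ^ 2 : ℝ) : ℂ)))))) (𝓝[<] 1)
      (𝓝 (h * (1 * ((1 + 1) * qProd Q Q ^ 3)))) :=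
    (hc.mul ((hc.const_add 1).mul t2)).const_mul h
  have heq := tendsto_nhds_unique (lhs.congr' ?_) rhs
  · have : qProd Q Q ^ 3 * 2 * (h - qProd Q Q ^ 9) = 0 := by linear_combination -heq
    have h3 : qProd Q Q ^ 3 * 2 ≠ 0 := mul_ne_zero (pow_ne_zero 3 hE) two_ne_zero
    exact sub_eq_zero.mp ((mul_eq_zero.mp this).resolve_left h3)
  · filter_upwards [eventually_mem_Ioo_nhdsLT_one hQ] with r hr
    have hr0 : 0 < r := (norm_nonneg Q).trans_lt hr.1
    have hn : ‖(r : ℂ)‖ = r := by simp [abs_of_pos hr0]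
    have key := thetaSeries_pow_four_mul_aux hQ0 hQ (w := r) (by rw [hn]; exact hr.1)
      (by rw [hn]; exact hr.2)
    have hr1 : (1 : ℂ) - r ≠ 0 := sub_ne_zero.mpr (by exact_mod_cast hr.2.ne')
    have hr2 : (1 : ℂ) + r ≠ 0 := by exact_mod_cast (by linarith : (1 : ℝ) + r ≠ 0)
    have hr3 : (1 : ℂ) - (r : ℂ) ^ 2 ≠ 0 := by
      rw [show (1 : ℂ) - (r : ℂ) ^ 2 = (1 - r) * (1 + r) by ring]
      exact mul_ne_zero hr1 hr2
    rw [lambertSeries] at key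
    push_cast
    rw [mul_one]
    have e1 : (1 + (r : ℂ)) * (thetaSeries Q ((r : ℂ) ^ 2) / (1 - (r : ℂ) ^ 2)) =
        thetaSeries Q ((r : ℂ) ^ 2) / (1 - r) := by
      rw [show (1 : ℂ) - (r : ℂ) ^ 2 = (1 - r) * (1 + r) by ring]
      field_simp
    rw [e1]
    have e2 : (thetaSeries Q r / (1 - r)) ^ 4 *
        ((r : ℂ) * (1 + r) + (1 - r) ^ 3 * lambertRegular Q r) = (thetaSeries Q r ^ 4 *
        ((r : ℂ) * (1 + r) / (1 - r) ^ 3 + lambertRegular Q r)) / (1 - r) := by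
      field_simp
    rw [e2, key]
    ring

/-- The product formula for the derivative of the Weierstrass function. -/
theorem thetaSeries_pow_four_mul_lambertSeries {Q : ℂ} (hQ0 : Q ≠ 0) (hQ : ‖Q‖ < 1) {w : ℂ}
    (h1 : ‖Q‖ < ‖w‖) (h2 : ‖w‖ ≤ 1) (h3 : w ≠ 1) :
    thetaSeries Q w ^ 4 * lambertSeries Q w = qProd Q Q ^ 9 * (w * thetaSeries Q (w ^ 2)) := by
  rcases h2.lt_or_eq with h2 | h2
  · rw [← conv_lambert_one hQ0 hQ, thetaSeries_pow_four_mul_aux hQ0 hQ h1 h2]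
  -- On the unit circle away from w = 1 the identity is the radial limit of the one in the open
  -- annulus.
  · have hw0 : w ≠ 0 := by rintro rfl; simp at h2
    have c1 := (continuousAt_thetaSeries hQ0 hQ hw0).tendsto
    have c2 := (continuousAt_thetaSeries hQ0 hQ (pow_ne_zero 2 hw0)).tendsto
    have hc : Tendsto (fun r : ℝ => (r : ℂ) * w) (𝓝[<] 1) (𝓝 w) := by
      simpa using tendsto_ofReal_nhdsLT_one.mul_const w
    have hd : (1 - w) ^ 3 ≠ 0 := pow_ne_zero 3 (sub_ne_zero.mpr h3.symm)
    have lhs : Tendsto (fun r : ℝ => thetaSeries Q (r * w) ^ 4 * lambertSeries Q (r * w)) (𝓝[<] 1)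
        (𝓝 (thetaSeries Q w ^ 4 * lambertSeries Q w)) :=
      ((c1.comp hc).pow 4).mul (((hc.mul (hc.const_add 1)).div ((hc.const_sub 1).pow 3) hd).add
        (tendsto_lambertRegular hQ h2))
    have rhs : Tendsto (fun r : ℝ => qProd Q Q ^ 9 * (r * w * thetaSeries Q ((r * w) ^ 2))) (𝓝[<] 1)
        (𝓝 (qProd Q Q ^ 9 * (w * thetaSeries Q (w ^ 2)))) :=
      (hc.mul (c2.comp (hc.pow 2))).const_mul _
    refine tendsto_nhds_unique lhs (rhs.congr' ?_)
    filter_upwards [eventually_mem_Ioo_nhdsLT_one hQ] with r hr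
    have hr0 : 0 < r := (norm_nonneg Q).trans_lt hr.1
    have hn : ‖(r : ℂ) * w‖ = r := by simp [h2, abs_of_pos hr0]
    rw [← conv_lambert_one hQ0 hQ, thetaSeries_pow_four_mul_aux hQ0 hQ (by rw [hn]; exact hr.1)
      (by rw [hn]; exact hr.2)]

/-! ### Product formulas for Ramanujan's theta functions -/

lemma ramanujanF_neg (q : ℂ) : ramanujanF (-q) = qProd q q := by
  simp only [ramanujanF, qProd, neg_neg, pow_succ']

lemma qProd_self_ne_zero {q : ℂ} (hq : ‖q‖ < 1) : qProd q q ≠ 0 := qProd_ne_zero_of_norm_lt hq hq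

lemma qProd_self_eq {q : ℂ} (hq : ‖q‖ < 1) :
    qProd q q = qProd q (q ^ 2) * qProd (q ^ 2) (q ^ 2) := by
  rw [qProd_split_two q hq, ← sq]

/-- Split by parity: the odd parts of (q;q) and (-q;-q) are (q;q²) and (-q;q²), whose product is
(q²;q⁴), while both even parts are (q²;q²). -/
lemma qProd_neg_self {q : ℂ} (hq : ‖q‖ < 1) :
    qProd (-q) (-q) = qProd (q ^ 2) (q ^ 2) ^ 3 / (qProd q q * qProd (q ^ 4) (q ^ 4)) := by
  have hq2 := norm_pow_lt_one hq two_ne_zero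
  have h4 := qProd_self_ne_zero (norm_pow_lt_one hq four_ne_zero)
  have e1 := qProd_self_eq hq
  have e2 := qProd_self_eq (q := -q) (by rwa [norm_neg])
  have e3 := qProd_self_eq hq2
  have e4 := qProd_mul_neg q hq2
  rw [neg_sq] at e2
  simp only [← pow_mul] at e3 e4
  norm_num at e3 e4
  rw [eq_div_iff (mul_ne_zero (qProd_self_ne_zero hq) h4), e1, e2]
  generalize qProd (q ^ 2) (q ^ 2) = P2 at *
  generalize qProd (q ^ 4) (q ^ 4) = P4 at *
  generalize qProd (q ^ 2) (q ^ 4) = R at *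
  linear_combination P2 ^ 2 * P4 * e4 - P2 ^ 2 * e3

/-- For base q³ the three factors of the triple product run over the residue classes modulo 3 and
reassemble Euler's product. This and the next lemma are forms of the pentagonal number theorem. -/
lemma thetaSeries_cube_self {q : ℂ} (h0 : q ≠ 0) (hq : ‖q‖ < 1) :
    thetaSeries (q ^ 3) q = qProd q q := by
  rw [thetaSeries_eq_qProd (pow_ne_zero 3 h0) (norm_pow_lt_one hq three_ne_zero) h0,
    qProd_split_three q hq, show q ^ 3 / q = q * q by field_simp, show q * q ^ 2 = q ^ 3 by ring]
  ring

lemma thetaSeries_cube_sq {q : ℂ} (h0 : q ≠ 0) (hq : ‖q‖ < 1) :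
    thetaSeries (q ^ 3) (q ^ 2) = qProd q q := by
  rw [thetaSeries_eq_qProd (pow_ne_zero 3 h0) (norm_pow_lt_one hq three_ne_zero) (pow_ne_zero 2 h0),
    qProd_split_three q hq, show q ^ 3 / q ^ 2 = q by field_simp, show q * q ^ 2 = q ^ 3 by ring,
    ← sq]
  ring

lemma thetaSeries_sq_self {q : ℂ} (h0 : q ≠ 0) (hq : ‖q‖ < 1) :
    thetaSeries (q ^ 2) q = qProd q q ^ 2 / qProd (q ^ 2) (q ^ 2) := by
  have hq2 := norm_pow_lt_one hq two_ne_zero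
  have h2 := qProd_self_ne_zero hq2
  rw [thetaSeries_eq_qProd (pow_ne_zero 2 h0) hq2 h0, qProd_self_eq hq,
    show q ^ 2 / q = q by field_simp]
  field_simp

lemma thetaSeries_four_self {q : ℂ} (h0 : q ≠ 0) (hq : ‖q‖ < 1) :
    thetaSeries (q ^ 4) q = qProd q q * qProd (q ^ 4) (q ^ 4) / qProd (q ^ 2) (q ^ 2) := by
  have hq2 := norm_pow_lt_one hq two_ne_zero
  have h2 := qProd_self_ne_zero hq2
  rw [thetaSeries_eq_qProd (pow_ne_zero 4 h0) (norm_pow_lt_one hq four_ne_zero) h0,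
    qProd_self_eq hq, qProd_split_two q hq2, show q ^ 4 / q = q * q ^ 2 by field_simp, ← pow_mul]
  field_simp

lemma ramanujanPhi_neg_eq_thetaSeries {q : ℂ} (h0 : q ≠ 0) :
    ramanujanPhi (-q) = thetaSeries (q ^ 2) q := by
  refine tsum_congr fun n => ?_
  have h1 : n * (n - 1) / 2 * 2 = n * (n - 1) := Int.ediv_mul_cancel (Int.even_mul_pred_self n).two_dvd
  have h2 : (q ^ 2) ^ (n * (n - 1) / 2) = q ^ (n * (n - 1)) := by
    generalize n * (n - 1) / 2 = t at h1 ⊢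
    rw [← h1, mul_comm t 2, zpow_mul]
    norm_cast
  have h3 : (-q) ^ (n.natAbs ^ 2) = (-q) ^ (n * n) := by
    rw [← zpow_natCast]
    congr 1
    push_cast
    rw [sq_abs, sq]
  rw [thetaCoeff, h2, h3, mul_assoc, ← zpow_add₀ h0, show n * (n - 1) + n = n * n by ring,
    neg_eq_neg_one_mul, mul_zpow, zpow_mul]
  rcases Int.even_or_odd n with h | h <;> simp [h.neg_one_zpow]

/-- The triangular numbers of index 2n and 2n + 1 are the values of m(2m - 1) at m = -n and m = n +
1, so even and odd indices together form one bilateral series. -/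
lemma ramanujanPsi_neg_eq_thetaSeries {q : ℂ} (h0 : q ≠ 0) (hq : ‖q‖ < 1) :
    ramanujanPsi (-q) = thetaSeries (q ^ 4) q := by
  have hs := (entireLaurent_thetaCoeff (pow_ne_zero 4 h0)
    (norm_pow_lt_one hq four_ne_zero)).summable h0
  obtain ⟨F, hF⟩ : ∃ F : ℤ → ℂ, F = fun n => thetaCoeff (q ^ 4) n * q ^ n := ⟨_, rfl⟩
  have hF' (n : ℤ) : F n = (-1) ^ n * q ^ (n * (2 * n - 1)) := by
    have h1 : n * (n - 1) / 2 * 2 = n * (n - 1) :=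
      Int.ediv_mul_cancel (Int.even_mul_pred_self n).two_dvd
    have h2 : (q ^ 4) ^ (n * (n - 1) / 2) = q ^ (2 * (n * (n - 1))) := by
      generalize n * (n - 1) / 2 = t at h1 ⊢
      rw [← h1, show 2 * (t * 2) = 4 * t by ring, zpow_mul]
      norm_cast
    simp only [hF, thetaCoeff]
    rw [h2, mul_assoc, ← zpow_add₀ h0]
    congr 2
    ring
  rw [← hF] at hs
  have s1 : Summable fun n : ℕ => F (-(n : ℤ)) :=
    hs.comp_injective (i := fun n : ℕ => -(n : ℤ)) fun a b h => by simpa using h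
  have s2 : Summable fun n : ℕ => F (-(-((n : ℤ) + 1))) :=
    hs.comp_injective (i := fun n : ℕ => -(-((n : ℤ) + 1))) fun a b h => by simpa using h
  have h := HasSum.of_nat_of_neg_add_one (f := fun n : ℤ => F (-n)) s1.hasSum s2.hasSum
  rw [thetaSeries, ← hF, ← (Equiv.neg ℤ).tsum_eq]
  simp only [Equiv.neg_apply]
  rw [h.tsum_eq]
  have e1 (n : ℕ) : (-q) ^ (2 * n * (2 * n + 1) / 2) = F (-(n : ℤ)) := by
    rw [hF', show 2 * n * (2 * n + 1) / 2 = n * (2 * n + 1) by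
      rw [mul_assoc, Nat.mul_div_cancel_left _ two_pos], neg_pow q,
      show -(n : ℤ) * (2 * -n - 1) = ((n * (2 * n + 1) : ℕ) : ℤ) by push_cast; ring, zpow_natCast,
      pow_mul, zpow_neg, zpow_natCast]
    rcases Nat.even_or_odd n with h | h <;> simp [h.neg_one_pow, (odd_two_mul_add_one n).neg_one_pow]
  have e2 (n : ℕ) : (-q) ^ ((2 * n + 1) * (2 * n + 1 + 1) / 2) = F (-(-((n : ℤ) + 1))) := by
    rw [hF', show (2 * n + 1) * (2 * n + 1 + 1) / 2 = (n + 1) * (2 * n + 1) by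
      rw [show (2 * n + 1) * (2 * n + 1 + 1) = 2 * ((n + 1) * (2 * n + 1)) by ring,
        Nat.mul_div_cancel_left _ two_pos], neg_pow q, neg_neg,
      show ((n : ℤ) + 1) * (2 * (n + 1) - 1) = (((n + 1) * (2 * n + 1) : ℕ) : ℤ) by push_cast; ring,
      zpow_natCast, pow_mul, show (n : ℤ) + 1 = ((n + 1 : ℕ) : ℤ) by push_cast; ring, zpow_natCast]
    rcases Nat.even_or_odd (n + 1) with h | h <;> simp [h.neg_one_pow, (odd_two_mul_add_one n).neg_one_pow]
  simp only [← e1] at s1 ⊢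
  simp only [← e2] at s2 ⊢
  exact (tsum_even_add_odd (f := fun n : ℕ => (-q) ^ (n * (n + 1) / 2)) s1 s2).symm

lemma ramanujanPhi_neg {q : ℂ} (h0 : q ≠ 0) (hq : ‖q‖ < 1) :
    ramanujanPhi (-q) = qProd q q ^ 2 / qProd (q ^ 2) (q ^ 2) := by
  rw [ramanujanPhi_neg_eq_thetaSeries h0, thetaSeries_sq_self h0 hq]

lemma ramanujanPsi_neg {q : ℂ} (h0 : q ≠ 0) (hq : ‖q‖ < 1) :
    ramanujanPsi (-q) = qProd q q * qProd (q ^ 4) (q ^ 4) / qProd (q ^ 2) (q ^ 2) := by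
  rw [ramanujanPsi_neg_eq_thetaSeries h0 hq, thetaSeries_four_self h0 hq]

lemma ramanujanPhi_eq {q : ℂ} (h0 : q ≠ 0) (hq : ‖q‖ < 1) :
    ramanujanPhi q = qProd (q ^ 2) (q ^ 2) ^ 5 / (qProd q q ^ 2 * qProd (q ^ 4) (q ^ 4) ^ 2) := by
  have h := ramanujanPhi_neg (neg_ne_zero.mpr h0) (by rwa [norm_neg])
  have h2 := qProd_self_ne_zero (norm_pow_lt_one hq two_ne_zero)
  rw [neg_neg, neg_sq, qProd_neg_self hq] at h
  rw [h]
  field_simp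

lemma ramanujanPsi_eq {q : ℂ} (h0 : q ≠ 0) (hq : ‖q‖ < 1) :
    ramanujanPsi q = qProd (q ^ 2) (q ^ 2) ^ 2 / qProd q q := by
  have h := ramanujanPsi_neg (neg_ne_zero.mpr h0) (by rwa [norm_neg])
  have h2 := qProd_self_ne_zero (norm_pow_lt_one hq two_ne_zero)
  have h4 := qProd_self_ne_zero (norm_pow_lt_one hq four_ne_zero)
  rw [neg_neg, neg_sq, show (-q) ^ 4 = q ^ 4 by ring, qProd_neg_self hq] at h
  rw [h]
  field_simp

lemma thetaSeries_mul_neg {Q w : ℂ} (hQ0 : Q ≠ 0) (hQ : ‖Q‖ < 1) (hw : w ≠ 0) :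
    thetaSeries Q w * thetaSeries Q (-w) =
      qProd Q Q ^ 2 / qProd (Q ^ 2) (Q ^ 2) * thetaSeries (Q ^ 2) (w ^ 2) := by
  have hQ2 := norm_pow_lt_one hQ two_ne_zero
  have h2 := qProd_self_ne_zero hQ2
  have e1 := qProd_mul_neg w hQ
  have e2 := qProd_mul_neg (Q / w) hQ
  rw [thetaSeries_eq_qProd hQ0 hQ hw, thetaSeries_eq_qProd hQ0 hQ (neg_ne_zero.mpr hw),
    thetaSeries_eq_qProd (pow_ne_zero 2 hQ0) hQ2 (pow_ne_zero 2 hw), div_neg, ← div_pow, ← e1, ← e2]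
  field_simp

lemma thetaSqCoeff_zero {Q : ℂ} (hQ0 : Q ≠ 0) : thetaSqCoeff Q 0 = ramanujanPhi Q := by
  refine tsum_congr fun k => ?_
  have h1 : (k * (k - 1) / 2) * 2 = k * (k - 1) :=
    Int.ediv_mul_cancel (Int.even_mul_pred_self k).two_dvd
  have h2 : (-k * (-k - 1) / 2) * 2 = -k * (-k - 1) :=
    Int.ediv_mul_cancel (Int.even_mul_pred_self (-k)).two_dvd
  have h3 : -k * (-k - 1) / 2 + k * (k - 1) / 2 = ((k.natAbs ^ 2 : ℕ) : ℤ) := by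
    push_cast
    rw [sq_abs]
    linarith
  rw [zero_sub, thetaCoeff, thetaCoeff, mul_mul_mul_comm, ← zpow_add₀ hQ0, h3, zpow_natCast]
  rcases Int.even_or_odd k with h | h <;> simp [h.neg_one_zpow]

/-- The even-indexed coefficients of θ² obey a first-order recursion with base Q², hence are fixed
by the one at 0, which is φ(Q). -/
lemma thetaSqCoeff_two_mul {Q : ℂ} (hQ0 : Q ≠ 0) (m : ℤ) :
    thetaSqCoeff Q (2 * m) = ramanujanPhi Q * ((-1) ^ m * thetaCoeff (Q ^ 2) m) := by
  refine sub_eq_zero.mp (eq_zero_of_shift (pow_ne_zero 2 hQ0) one_pos (ε := 1) one_ne_zero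
    (d := fun m => thetaSqCoeff Q (2 * m) - ramanujanPhi Q * ((-1) ^ m * thetaCoeff (Q ^ 2) m))
    (fun n => ?_) (fun n h1 h2 => ?_) m)
  · have h : (Q ^ 2) ^ n = Q ^ (2 * n) := by rw [zpow_mul]; norm_cast
    push_cast
    rw [show 2 * (n + 1) = 2 * n + 2 by ring, thetaSqCoeff_shift hQ0,
      thetaCoeff_succ (pow_ne_zero 2 hQ0), zpow_add_one₀ (by norm_num), h]
    ring
  · obtain rfl : n = 0 := by push_cast at h2; omega
    simp [thetaSqCoeff_zero hQ0, thetaCoeff]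

lemma thetaSeries_sq_add_neg_sq {Q w : ℂ} (hQ0 : Q ≠ 0) (hQ : ‖Q‖ < 1) (hw : w ≠ 0) :
    thetaSeries Q w ^ 2 + thetaSeries Q (-w) ^ 2 =
      2 * (ramanujanPhi Q * thetaSeries (Q ^ 2) (-w ^ 2)) := by
  have hw' := neg_ne_zero.mpr hw
  have hE := entireLaurent_thetaSqCoeff hQ0 hQ
  rw [← tsum_thetaSqCoeff_mul_zpow hQ0 hQ hw, ← tsum_thetaSqCoeff_mul_zpow hQ0 hQ hw',
    ← (hE.summable hw).tsum_add (hE.summable hw'), thetaSeries, ← tsum_mul_left, ← tsum_mul_left]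
  have hinj : Function.Injective fun m : ℤ => 2 * m := fun a b h => by simpa using h
  rw [← hinj.tsum_eq]
  · refine tsum_congr fun m => ?_
    have h1 : w ^ (2 * m) = (w ^ 2) ^ m := by rw [zpow_mul]; norm_cast
    have h2 : (-w) ^ (2 * m) = (w ^ 2) ^ m := by
      rw [zpow_mul]
      norm_cast
      rw [neg_sq]
    rw [thetaSqCoeff_two_mul hQ0, h1, h2, neg_eq_neg_one_mul (w ^ 2), mul_zpow]
    ring
  · intro n hn
    rcases Int.even_or_odd n with ⟨m, rfl⟩ | h
    · exact ⟨m, two_mul m⟩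
    · simp [h.neg_zpow] at hn

/-- The even part of θ² in the case of base q² at w = q, where all three theta values are values of
φ. -/
lemma ramanujanPhi_sq_add_neg_sq {q : ℂ} (h0 : q ≠ 0) (hq : ‖q‖ < 1) :
    ramanujanPhi q ^ 2 + ramanujanPhi (-q) ^ 2 = 2 * ramanujanPhi (q ^ 2) ^ 2 := by
  have h := thetaSeries_sq_add_neg_sq (pow_ne_zero 2 h0) (norm_pow_lt_one hq two_ne_zero) h0
  have e1 := ramanujanPhi_neg_eq_thetaSeries (neg_ne_zero.mpr h0)
  have e2 := ramanujanPhi_neg_eq_thetaSeries (neg_ne_zero.mpr (pow_ne_zero 2 h0))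
  rw [neg_neg, neg_sq] at e1 e2
  rw [← ramanujanPhi_neg_eq_thetaSeries h0, ← e1, ← e2] at h
  linear_combination h

lemma thetaSeries_neg_sq_neg {p : ℂ} (h0 : p ≠ 0) (hp : ‖p‖ < 1) :
    thetaSeries (-p ^ 2) (-p) = qProd (p ^ 4) (p ^ 4) ^ 2 / qProd (p ^ 8) (p ^ 8) := by
  have hp2 := norm_pow_lt_one hp two_ne_zero
  have n2 := qProd_self_ne_zero hp2
  have n4 := qProd_self_ne_zero (norm_pow_lt_one hp four_ne_zero)
  have n8 := qProd_self_ne_zero (norm_pow_lt_one hp (k := 8) (by norm_num))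
  have e1 := qProd_neg_self hp2
  have e2 := qProd_self_eq hp2
  have e3 := qProd_mul_neg (Q := -p ^ 2) p (by rwa [norm_neg])
  rw [neg_sq] at e3
  simp only [← pow_mul] at e1 e2 e3
  norm_num at e1 e2 e3
  rw [thetaSeries_eq_qProd (neg_ne_zero.mpr (pow_ne_zero 2 h0)) (by rwa [norm_neg])
    (neg_ne_zero.mpr h0), show -p ^ 2 / -p = p by field_simp, mul_comm (qProd (-p) _), e3, e1]
  have e4 : qProd (p ^ 2) (p ^ 4) = qProd (p ^ 2) (p ^ 2) / qProd (p ^ 4) (p ^ 4) := by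
    rw [e2]
    field_simp
  rw [e4]
  field_simp

/-! ### Lambert series of weight three -/

lemma hasSum_lambertRegular {Q : ℂ} (hQ : ‖Q‖ < 1) {w : ℂ} (h1 : ‖Q‖ < ‖w‖) (h2 : ‖w‖ ≤ 1) :
    HasSum (fun J : ℕ => (J : ℂ) ^ 2 / (1 - Q ^ J) * Q ^ J * (w ^ J - (w ^ J)⁻¹))
      (lambertRegular Q w) := by
  have h3 : ‖Q / w‖ < 1 := by
    rw [norm_div]
    exact (div_lt_one ((norm_nonneg Q).trans_lt h1)).mpr h1
  have h4 : ‖Q * w‖ < 1 := by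
    rw [norm_mul]
    exact mul_lt_one_of_nonneg_of_lt_one_left (norm_nonneg _) hQ h2
  have s1 := (summable_lambert_nat hQ h4).of_norm
  have s2 := (summable_lambert_nat hQ h3).of_norm
  refine Summable.hasSum ((s1.sub s2).congr fun J => ?_)
  rw [mul_pow, div_pow]
  ring

lemma hasSum_lambertSeries {Q : ℂ} (hQ : ‖Q‖ < 1) {w : ℂ} (h1 : ‖Q‖ < ‖w‖) (h2 : ‖w‖ < 1) :
    HasSum (fun J : ℕ => (J : ℂ) ^ 2 * (w ^ J + Q ^ J / (1 - Q ^ J) * (w ^ J - (w ^ J)⁻¹)))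
      (lambertSeries Q w) := by
  convert! (hasSum_sq_mul_geometric h2).add (hasSum_lambertRegular hQ h1 h2.le) using 1
  funext J
  ring

/-- Peeling off one period gives a linear equation for the sum. The multiplier δ also admits
antiperiodic sequences, so half a period suffices for the characters modulo 4 and 8. -/
lemma hasSum_periodic_mul_pow {ε : ℕ → ℤ} (hε : ∀ m, |ε m| ≤ 1) {k : ℕ} (hk : k ≠ 0) {δ : ℤ}
    (hδ : |δ| ≤ 1) (h : ∀ m, ε (m + k) = δ * ε m) {x : ℂ} (hx : ‖x‖ < 1) :
    HasSum (fun m => (ε m : ℂ) * x ^ m)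
      ((∑ i ∈ Finset.range k, (ε i : ℂ) * x ^ i) / (1 - δ * x ^ k)) := by
  have hs : Summable fun m => (ε m : ℂ) * x ^ m := by
    refine .of_norm (.of_nonneg_of_le (fun m => norm_nonneg _) (fun m => ?_)
      (summable_geometric_of_lt_one (norm_nonneg x) hx))
    have : ‖(ε m : ℂ)‖ ≤ 1 := by
      rw [Complex.norm_intCast]
      exact_mod_cast hε m
    rw [norm_mul, norm_pow]
    exact mul_le_of_le_one_left (by positivity) this
  have hne : 1 - (δ : ℂ) * x ^ k ≠ 0 := by
    intro h0
    have h1 : ‖(δ : ℂ) * x ^ k‖ < 1 := by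
      have : ‖(δ : ℂ)‖ ≤ 1 := by
        rw [Complex.norm_intCast]
        exact_mod_cast hδ
      rw [norm_mul]
      exact (mul_le_of_le_one_left (norm_nonneg _) this).trans_lt (norm_pow_lt_one hx hk)
    rw [← sub_eq_zero.mp h0] at h1
    simp at h1
  have h1 := hs.sum_add_tsum_nat_add k
  have h2 : ∑' m, (ε (m + k) : ℂ) * x ^ (m + k) = δ * x ^ k * ∑' m, (ε m : ℂ) * x ^ m := by
    rw [← tsum_mul_left]
    refine tsum_congr fun m => ?_
    rw [h, pow_add]
    push_cast
    ring
  rw [h2] at h1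
  convert! hs.hasSum using 1
  rw [div_eq_iff hne]
  linear_combination h1

/-- The quadratic character modulo `3`. -/
def chiThree (m : ℕ) : ℤ := quadraticChar (ZMod 3) m

/-- The quadratic character modulo `4`. -/
def chiFour (m : ℕ) : ℤ := ZMod.χ₄ m

/-- The even quadratic character modulo `8`. -/
def chiEight (m : ℕ) : ℤ := ZMod.χ₈ m

/-- The sequence `(-1)^m`, with value zero at `m = 0`. -/
def altSign (m : ℕ) : ℤ := if m = 0 then 0 else (-1) ^ m

lemma chiThree_mul (m n : ℕ) : chiThree (m * n) = chiThree m * chiThree n := by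
  rw [chiThree, chiThree, chiThree, Nat.cast_mul, map_mul]

lemma chiFour_mul (m n : ℕ) : chiFour (m * n) = chiFour m * chiFour n := by
  rw [chiFour, chiFour, chiFour, Nat.cast_mul, map_mul]

lemma abs_chiThree_le (m : ℕ) : |chiThree m| ≤ 1 := by
  rw [chiThree]
  generalize (m : ZMod 3) = a
  revert a
  decide

lemma abs_chiFour_le (m : ℕ) : |chiFour m| ≤ 1 := by
  rw [chiFour]
  generalize (m : ZMod 4) = a
  revert a
  decide

lemma abs_chiEight_le (m : ℕ) : |chiEight m| ≤ 1 := by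
  rw [chiEight]
  generalize (m : ZMod 8) = a
  revert a
  decide

lemma abs_altSign_le (m : ℕ) : |altSign m| ≤ 1 := by
  rw [altSign]
  split_ifs
  · simp
  · simp

lemma chiThree_add (m : ℕ) : chiThree (m + 3) = 1 * chiThree m := by
  have : ((m + 3 : ℕ) : ZMod 3) = m := by
    push_cast
    rw [show (3 : ZMod 3) = 0 by decide, add_zero]
  rw [chiThree, chiThree, this, one_mul]

lemma chiFour_add (m : ℕ) : chiFour (m + 2) = -1 * chiFour m := by
  rw [chiFour, chiFour]
  push_cast
  generalize (m : ZMod 4) = a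
  revert a
  decide

lemma chiEight_add (m : ℕ) : chiEight (m + 4) = -1 * chiEight m := by
  rw [chiEight, chiEight]
  push_cast
  generalize (m : ZMod 8) = a
  revert a
  decide

lemma chiThree_zero : chiThree 0 = 0 := by decide
lemma chiThree_one : chiThree 1 = 1 := by decide
lemma chiThree_two : chiThree 2 = -1 := by decide
lemma chiFour_zero : chiFour 0 = 0 := by decide
lemma chiFour_one : chiFour 1 = 1 := by decide
lemma chiEight_zero : chiEight 0 = 0 := by decide
lemma chiEight_one : chiEight 1 = 1 := by decide
lemma chiEight_two : chiEight 2 = 0 := by decide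
lemma chiEight_three : chiEight 3 = -1 := by decide
lemma altSign_zero : altSign 0 = 0 := rfl

lemma one_sub_ne_zero_of_norm_lt {x : ℂ} (hx : ‖x‖ < 1) : 1 - x ≠ 0 := by
  intro h
  rw [← sub_eq_zero.mp h, norm_one] at hx
  exact lt_irrefl _ hx

lemma hasSum_chiThree {x : ℂ} (hx : ‖x‖ < 1) :
    HasSum (fun m => (chiThree m : ℂ) * x ^ m) ((x - x ^ 2) / (1 - x ^ 3)) := by
  have := hasSum_periodic_mul_pow abs_chiThree_le three_ne_zero (by simp) chiThree_add hx
  simpa [Finset.sum_range_succ, chiThree_zero, chiThree_one, chiThree_two, sub_eq_add_neg] using this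

lemma hasSum_chiFour {x : ℂ} (hx : ‖x‖ < 1) :
    HasSum (fun m => (chiFour m : ℂ) * x ^ m) (x / (1 + x ^ 2)) := by
  have := hasSum_periodic_mul_pow abs_chiFour_le two_ne_zero (by simp) chiFour_add hx
  simpa [Finset.sum_range_succ, chiFour_zero, chiFour_one] using this

lemma hasSum_chiEight {x : ℂ} (hx : ‖x‖ < 1) :
    HasSum (fun m => (chiEight m : ℂ) * x ^ m) ((x - x ^ 3) / (1 + x ^ 4)) := by
  have := hasSum_periodic_mul_pow abs_chiEight_le four_ne_zero (by simp) chiEight_add hx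
  simpa [Finset.sum_range_succ, chiEight_zero, chiEight_one, chiEight_two, chiEight_three,
    sub_eq_add_neg] using this

lemma hasSum_altSign {x : ℂ} (hx : ‖x‖ < 1) :
    HasSum (fun m => (altSign m : ℂ) * x ^ m) (-x / (1 + x)) := by
  have h := hasSum_geometric_of_norm_lt_one (ξ := -x) (by rwa [norm_neg])
  have h' := h.sub (hasSum_ite_eq (0 : ℕ) (1 : ℂ))
  convert! h' using 1
  · funext m
    rcases eq_or_ne m 0 with rfl | hm
    · simp [altSign]
    · simp [altSign, hm, ← mul_pow]
  · have := one_sub_ne_zero_of_norm_lt (x := -x) (by rwa [norm_neg])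
    rw [sub_neg_eq_add] at this ⊢
    field_simp
    ring

/-- The terms `α(J) ε(m) J² u^{Jm}` of a double Lambert series of weight three. -/
noncomputable def lambertTerm (α ε : ℕ → ℤ) (u : ℂ) (p : ℕ × ℕ) : ℂ :=
  α p.1 * ε p.2 * (p.1 : ℂ) ^ 2 * u ^ (p.1 * p.2)

/-- For J, m ≥ 1 one has J + m ≤ 2Jm, so with ρ = √‖u‖ the power ‖u‖^(Jm) is at most ρ^J ρ^m and the
double series is dominated by a product. The condition on ε(0) removes m = 0, where there is no
decay. -/
lemma summable_lambertTerm {α ε : ℕ → ℤ} (hα : ∀ m, |α m| ≤ 1) (hε : ∀ m, |ε m| ≤ 1)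
    (h0 : ε 0 = 0) {u : ℂ} (hu : ‖u‖ < 1) : Summable fun p => ‖lambertTerm α ε u p‖ := by
  set ρ := √‖u‖ with hρ
  have hρ0 : 0 ≤ ρ := sqrt_nonneg _
  have hρ1 : ρ < 1 := (Real.sqrt_lt' one_pos).mpr (by simpa using hu)
  have hρu : ‖u‖ = ρ ^ 2 := (Real.sq_sqrt (norm_nonneg u)).symm
  have s1 := summable_sq_mul_geometric hρ0 hρ1 1
  have s2 := summable_geometric_of_lt_one hρ0 hρ1
  refine .of_nonneg_of_le (fun p => norm_nonneg _) (fun p => ?_)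
    (s1.mul_of_nonneg s2 (fun J => by positivity) (fun m => by positivity))
  obtain ⟨J, m⟩ := p
  rcases m.eq_zero_or_pos with rfl | hm
  · simp only [lambertTerm, h0]
    simp
    positivity
  rcases J.eq_zero_or_pos with rfl | hJ
  · simp [lambertTerm]
  have n1 : ‖(α J : ℂ)‖ ≤ 1 := by
    rw [Complex.norm_intCast]
    exact_mod_cast hα J
  have n2 : ‖(ε m : ℂ)‖ ≤ 1 := by
    rw [Complex.norm_intCast]
    exact_mod_cast hε m
  have e1 : J + m ≤ 2 * (J * m) := by nlinarith
  have n3 : ‖u‖ ^ (J * m) ≤ ρ ^ J * ρ ^ m := by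
    rw [hρu, ← pow_mul, ← pow_add]
    exact pow_le_pow_of_le_one hρ0 hρ1.le e1
  calc ‖lambertTerm α ε u (J, m)‖ = ‖(α J : ℂ)‖ * ‖(ε m : ℂ)‖ * (J : ℝ) ^ 2 * ‖u‖ ^ (J * m) := by
        simp [lambertTerm]
    _ ≤ 1 * 1 * (J : ℝ) ^ 2 * (ρ ^ J * ρ ^ m) := by gcongr
    _ = _ := by ring

lemma tsum_lambertTerm {α ε : ℕ → ℤ} (hα : ∀ m, |α m| ≤ 1) (hε : ∀ m, |ε m| ≤ 1)
    (h0 : ε 0 = 0) {K : ℂ → ℂ} (hK : ∀ x : ℂ, ‖x‖ < 1 → HasSum (fun m => (ε m : ℂ) * x ^ m) (K x))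
    {u : ℂ} (hu : ‖u‖ < 1) :
    ∑' p, lambertTerm α ε u p = ∑' J : ℕ, (α J : ℂ) * (J : ℂ) ^ 2 * K (u ^ J) := by
  rw [(summable_lambertTerm hα hε h0 hu).of_norm.tsum_prod]
  refine tsum_congr fun J => ?_
  rcases J.eq_zero_or_pos with rfl | hJ
  · simp [lambertTerm]
  · rw [← (hK (u ^ J) (norm_pow_lt_one hu hJ.ne')).tsum_eq, ← tsum_mul_left]
    refine tsum_congr fun m => ?_
    rw [lambertTerm, pow_mul]
    ring

/-- The constant sequence one. -/
def constOne (_ : ℕ) : ℤ := 1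

lemma abs_constOne_le (m : ℕ) : |constOne m| ≤ 1 := by simp [constOne]

lemma pow_lt_norm {u : ℂ} (h0 : u ≠ 0) (hu : ‖u‖ < 1) {k : ℕ} (hk : 1 < k) : ‖u ^ k‖ < ‖u‖ := by
  rw [norm_pow]
  exact pow_lt_self_of_lt_one₀ (norm_pos_iff.mpr h0) hu hk

/-- The Lambert series of `η(3τ)^9 / η(τ)^3`. -/
theorem lambert_etaQuotient {u : ℂ} (h0 : u ≠ 0) (hu : ‖u‖ < 1) :
    u * (ramanujanF (-u ^ 3) ^ 9 / ramanujanF (-u) ^ 3) =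
      ∑' p, lambertTerm constOne chiThree u p := by
  have hu3 := norm_pow_lt_one hu three_ne_zero
  have h13 := pow_lt_norm h0 hu (k := 3) (by norm_num)
  have hP := qProd_self_ne_zero hu
  have key := thetaSeries_pow_four_mul_lambertSeries (pow_ne_zero 3 h0) hu3 h13 hu.le
    (by rintro rfl; simp at hu)
  -- Both theta values equal (u;u), so the product formula reads (u;u)⁴ L = (u³;u³)⁹ u (u;u).
  rw [thetaSeries_cube_self h0 hu, thetaSeries_cube_sq h0 hu] at key
  rw [tsum_lambertTerm abs_constOne_le abs_chiThree_le chiThree_zero (fun x => hasSum_chiThree) hu,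
    ramanujanF_neg, ramanujanF_neg]
  have h : lambertSeries (u ^ 3) u = u * (qProd (u ^ 3) (u ^ 3) ^ 9 / qProd u u ^ 3) := by
    field_simp
    refine mul_left_cancel₀ hP ?_
    linear_combination key
  rw [← h, ← (hasSum_lambertSeries hu3 h13 hu).tsum_eq]
  refine tsum_congr fun J => ?_
  rcases J.eq_zero_or_pos with rfl | hJ
  · simp
  · have hx0 := pow_ne_zero J h0
    have hx := norm_pow_lt_one hu hJ.ne'
    rw [← pow_mul, mul_comm 3 J, pow_mul]
    generalize u ^ J = x at *
    have h3 := one_sub_ne_zero_of_norm_lt (norm_pow_lt_one hx three_ne_zero)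
    simp only [constOne]
    push_cast
    field_simp
    ring

/-- The Lambert series of `φ(u)² ψ(u²)⁴`. -/
theorem lambert_phi_sq_mul_psi_pow {u : ℂ} (h0 : u ≠ 0) (hu : ‖u‖ < 1) :
    u * (ramanujanPhi u ^ 2 * ramanujanPsi (u ^ 2) ^ 4) =
      ∑' p, lambertTerm constOne chiFour u p := by
  have hu2 := norm_pow_lt_one hu two_ne_zero
  have hu4 := norm_pow_lt_one hu four_ne_zero
  have h14 := pow_lt_norm h0 hu (k := 4) (by norm_num)
  have hP := qProd_self_ne_zero hu
  have hP2 := qProd_self_ne_zero hu2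
  have hP4 := qProd_self_ne_zero hu4
  have key := thetaSeries_pow_four_mul_lambertSeries (pow_ne_zero 4 h0) hu4 h14 hu.le
    (by rintro rfl; simp at hu)
  have e := thetaSeries_sq_self (pow_ne_zero 2 h0) hu2
  have ePsi := ramanujanPsi_eq (pow_ne_zero 2 h0) hu2
  simp only [← pow_mul, Nat.reduceMul] at e ePsi
  rw [thetaSeries_four_self h0 hu, e] at key
  rw [tsum_lambertTerm abs_constOne_le abs_chiFour_le chiFour_zero (fun x => hasSum_chiFour) hu,
    ramanujanPhi_eq h0 hu, ePsi]
  have h : lambertSeries (u ^ 4) u = u * ((qProd (u ^ 2) (u ^ 2) ^ 5 /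
      (qProd u u ^ 2 * qProd (u ^ 4) (u ^ 4) ^ 2)) ^ 2 *
      (qProd (u ^ 4) (u ^ 4) ^ 2 / qProd (u ^ 2) (u ^ 2)) ^ 4) := by
    generalize lambertSeries (u ^ 4) u = S at *
    generalize qProd (u ^ 2) (u ^ 2) = b at *
    generalize qProd (u ^ 4) (u ^ 4) = c at *
    generalize qProd u u = a at *
    have : (a * c / b) ^ 4 ≠ 0 := by positivity
    refine mul_left_cancel₀ this (key.trans ?_)
    field_simp
  rw [← h, ← (hasSum_lambertSeries hu4 h14 hu).tsum_eq]
  refine tsum_congr fun J => ?_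
  rcases J.eq_zero_or_pos with rfl | hJ
  · simp
  · have hx0 := pow_ne_zero J h0
    have hx := norm_pow_lt_one hu hJ.ne'
    rw [← pow_mul, mul_comm 4 J, pow_mul]
    generalize u ^ J = x at *
    have h3 := one_sub_ne_zero_of_norm_lt (norm_pow_lt_one hx four_ne_zero)
    have h4 : 1 + x ^ 2 ≠ 0 := by
      have := one_sub_ne_zero_of_norm_lt (x := -x ^ 2)
        (by rw [norm_neg]; exact norm_pow_lt_one hx two_ne_zero)
      rwa [sub_neg_eq_add] at this
    simp only [constOne]
    push_cast
    field_simp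
    ring

lemma I_pow_two_mul_add_one (k : ℕ) :
    Complex.I ^ (2 * k + 1) = Complex.I * chiFour (2 * k + 1) := by
  induction k with
  | zero => simp [chiFour_one]
  | succ k ih =>
    rw [show 2 * (k + 1) + 1 = 2 * k + 1 + 2 by ring, chiFour_add, pow_add, ih, Complex.I_sq]
    push_cast
    ring

lemma chiFour_two_mul (k : ℕ) : chiFour (2 * k) = 0 := by
  induction k with
  | zero => exact chiFour_zero
  | succ k ih => rw [mul_add, mul_one, chiFour_add, ih, mul_zero]

lemma chiFour_odd_sq (k : ℕ) : (chiFour (2 * k + 1) : ℂ) ^ 2 = 1 := by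
  have h := congrArg (· ^ 2) (I_pow_two_mul_add_one k)
  simp only [mul_pow, Complex.I_sq, ← pow_mul] at h
  rw [mul_comm, pow_mul, Complex.I_sq, (odd_two_mul_add_one k).neg_one_pow] at h
  linear_combination h

lemma inv_I_pow_two_mul_add_one (k : ℕ) :
    (Complex.I ^ (2 * k + 1))⁻¹ = -(Complex.I * chiFour (2 * k + 1)) := by
  rw [I_pow_two_mul_add_one]
  refine inv_eq_of_mul_eq_one_right ?_
  linear_combination -(chiFour (2 * k + 1) : ℂ) ^ 2 * Complex.I_sq + chiFour_odd_sq k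

lemma thetaSeries_neg_one {q : ℂ} (h0 : q ≠ 0) (hq : ‖q‖ < 1) :
    thetaSeries q (-1) = 2 * qProd (q ^ 2) (q ^ 2) ^ 2 / qProd q q := by
  have hP := qProd_self_ne_zero hq
  have e := qProd_mul_neg q hq
  rw [thetaSeries_eq_qProd h0 hq (by norm_num), qProd_eq_mul (-1) hq, ← e,
    show q / -1 = -q by ring, neg_one_mul]
  field_simp
  ring

lemma thetaSeries_I {q : ℂ} (h0 : q ≠ 0) (hq : ‖q‖ < 1) :
    thetaSeries q Complex.I =
      (1 - Complex.I) * (qProd q q * qProd (q ^ 4) (q ^ 4) / qProd (q ^ 2) (q ^ 2)) := by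
  have hq2 := norm_pow_lt_one hq two_ne_zero
  have hP := qProd_self_ne_zero hq2
  have e := qProd_mul_neg (Complex.I * q) hq
  have e2 := qProd_mul_neg (q ^ 2) hq2
  simp only [← pow_mul, Nat.reduceMul] at e2
  rw [mul_pow, Complex.I_sq, neg_one_mul] at e
  rw [thetaSeries_eq_qProd h0 hq Complex.I_ne_zero, qProd_eq_mul Complex.I hq, ← e2, ← e,
    show q / Complex.I = -(Complex.I * q) by rw [Complex.div_I]; ring]
  field_simp

/-- The Lambert series of `φ(-q)² φ(q)⁴`. -/
theorem lambert_phi_neg_sq_mul_phi_pow {q : ℂ} (h0 : q ≠ 0) (hq : ‖q‖ < 1) :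
    ramanujanPhi (-q) ^ 2 * ramanujanPhi q ^ 4 =
      1 - 4 * ∑' p, lambertTerm chiFour altSign q p := by
  obtain ⟨Q, rfl⟩ : ∃ Q, q = -Q := ⟨-q, by ring⟩
  rw [neg_ne_zero] at h0
  have hQ : ‖Q‖ < 1 := by rwa [norm_neg] at hq
  have hQ2 := norm_pow_lt_one hQ two_ne_zero
  have hQ4 := norm_pow_lt_one hQ four_ne_zero
  have key := thetaSeries_pow_four_mul_lambertSeries h0 hQ (w := Complex.I) (by simpa using hQ)
    (by simp) (by simp [Complex.ext_iff])
  rw [Complex.I_sq, thetaSeries_neg_one h0 hQ, thetaSeries_I h0 hQ] at key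
  have hI : (1 - Complex.I) ^ 4 = -4 := by
    linear_combination (Complex.I ^ 2 - 4 * Complex.I + 5) * Complex.I_sq
  rw [tsum_lambertTerm abs_chiFour_le abs_altSign_le altSign_zero (fun x => hasSum_altSign) hq,
    neg_neg, ramanujanPhi_neg h0 hQ, ramanujanPhi_eq h0 hQ]
  -- At w = i the even J cancel. For odd J and x = (-Q)^J one has Q^J/(1 - Q^J) = -x/(1 + x), which
  -- generates (-1)^m; this is why q = -Q. The polar part gives -i/2.
  have h : lambertSeries Q Complex.I = -(Complex.I / 2) * (1 - 4 * ∑' J : ℕ,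
      (chiFour J : ℂ) * (J : ℂ) ^ 2 * (-(-Q) ^ J / (1 + (-Q) ^ J))) := by
    have e1 : Complex.I * (1 + Complex.I) / (1 - Complex.I) ^ 3 = -(Complex.I / 2) := by
      have h1 : 1 - Complex.I ≠ 0 := by
        intro h
        rw [h] at hI
        norm_num at hI
      rw [div_eq_iff (pow_ne_zero 3 h1)]
      linear_combination (-Complex.I ^ 2 / 2 + 3 / 2 * Complex.I) * Complex.I_sq
    rw [lambertSeries, e1, ← (hasSum_lambertRegular hQ (w := Complex.I) (by simpa using hQ)
      (by simp)).tsum_eq, mul_sub, mul_one, ← mul_assoc, ← tsum_mul_left, sub_eq_add_neg]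
    congr 1
    rw [← tsum_neg]
    refine tsum_congr fun J => ?_
    rcases Nat.even_or_odd' J with ⟨k, rfl | rfl⟩
    · rw [chiFour_two_mul, pow_mul Complex.I, Complex.I_sq]
      rcases Nat.even_or_odd k with h | h <;> simp [h.neg_one_pow]
    · rw [inv_I_pow_two_mul_add_one, I_pow_two_mul_add_one, (odd_two_mul_add_one k).neg_pow]
      ring
  generalize lambertSeries Q Complex.I = S at *
  generalize (1 - 4 * ∑' J : ℕ,
      (chiFour J : ℂ) * (J : ℂ) ^ 2 * (-(-Q) ^ J / (1 + (-Q) ^ J))) = L at *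
  have hP := qProd_self_ne_zero hQ
  have hP2 := qProd_self_ne_zero hQ2
  have hP4 := qProd_self_ne_zero hQ4
  rw [h, mul_pow, hI] at key
  generalize qProd (Q ^ 2) (Q ^ 2) = b at *
  generalize qProd (Q ^ 4) (Q ^ 4) = c at *
  generalize qProd Q Q = a at *
  have h2 : 2 * Complex.I * (a * c / b) ^ 4 ≠ 0 :=
    mul_ne_zero (mul_ne_zero two_ne_zero Complex.I_ne_zero)
      (pow_ne_zero 4 (div_ne_zero (mul_ne_zero hP hP4) hP2))
  refine mul_left_cancel₀ h2 (Eq.trans ?_ ((by linear_combination -key :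
    a ^ 9 * (Complex.I * (2 * b ^ 2 / a)) = 2 * Complex.I * (a * c / b) ^ 4 * L)))
  field_simp

/-- The Lambert series of `φ(-u²) φ(u⁴) (3 ψ(-u²)⁴ - ψ(u²)⁴)`. -/
theorem lambert_phi_mul_phi_mul_psi {u : ℂ} (h0 : u ≠ 0) (hu : ‖u‖ < 1) :
    u * (ramanujanPhi (-u ^ 2) * ramanujanPhi (u ^ 4) *
      (3 * ramanujanPsi (-u ^ 2) ^ 4 - ramanujanPsi (u ^ 2) ^ 4)) =
      2 * ∑' p, lambertTerm chiFour chiEight u p := by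
  -- The base is Q = -p² = -u⁴ and the points are ±w with w = iu. In L(w) - L(-w) only odd J
  -- survive, with sign χ₄(J) and kernel (x - x³)/(1 + x⁴), the generating function of χ₈. With A =
  -- θ(w) and B = θ(-w), the product formulas at ±w combine to an expression in AB and A⁴ + B⁴.
  obtain ⟨p, hp⟩ : ∃ p, p = u ^ 2 := ⟨_, rfl⟩
  obtain ⟨w, hw⟩ : ∃ w, w = Complex.I * u := ⟨_, rfl⟩
  have hp0 : p ≠ 0 := by rw [hp]; exact pow_ne_zero 2 h0
  have hp1 : ‖p‖ < 1 := by rw [hp]; exact norm_pow_lt_one hu two_ne_zero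
  have hw0 : w ≠ 0 := by rw [hw]; exact mul_ne_zero Complex.I_ne_zero h0
  have hwn : ‖w‖ = ‖u‖ := by simp [hw]
  have hw2 : w ^ 2 = -p := by rw [hw, hp, mul_pow, Complex.I_sq]; ring
  have hp2 := norm_pow_lt_one hp1 two_ne_zero
  have hp4 := norm_pow_lt_one hp1 four_ne_zero
  have hp8 := norm_pow_lt_one hp1 (k := 8) (by norm_num)
  have hQ0 : -p ^ 2 ≠ 0 := neg_ne_zero.mpr (pow_ne_zero 2 hp0)
  have hQ : ‖-p ^ 2‖ < 1 := by rwa [norm_neg]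
  have hQw : ‖-p ^ 2‖ < ‖w‖ := by
    rw [norm_neg, hwn, hp, ← pow_mul]
    exact pow_lt_norm h0 hu (by norm_num)
  have hw1 : ‖w‖ < 1 := by rwa [hwn]
  have k1 := thetaSeries_pow_four_mul_lambertSeries hQ0 hQ hQw hw1.le
    (by rintro rfl; simp at hw1)
  have k2 := thetaSeries_pow_four_mul_lambertSeries hQ0 hQ (w := -w) (by rwa [norm_neg w])
    (by rw [norm_neg]; exact hw1.le) (by
      intro h
      rw [← norm_neg, h] at hw1
      simp at hw1)
  have kAB := thetaSeries_mul_neg hQ0 hQ hw0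
  have kE := thetaSeries_sq_add_neg_sq hQ0 hQ hw0
  rw [neg_sq, hw2, thetaSeries_neg_sq_neg hp0 hp1] at k2
  rw [hw2, thetaSeries_neg_sq_neg hp0 hp1] at k1
  have hpsi := ramanujanPsi_neg_eq_thetaSeries (neg_ne_zero.mpr hp0) (by rwa [norm_neg])
  have hpsi2 := ramanujanPsi_neg_eq_thetaSeries hp0 hp1
  rw [neg_neg, show (-p) ^ 4 = p ^ 4 by ring] at hpsi
  rw [neg_sq, ← pow_mul, hw2, show p ^ (2 * 2) = p ^ 4 by norm_num, ← hpsi] at kAB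
  rw [neg_sq, ← pow_mul, hw2, neg_neg, show p ^ (2 * 2) = p ^ 4 by norm_num, ← hpsi2] at kE
  have hPQ := qProd_neg_self hp2
  have hphi := ramanujanPhi_eq hp0 hp1
  have hphin := ramanujanPhi_neg hp0 hp1
  have hphi2 := ramanujanPhi_eq (pow_ne_zero 2 hp0) hp2
  have hphi2n := ramanujanPhi_neg (pow_ne_zero 2 hp0) hp2
  have hR := ramanujanPhi_sq_add_neg_sq hp0 hp1
  simp only [← pow_mul, Nat.reduceMul] at hPQ hphi2 hphi2n
  have hS : lambertSeries (-p ^ 2) w - lambertSeries (-p ^ 2) (-w) =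
      2 * Complex.I * ∑' J : ℕ, (chiFour J : ℂ) * (J : ℂ) ^ 2 *
        ((u ^ J - (u ^ J) ^ 3) / (1 + (u ^ J) ^ 4)) := by
    rw [← tsum_mul_left, ← ((hasSum_lambertSeries hQ hQw hw1).sub (hasSum_lambertSeries hQ
      (w := -w) (by rwa [norm_neg w]) (by rwa [norm_neg]))).tsum_eq]
    refine tsum_congr fun J => ?_
    rcases Nat.even_or_odd' J with ⟨k, rfl | rfl⟩
    · rw [chiFour_two_mul, (even_two_mul k).neg_pow w]
      simp
    · have hx0 := pow_ne_zero (2 * k + 1) h0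
      have hx := norm_pow_lt_one hu (k := 2 * k + 1) (by omega)
      have hQJ : (-p ^ 2) ^ (2 * k + 1) = -(u ^ (2 * k + 1)) ^ 4 := by
        rw [(odd_two_mul_add_one k).neg_pow, hp]
        ring
      rw [(odd_two_mul_add_one k).neg_pow w, hQJ, hw, mul_pow, mul_inv, inv_neg, mul_inv,
        inv_I_pow_two_mul_add_one, I_pow_two_mul_add_one]
      generalize u ^ (2 * k + 1) = x at *
      have h4 : 1 + x ^ 4 ≠ 0 := by
        have := one_sub_ne_zero_of_norm_lt (x := -x ^ 4)
          (by rw [norm_neg]; exact norm_pow_lt_one hx four_ne_zero)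
        rwa [sub_neg_eq_add] at this
      rw [sub_neg_eq_add]
      field_simp
      ring
  rw [tsum_lambertTerm abs_chiFour_le abs_chiEight_le chiEight_zero (fun x => hasSum_chiEight) hu,
    ← hp, show u ^ 4 = p ^ 2 by rw [hp]; ring]
  generalize (∑' J : ℕ, (chiFour J : ℂ) * (J : ℂ) ^ 2 *
        ((u ^ J - (u ^ J) ^ 3) / (1 + (u ^ J) ^ 4))) = L at *
  have n1 := qProd_self_ne_zero hp1
  have n2 := qProd_self_ne_zero hp2
  have n4 := qProd_self_ne_zero hp4
  have n8 := qProd_self_ne_zero hp8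
  have hψ := ramanujanPsi_eq hp0 hp1
  have hψn := ramanujanPsi_neg hp0 hp1
  generalize thetaSeries (-p ^ 2) w = A at *
  generalize thetaSeries (-p ^ 2) (-w) = B at *
  generalize lambertSeries (-p ^ 2) w = S1 at *
  generalize lambertSeries (-p ^ 2) (-w) = S2 at *
  rw [hPQ] at k1 k2 kAB
  rw [hphi2n] at kE
  rw [hphi, hphin, hphi2] at hR
  rw [hψ] at kAB
  rw [hψn] at kE
  rw [hphin, hphi2, hψ, hψn]
  generalize qProd p p = a at *
  generalize qProd (p ^ 2) (p ^ 2) = b at *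
  generalize qProd (p ^ 4) (p ^ 4) = c at *
  generalize qProd (p ^ 8) (p ^ 8) = d at *
  have kAB' : A * B = c ^ 5 / (a * d ^ 2) := by
    rw [kAB]
    field_simp
  have kE' : A ^ 2 + B ^ 2 = 2 * (a * b) := by
    rw [kE]
    field_simp
  -- Use A⁴ + B⁴ = (A² + B²)² - 2(AB)². Here AB = φ(p²) ψ(p), and 2φ(p²)² = φ(p)² + φ(-p)². Since
  -- φ(-p)² ψ(p)² equals (ab)², it reduces the coefficient 4 to the 3 of the statement.
  have k4 : A ^ 4 + B ^ 4 = 4 * (a * b) ^ 2 -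
      ((b ^ 5 / (a ^ 2 * c ^ 2)) ^ 2 + (a ^ 2 / b) ^ 2) * (b ^ 2 / a) ^ 2 := by
    rw [hR, show A ^ 4 + B ^ 4 = (A ^ 2 + B ^ 2) ^ 2 - 2 * (A * B) ^ 2 by ring, kAB', kE']
    field_simp
    ring
  -- The right sides of the two product formulas differ only by the sign of w, so the
  -- cross-multiplied difference carries the sum A⁴ + B⁴.
  have k5 : (A * B) ^ 4 * (2 * L) = (c ^ 3 / (b * d)) ^ 9 * u * (c ^ 2 / d) * (A ^ 4 + B ^ 4) := by
    refine mul_left_cancel₀ Complex.I_ne_zero ?_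
    rw [hw] at k1 k2
    linear_combination -(A * B) ^ 4 * hS + B ^ 4 * k1 - A ^ 4 * k2
  have hAB : (A * B) ^ 4 ≠ 0 := by
    rw [kAB']
    exact pow_ne_zero 4 (div_ne_zero (pow_ne_zero 5 n4) (mul_ne_zero n1 (pow_ne_zero 2 n8)))
  refine mul_left_cancel₀ hAB (Eq.trans ?_ k5.symm)
  rw [k4, kAB']
  field_simp
  ring

/-! ### Summation over one lattice direction -/

lemma div_mul_sq_eq_sub {c y r : ℂ} (hr : r ≠ 0) (hy : y ≠ 0) (h1 : c + Complex.I * y ≠ 0)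
    (h2 : c - Complex.I * y ≠ 0) : c / ((c + Complex.I * y) * (c - Complex.I * y)) ^ 2 =
      1 / (4 * Complex.I * y * r ^ 2) *
        (1 / (-(c - Complex.I * y) / r) ^ 2 - 1 / ((c + Complex.I * y) / r) ^ 2) := by
  have hI := Complex.I_ne_zero
  field_simp
  ring

/-- Partial fractions give a difference of 1/(z + m)² at z = (±1 + iy)/r, both in the upper
half-plane once m is negated in one of them. The Lipschitz formula applies to each, and the two
exponentials combine to a sine. -/
lemma tsum_div_sq_add_sq_sq_complex {r y : ℝ} (hr : 0 < r) (hy : 0 < y) :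
    ∑' m : ℤ, ((r : ℂ) * m + 1) / ((r * m + 1) ^ 2 + y ^ 2) ^ 2 =
      2 * π ^ 2 / (r ^ 2 * y) *
        ∑' n : ℕ, (n : ℂ) * Complex.sin (2 * π * n / r) * Complex.exp (-2 * π * y / r) ^ n := by
  have him : 0 < y / r := div_pos hy hr
  have hrc : (r : ℂ) ≠ 0 := by exact_mod_cast hr.ne'
  have hyc : (y : ℂ) ≠ 0 := by exact_mod_cast hy.ne'
  let z₁ : UpperHalfPlane := ⟨⟨1 / r, y / r⟩, him⟩
  let z₂ : UpperHalfPlane := ⟨⟨-1 / r, y / r⟩, him⟩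
  have h1 : (z₁ : ℂ) = (1 + Complex.I * y) / r := by
    change (⟨1 / r, y / r⟩ : ℂ) = _
    apply Complex.ext <;> simp
  have h2 : (z₂ : ℂ) = (-1 + Complex.I * y) / r := by
    change (⟨-1 / r, y / r⟩ : ℂ) = _
    apply Complex.ext <;> simp
  have t1 := EisensteinSeries.qExpansion_identity le_rfl z₁
  have t2 := EisensteinSeries.qExpansion_identity le_rfl z₂
  have s1 : Summable fun m : ℤ => 1 / ((z₁ : ℂ) + m) ^ (1 + 1) := by
    refine (EisensteinSeries.linear_right_summable z₁ 1 (k := 2) le_rfl).congr fun m => ?_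
    norm_cast
    simp
  have s2 : Summable fun m : ℤ => 1 / ((z₂ : ℂ) + m) ^ (1 + 1) := by
    refine (EisensteinSeries.linear_right_summable z₂ 1 (k := 2) le_rfl).congr fun m => ?_
    norm_cast
    simp
  have u1 : Summable fun n : ℕ => (n : ℂ) ^ 1 * Complex.exp (2 * π * Complex.I * z₁) ^ n := by
    simpa using summable_pow_mul_cexp 1 1 z₁
  have u2 : Summable fun n : ℕ => (n : ℂ) ^ 1 * Complex.exp (2 * π * Complex.I * z₂) ^ n := by
    simpa using summable_pow_mul_cexp 1 1 z₂
  have s2' : Summable fun m : ℤ => 1 / ((z₂ : ℂ) + (-m : ℤ)) ^ (1 + 1) :=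
    (Equiv.neg ℤ).summable_iff.mpr s2
  have t2' : ∑' m : ℤ, 1 / ((z₂ : ℂ) + (-m : ℤ)) ^ (1 + 1) = _ :=
    ((Equiv.neg ℤ).tsum_eq (fun m : ℤ => 1 / ((z₂ : ℂ) + m) ^ (1 + 1))).trans t2
  have key := s2'.tsum_sub s1
  rw [t1, t2', ← mul_sub, ← u2.tsum_sub u1] at key
  have lhs (m : ℤ) : ((r : ℂ) * m + 1) / ((r * m + 1) ^ 2 + y ^ 2) ^ 2 =
      1 / (4 * Complex.I * y * r ^ 2) *
      (1 / ((z₂ : ℂ) + (-m : ℤ)) ^ (1 + 1) - 1 / ((z₁ : ℂ) + m) ^ (1 + 1)) := by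
    have a1 : (z₁ : ℂ) + m = ((r * m + 1) + Complex.I * y) / r := by
      rw [h1]
      field_simp
      ring
    have a2 : (z₂ : ℂ) + (-m : ℤ) = -((r * m + 1) - Complex.I * y) / r := by
      rw [h2]
      push_cast
      field_simp
      ring
    have b1 : ((r * m + 1) + Complex.I * y : ℂ) ≠ 0 := by
      intro h
      have := congrArg Complex.im h
      simp at this
      exact hy.ne' this
    have b2 : ((r * m + 1) - Complex.I * y : ℂ) ≠ 0 := by
      intro h
      have := congrArg Complex.im h
      simp at this
      exact hy.ne' this
    have b3 : ((r * m + 1) ^ 2 + y ^ 2 : ℂ) =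
        ((r * m + 1) + Complex.I * y) * ((r * m + 1) - Complex.I * y) := by
      linear_combination (y : ℂ) ^ 2 * Complex.I_sq
    rw [a1, a2, b3]
    exact div_mul_sq_eq_sub hrc hyc b1 b2
  have rhs (n : ℕ) : (n : ℂ) ^ 1 * Complex.exp (2 * π * Complex.I * z₂) ^ n -
      (n : ℂ) ^ 1 * Complex.exp (2 * π * Complex.I * z₁) ^ n =
      -2 * Complex.I * ((n : ℂ) * Complex.sin (2 * π * n / r) *
        Complex.exp (-2 * π * y / r) ^ n) := by
    have a1 : Complex.exp (2 * π * Complex.I * z₁) ^ n =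
        Complex.exp (-2 * π * y / r) ^ n * Complex.exp (2 * π * n / r * Complex.I) := by
      rw [← Complex.exp_nat_mul, ← Complex.exp_nat_mul, ← Complex.exp_add, h1]
      congr 1
      field_simp
      linear_combination (n * y : ℂ) * Complex.I_sq
    have a2 : Complex.exp (2 * π * Complex.I * z₂) ^ n =
        Complex.exp (-2 * π * y / r) ^ n * Complex.exp (-(2 * π * n / r) * Complex.I) := by
      rw [← Complex.exp_nat_mul, ← Complex.exp_nat_mul, ← Complex.exp_add, h2]
      congr 1
      field_simp
      linear_combination (n * y : ℂ) * Complex.I_sq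
    rw [a1, a2, Complex.sin]
    linear_combination ((n : ℂ) * Complex.exp (-2 * π * y / r) ^ n *
      (Complex.exp (-(2 * π * n / r) * Complex.I) - Complex.exp (2 * π * n / r * Complex.I))) *
      Complex.I_sq
  simp_rw [lhs, tsum_mul_left]
  simp_rw [rhs, tsum_mul_left] at key
  rw [key]
  simp only [Nat.factorial_one, Nat.cast_one, div_one]
  generalize ∑' n : ℕ, (n : ℂ) * Complex.sin (2 * π * n / r) * Complex.exp (-2 * π * y / r) ^ n = S
  have hI := Complex.I_ne_zero
  field_simp
  ring_nf
  simp only [Complex.I_sq]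
  try ring

lemma tsum_div_sq_add_sq_sq {r y : ℝ} (hr : 0 < r) (hy : 0 < y) :
    ∑' m : ℤ, (r * m + 1) / ((r * m + 1) ^ 2 + y ^ 2) ^ 2 =
      2 * π ^ 2 / (r ^ 2 * y) *
        ∑' n : ℕ, (n : ℝ) * Real.sin (2 * π * n / r) * Real.exp (-2 * π * y / r) ^ n := by
  have h := tsum_div_sq_add_sq_sq_complex hr hy
  exact_mod_cast h

lemma sin_two_pi_mul_div_four (n : ℕ) : Real.sin (2 * π * n / 4) = chiFour n := by
  induction n using Nat.twoStepInduction with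
  | zero => simp [chiFour_zero]
  | one =>
    rw [chiFour_one, show 2 * π * (1 : ℕ) / 4 = π / 2 by push_cast; ring]
    simp
  | more n ih _ =>
    rw [chiFour_add, show 2 * π * ((n + 2 : ℕ) : ℝ) / 4 = 2 * π * n / 4 + π by push_cast; ring,
      Real.sin_add_pi, ih]
    push_cast
    ring

lemma sin_two_pi_mul_div_three (n : ℕ) : Real.sin (2 * π * n / 3) = √3 / 2 * chiThree n := by
  have hper (n : ℕ) : Real.sin (2 * π * ((n + 3 : ℕ) : ℝ) / 3) = Real.sin (2 * π * n / 3) := by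
    rw [show 2 * π * ((n + 3 : ℕ) : ℝ) / 3 = 2 * π * n / 3 + 2 * π by push_cast; ring,
      Real.sin_add_two_pi]
  have h1 : Real.sin (2 * π * (1 : ℕ) / 3) = √3 / 2 := by
    rw [show 2 * π * (1 : ℕ) / 3 = π - π / 3 by push_cast; ring, Real.sin_pi_sub,
      Real.sin_pi_div_three]
  have h2 : Real.sin (2 * π * (2 : ℕ) / 3) = -(√3 / 2) := by
    rw [show 2 * π * (2 : ℕ) / 3 = π / 3 + π by push_cast; ring, Real.sin_add_pi,
      Real.sin_pi_div_three]
  induction n using Nat.strong_induction_on with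
  | _ n ih =>
    match n with
    | 0 => simp [chiThree_zero]
    | 1 => rw [h1, chiThree_one]; simp
    | 2 => rw [h2, chiThree_two]; simp
    | n + 3 => rw [hper, ih n (by omega), chiThree_add, one_mul]

lemma tsum_four_mul_add_one {y : ℝ} (hy : 0 < y) :
    ∑' m : ℤ, (4 * (m : ℝ) + 1) / ((4 * m + 1) ^ 2 + y ^ 2) ^ 2 =
      π ^ 2 / (8 * y) * ∑' J : ℕ, (chiFour J : ℝ) * J * Real.exp (-π * y / 2) ^ J := by
  rw [tsum_div_sq_add_sq_sq four_pos hy]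
  congr 1
  · ring
  · refine tsum_congr fun n => ?_
    rw [sin_two_pi_mul_div_four, show -2 * π * y / 4 = -π * y / 2 by ring]
    ring

lemma tsum_three_mul_add_one {y : ℝ} (hy : 0 < y) :
    ∑' m : ℤ, (3 * (m : ℝ) + 1) / ((3 * m + 1) ^ 2 + y ^ 2) ^ 2 =
      √3 * π ^ 2 / (9 * y) * ∑' J : ℕ, (chiThree J : ℝ) * J * Real.exp (-2 * π * y / 3) ^ J := by
  have h (S : ℝ) : √3 * π ^ 2 / (9 * y) * S = 2 * π ^ 2 / (3 ^ 2 * y) * (√3 / 2 * S) := by ring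
  rw [tsum_div_sq_add_sq_sq three_pos hy, h]
  refine congrArg _ ?_
  rw [← tsum_mul_left]
  refine tsum_congr fun n => ?_
  rw [sin_two_pi_mul_div_three]
  ring

lemma summable_odd_div_sq (y : ℝ) : Summable fun k : ℕ =>
    (-1 : ℝ) ^ k * (2 * k + 1) / ((2 * k + 1) ^ 2 + y ^ 2) ^ 2 := by
  have h := (summable_nat_add_iff 1).mpr (Real.summable_one_div_nat_pow.mpr one_lt_two)
  refine .of_norm (.of_nonneg_of_le (fun k => norm_nonneg _) (fun k => ?_) h)
  have hk : (0 : ℝ) ≤ k := by positivity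
  rw [norm_div, norm_mul, norm_pow, norm_neg, norm_one, one_pow, one_mul,
    Real.norm_of_nonneg (by positivity), Real.norm_of_nonneg (by positivity),
    div_le_div_iff₀ (by positivity) (by positivity)]
  push_cast
  have h1 : ((2 * (k : ℝ) + 1) ^ 2) ^ 2 ≤ ((2 * (k : ℝ) + 1) ^ 2 + y ^ 2) ^ 2 := by
    gcongr
    nlinarith [sq_nonneg y]
  have h2 : (2 * (k : ℝ) + 1) * (k + 1) ^ 2 ≤ (2 * k + 1) * (2 * k + 1) ^ 3 := by
    gcongr
    calc ((k : ℝ) + 1) ^ 2 ≤ (2 * (k : ℝ) + 1) ^ 2 := by gcongr; linarith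
      _ ≤ (2 * (k : ℝ) + 1) ^ 3 := pow_le_pow_right₀ (by linarith) (by norm_num)
  nlinarith

/-- The numbers (-1)^k (2k + 1) with k ≥ 0 are exactly the integers 4m + 1: k = 2m for m ≥ 0, and
odd k for m < 0. -/
lemma tsum_odd_div_sq {y : ℝ} (hy : 0 < y) :
    ∑' k : ℕ, (-1 : ℝ) ^ k * (2 * k + 1) / ((2 * k + 1) ^ 2 + y ^ 2) ^ 2 =
      π ^ 2 / (8 * y) * ∑' J : ℕ, (chiFour J : ℝ) * J * Real.exp (-π * y / 2) ^ J := by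
  obtain ⟨f, hf⟩ : ∃ f : ℕ → ℝ, f = fun k : ℕ =>
    (-1 : ℝ) ^ k * (2 * k + 1) / ((2 * k + 1) ^ 2 + y ^ 2) ^ 2 := ⟨_, rfl⟩
  have hs : Summable f := hf ▸ summable_odd_div_sq y
  have s1 : Summable fun k => f (2 * k) := hs.comp_injective fun a b h => by simpa using h
  have s2 : Summable fun k => f (2 * k + 1) := hs.comp_injective fun a b h => by simpa using h
  rw [← tsum_four_mul_add_one hy, ← hf, ← tsum_even_add_odd s1 s2]
  have e1 (k : ℕ) : f (2 * k) =
      (4 * (((k : ℤ)) : ℝ) + 1) / ((4 * ((k : ℤ) : ℝ) + 1) ^ 2 + y ^ 2) ^ 2 := by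
    simp only [hf, pow_mul, neg_one_sq, one_pow]
    push_cast
    ring
  have e2 (k : ℕ) : f (2 * k + 1) = (4 * ((-((k : ℤ) + 1) : ℤ) : ℝ) + 1) /
      ((4 * ((-((k : ℤ) + 1) : ℤ) : ℝ) + 1) ^ 2 + y ^ 2) ^ 2 := by
    simp only [hf, pow_mul, pow_succ]
    push_cast
    ring
  simp only [e1] at s1 ⊢
  simp only [e2] at s2 ⊢
  exact (HasSum.of_nat_of_neg_add_one
    (f := fun m : ℤ => (4 * (m : ℝ) + 1) / ((4 * m + 1) ^ 2 + y ^ 2) ^ 2)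
    s1.hasSum s2.hasSum).tsum_eq.symm

lemma tsum_odd_div_cube :
    ∑' k : ℕ, (-1 : ℝ) ^ k * (2 * k + 1) / ((2 * k + 1) ^ 2 + 0 ^ 2) ^ 2 = π ^ 3 / 32 := by
  have h : HasSum (fun n : ℕ => 1 / (n : ℝ) ^ 3 * Real.sin (π * n / 2)) (π ^ 3 / 32) := by
    exact hasSum_L_function_mod_four_eval_three
  have hinj : Function.Injective fun k : ℕ => 2 * k + 1 := fun a b h => by simpa using h
  have h2 := hinj.tsum_eq (f := fun n : ℕ => 1 / (n : ℝ) ^ 3 * Real.sin (π * n / 2)) <| by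
    intro n hn
    rcases Nat.even_or_odd' n with ⟨k, rfl | rfl⟩
    · exfalso
      apply hn
      have : Real.sin (π * ((2 * k : ℕ) : ℝ) / 2) = 0 := by
        rw [show π * ((2 * k : ℕ) : ℝ) / 2 = k * π by push_cast; ring, Real.sin_nat_mul_pi]
      simp only [this, mul_zero]
    · exact ⟨k, rfl⟩
  rw [← h.tsum_eq, ← h2]
  refine tsum_congr fun k => ?_
  have : Real.sin (π * ((2 * k + 1 : ℕ) : ℝ) / 2) = (-1) ^ k := by
    rw [show π * ((2 * k + 1 : ℕ) : ℝ) / 2 = π / 2 + k * π by push_cast; ring,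
      Real.sin_add_nat_mul_pi, Real.sin_pi_div_two, mul_one]
  rw [this]
  push_cast
  have : (2 * (k : ℝ) + 1) ≠ 0 := by positivity
  field_simp
  ring

/-! ### Absolute convergence of the double series -/

lemma summable_nat_rpow : Summable fun k : ℕ => ((k : ℝ) + 1) ^ (-(3 / 2) : ℝ) := by
  have := (summable_nat_add_iff 1).mpr (Real.summable_nat_rpow.mpr (show (-(3 / 2) : ℝ) < -1 by norm_num))
  exact this.congr fun k => by push_cast; rfl

lemma summable_int_rpow : Summable fun k : ℤ => (|(k : ℝ)| + 1) ^ (-(3 / 2) : ℝ) := by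
  refine Summable.of_nat_of_neg (summable_nat_rpow.congr fun k => ?_)
    (summable_nat_rpow.congr fun k => ?_) <;> simp

/-- With X = aK² and Y = bs², (X + Y)² ≥ X^(5/4) Y^(3/4). These exponents leave K^(-3/2) s^(-3/2)
after the numerator K is cancelled, so the double series is dominated by a product of convergent
series. -/
lemma summable_of_le_quadratic {κ ι : Type*} {s : κ → ℝ} {t K : ι → ℝ} {a b : ℝ} (ha : 0 < a)
    (hb : 0 < b) (hs0 : ∀ n, 0 < s n) (ht0 : ∀ k, 0 < t k)
    (hs : Summable fun n => s n ^ (-(3 / 2) : ℝ)) (ht : Summable fun k => t k ^ (-(3 / 2) : ℝ))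
    (hK : ∀ k, t k ≤ K k) {f : κ × ι → ℝ}
    (hf : ∀ p, |f p| ≤ K p.2 / (a * K p.2 ^ 2 + b * s p.1 ^ 2) ^ 2) : Summable f := by
  have hsum := ((hs.mul_of_nonneg ht (fun n => by have := hs0 n; positivity)
    (fun k => by have := ht0 k; positivity)).mul_left (a ^ (-(5 / 4) : ℝ) * b ^ (-(3 / 4) : ℝ)))
  refine .of_norm (.of_nonneg_of_le (fun p => norm_nonneg _) (fun p => ?_) hsum)
  obtain ⟨n, k⟩ := p
  refine (hf (n, k)).trans ?_
  simp only
  have hs1 := hs0 n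
  have ht1 := ht0 k
  have hK1 : 0 < K k := ht1.trans_le (hK k)
  have h1 : (a * K k ^ 2) ^ (5 / 4 : ℝ) * (b * s n ^ 2) ^ (3 / 4 : ℝ) ≤
      (a * K k ^ 2 + b * s n ^ 2) ^ 2 := by
    have e : (a * K k ^ 2 + b * s n ^ 2) ^ 2 =
        (a * K k ^ 2 + b * s n ^ 2) ^ (5 / 4 : ℝ) * (a * K k ^ 2 + b * s n ^ 2) ^ (3 / 4 : ℝ) := by
      rw [← Real.rpow_add (by positivity)]
      norm_num
    rw [e]
    gcongr
    · linarith [show 0 < b * s n ^ 2 by positivity]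
    · linarith [show 0 < a * K k ^ 2 by positivity]
  have h2 : (a * K k ^ 2) ^ (5 / 4 : ℝ) * (b * s n ^ 2) ^ (3 / 4 : ℝ) =
      K k * (a ^ (5 / 4 : ℝ) * b ^ (3 / 4 : ℝ) * (K k ^ (3 / 2 : ℝ) * s n ^ (3 / 2 : ℝ))) := by
    have e1 : (K k ^ 2) ^ (5 / 4 : ℝ) = K k * K k ^ (3 / 2 : ℝ) := by
      rw [← Real.rpow_natCast, ← Real.rpow_mul hK1.le]
      nth_rewrite 2 [← Real.rpow_one (K k)]
      rw [← Real.rpow_add hK1]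
      norm_num
    have e2 : (s n ^ 2) ^ (3 / 4 : ℝ) = s n ^ (3 / 2 : ℝ) := by
      rw [← Real.rpow_natCast, ← Real.rpow_mul hs1.le]
      norm_num
    rw [Real.mul_rpow ha.le (by positivity), Real.mul_rpow hb.le (by positivity), e1, e2]
    ring
  calc K k / (a * K k ^ 2 + b * s n ^ 2) ^ 2
      ≤ K k / (K k * (a ^ (5 / 4 : ℝ) * b ^ (3 / 4 : ℝ) * (K k ^ (3 / 2 : ℝ) * s n ^ (3 / 2 : ℝ)))) := by
        rw [← h2]
        exact div_le_div_of_nonneg_left hK1.le (by positivity) h1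
    _ = a ^ (-(5 / 4) : ℝ) * b ^ (-(3 / 4) : ℝ) * (s n ^ (-(3 / 2) : ℝ) * K k ^ (-(3 / 2) : ℝ)) := by
        rw [Real.rpow_neg ha.le, Real.rpow_neg hb.le, Real.rpow_neg hs1.le, Real.rpow_neg hK1.le]
        field_simp
    _ ≤ _ := by
        have : K k ^ (-(3 / 2) : ℝ) ≤ t k ^ (-(3 / 2) : ℝ) :=
          Real.rpow_le_rpow_of_nonpos ht1 (hK k) (by norm_num)
        gcongr

/-! ### The dual double sums -/

/-- The terms `α(J) ε(m) (J/m) q^{Jm}` of the termwise integral of a double Lambert series. -/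
noncomputable def dualTerm (α ε : ℕ → ℤ) (q : ℝ) (p : ℕ × ℕ) : ℝ :=
  α p.1 * ε p.2 * (p.1 / p.2) * q ^ (p.1 * p.2)

lemma summable_dualTerm {α ε : ℕ → ℤ} (hα : ∀ m, |α m| ≤ 1) (hε : ∀ m, |ε m| ≤ 1)
    (h0 : ε 0 = 0) {q : ℝ} (hq0 : 0 ≤ q) (hq : q < 1) : Summable (dualTerm α ε q) := by
  have h := summable_lambertTerm hα hε h0 (u := (q : ℂ))
    (by rwa [Complex.norm_real, Real.norm_of_nonneg hq0])
  refine .of_norm (.of_nonneg_of_le (fun p => norm_nonneg _) (fun p => ?_) h)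
  obtain ⟨J, m⟩ := p
  have e : ‖dualTerm α ε q (J, m)‖ = |(α J : ℝ)| * |(ε m : ℝ)| * ((J : ℝ) / m) * q ^ (J * m) := by
    rw [dualTerm, norm_mul, norm_mul, norm_mul, Real.norm_of_nonneg (pow_nonneg hq0 _),
      Real.norm_of_nonneg (div_nonneg J.cast_nonneg m.cast_nonneg)]
    rfl
  have e' : ‖lambertTerm α ε q (J, m)‖ = |(α J : ℝ)| * |(ε m : ℝ)| * (J : ℝ) ^ 2 * q ^ (J * m) := by
    simp [lambertTerm, Complex.norm_intCast, abs_of_nonneg hq0]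
  rw [e, e']
  gcongr
  have h1 : (J : ℝ) ≤ (J : ℝ) ^ 2 := by exact_mod_cast Nat.le_self_pow two_ne_zero J
  rcases m.eq_zero_or_pos with rfl | hm
  · simp
  · exact (div_le_self J.cast_nonneg (by exact_mod_cast hm)).trans h1

lemma tsum_dualTerm {α ε : ℕ → ℤ} (hα : ∀ m, |α m| ≤ 1) (hε : ∀ m, |ε m| ≤ 1)
    (h0 : ε 0 = 0) {q : ℝ} (hq0 : 0 ≤ q) (hq : q < 1) :
    ∑' p, dualTerm α ε q p =
      ∑' m : ℕ, (ε m : ℝ) * ((∑' J : ℕ, (α J : ℝ) * J * q ^ (J * m)) / m) := by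
  have h := summable_dualTerm hα hε h0 hq0 hq
  rw [← (Equiv.prodComm ℕ ℕ).tsum_eq, Summable.tsum_prod]
  · refine tsum_congr fun m => ?_
    rw [← tsum_div_const, ← tsum_mul_left]
    refine tsum_congr fun J => ?_
    simp only [dualTerm, Equiv.prodComm_apply, Prod.swap_prod_mk]
    ring
  · exact (Equiv.prodComm ℕ ℕ).summable_iff.mpr h

/-! ### Reindexing by characters -/

/-- The product of the characters modulo `3` and `4`. -/
def chiTwelve (m : ℕ) : ℤ := chiThree m * chiFour m

lemma abs_chiTwelve_le (m : ℕ) : |chiTwelve m| ≤ 1 := by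
  rw [chiTwelve, abs_mul]
  exact mul_le_one₀ (abs_chiThree_le m) (abs_nonneg _) (abs_chiFour_le m)

lemma chiTwelve_zero : chiTwelve 0 = 0 := by decide

lemma chiTwelve_add (m : ℕ) : chiTwelve (m + 6) = -1 * chiTwelve m := by
  have h3 : chiThree (m + 6) = chiThree m := by
    rw [show m + 6 = m + 3 + 3 from rfl, chiThree_add, chiThree_add, one_mul, one_mul]
  have h4 : chiFour (m + 6) = -1 * chiFour m := by
    rw [show m + 6 = m + 2 + 2 + 2 from rfl, chiFour_add, chiFour_add, chiFour_add]
    ring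
  rw [chiTwelve, chiTwelve, h3, h4]
  ring

lemma chiTwelve_six_mul_add (k r : ℕ) : chiTwelve (6 * k + r) = (-1) ^ k * chiTwelve r := by
  induction k with
  | zero => simp
  | succ k ih =>
    rw [show 6 * (k + 1) + r = 6 * k + r + 6 by ring, chiTwelve_add, ih]
    ring

lemma neg_one_zpow_eq_pow_natAbs (n : ℤ) : (-1 : ℝ) ^ n = (-1) ^ n.natAbs := by
  rcases n with n | n
  · simp
  · rw [zpow_negSucc, ← inv_pow, inv_neg_one, Int.natAbs_negSucc]

lemma chiTwelve_natAbs (n : ℤ) : (chiTwelve (6 * n + 1).natAbs : ℝ) = (-1) ^ n := by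
  rw [neg_one_zpow_eq_pow_natAbs]
  rcases n with n | n
  · rw [show (6 * (Int.ofNat n) + 1).natAbs = 6 * n + 1 by simp; omega, chiTwelve_six_mul_add,
      show chiTwelve 1 = 1 by decide]
    simp
  · rw [show (6 * (Int.negSucc n) + 1).natAbs = 6 * n + 5 by omega, chiTwelve_six_mul_add,
      show chiTwelve 5 = -1 by decide]
    simp [pow_succ]

lemma injective_natAbs_six_mul_add_one : Function.Injective fun n : ℤ => (6 * n + 1).natAbs := by
  intro a b h
  simp only at h
  omega

lemma chiTwelve_eq_zero {m : ℕ} (h : m ∉ Set.range fun n : ℤ => (6 * n + 1).natAbs) :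
    chiTwelve m = 0 := by
  obtain ⟨k, r, hr, rfl⟩ : ∃ k r, r < 6 ∧ m = 6 * k + r := ⟨m / 6, m % 6, by omega, by omega⟩
  rw [chiTwelve_six_mul_add]
  interval_cases r
  · simp [chiTwelve_zero]
  · exact (h ⟨k, by simp only; omega⟩).elim
  · simp [show chiTwelve 2 = 0 by decide]
  · simp [show chiTwelve 3 = 0 by decide]
  · simp [show chiTwelve 4 = 0 by decide]
  · exact (h ⟨-k - 1, by simp only; omega⟩).elim

/-- The map n ↦ |6n + 1| is a bijection from ℤ onto the naturals prime to 6, the support of the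
character modulo 12, and that character takes the value (-1)ⁿ there. -/
lemma tsum_neg_one_zpow_mul_natAbs (G : ℕ → ℝ) :
    ∑' n : ℤ, (-1 : ℝ) ^ n * G (6 * n + 1).natAbs = ∑' m : ℕ, chiTwelve m * G m := by
  have h := injective_natAbs_six_mul_add_one.tsum_eq (f := fun m : ℕ => (chiTwelve m : ℝ) * G m) <| by
    intro m hm
    by_contra h
    exact hm (by simp [chiTwelve_eq_zero h])
  rw [← h]
  exact tsum_congr fun n => by rw [chiTwelve_natAbs]

lemma chiEight_two_mul_add_one (n : ℕ) : (chiEight (2 * n + 1) : ℝ) = (-1) ^ (n * (n + 1) / 2) := by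
  induction n using Nat.twoStepInduction with
  | zero => simp [chiEight_one]
  | one => simp [chiEight_three]
  | more n ih _ =>
    rw [show 2 * (n + 2) + 1 = 2 * n + 1 + 4 by ring, chiEight_add,
      show (n + 2) * (n + 2 + 1) / 2 = n * (n + 1) / 2 + (2 * n + 3) by
        rw [show (n + 2) * (n + 2 + 1) = n * (n + 1) + (2 * n + 3) * 2 by ring,
          Nat.add_mul_div_right _ _ two_pos], pow_add, ← ih,
      Odd.neg_one_pow (n := 2 * n + 3) ⟨n + 1, by ring⟩]
    push_cast
    ring

lemma chiEight_two_mul (n : ℕ) : chiEight (2 * n) = 0 := by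
  induction n using Nat.twoStepInduction with
  | zero => simp [chiEight_zero]
  | one => simp [chiEight_two]
  | more n ih _ => rw [show 2 * (n + 2) = 2 * n + 4 by ring, chiEight_add, ih, mul_zero]

lemma tsum_neg_one_pow_triangular_mul_odd (G : ℕ → ℝ) :
    ∑' n : ℕ, (-1 : ℝ) ^ (n * (n + 1) / 2) * G (2 * n + 1) = ∑' m : ℕ, chiEight m * G m := by
  have hinj : Function.Injective fun k : ℕ => 2 * k + 1 := fun a b h => by simpa using h
  have h := hinj.tsum_eq (f := fun m : ℕ => (chiEight m : ℝ) * G m) <| by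
    intro m hm
    rcases Nat.even_or_odd' m with ⟨k, rfl | rfl⟩
    · exact (hm (by simp [chiEight_two_mul])).elim
    · exact ⟨k, rfl⟩
  rw [← h]
  exact tsum_congr fun n => by rw [chiEight_two_mul_add_one]

lemma tsum_neg_one_zpow_mul_even {g : ℤ → ℝ} (hg : Summable g) (heven : ∀ n, g (-n) = g n) {G : ℕ → ℝ}
    (hG : ∀ n : ℕ, n ≠ 0 → g n = (-1) ^ n * G n) :
    ∑' n : ℤ, g n = g 0 + 2 * ∑' m : ℕ, altSign m * G m := by
  have h := hg.hasSum.nat_add_neg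
  -- Pairing n with -n counts the term at 0 twice, whence the correction at n = 0.
  have h0 : ∀ n : ℕ, g n + g (-n) = 2 * (altSign n * G n) + if n = 0 then 2 * g 0 else 0 := by
    intro n
    rw [heven]
    rcases eq_or_ne n 0 with rfl | hn
    · simp [altSign]
      ring
    · rw [hG n hn]
      simp [altSign, hn]
      ring
  have hs := h.summable
  have hs2 : Summable fun n : ℕ => if n = 0 then 2 * g 0 else 0 := (hasSum_ite_eq 0 _).summable
  have hs3 : Summable fun n : ℕ => 2 * (altSign n * G n) := by
    refine (hs.sub hs2).congr fun n => ?_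
    rw [h0]
    ring
  have h1 := h.tsum_eq
  simp_rw [h0] at h1
  rw [hs3.tsum_add hs2, tsum_ite_eq, tsum_mul_left] at h1
  linarith

/-! ### Evaluation of the double series -/

lemma summable_term22 {x : ℝ} (hx : 0 < x) : Summable (term22 x) := by
  refine summable_of_le_quadratic (s := fun n : ℕ => (n : ℝ) + 1) (t := fun k : ℕ => (k : ℝ) + 1)
    (K := fun k : ℕ => 2 * (k : ℝ) + 1) (a := 2) (b := x ^ 2) two_pos (by positivity)
    (fun n => by positivity) (fun n => by positivity) summable_nat_rpow summable_nat_rpow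
    (fun k => by have : (0 : ℝ) ≤ k := k.cast_nonneg; linarith) fun p => ?_
  obtain ⟨n, k⟩ := p
  rw [term22, abs_div, abs_mul, abs_pow, abs_neg, abs_one, one_pow, one_mul,
    abs_of_nonneg (by positivity), abs_of_nonneg (by positivity)]
  simp only
  gcongr
  have : (0 : ℝ) ≤ n := n.cast_nonneg
  linarith

lemma abs_add_one_le_abs_six_mul_add_one (n : ℤ) : |(n : ℝ)| + 1 ≤ |6 * (n : ℝ) + 1| := by
  have : |n| + 1 ≤ |6 * n + 1| := by
    rcases abs_cases n with h | h <;> rcases abs_cases (6 * n + 1) with h' | h' <;> omega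
  exact_mod_cast this

lemma abs_add_one_le_abs_three_mul_add_one (n : ℤ) : |(n : ℝ)| + 1 ≤ |3 * (n : ℝ) + 1| := by
  have : |n| + 1 ≤ |3 * n + 1| := by
    rcases abs_cases n with h | h <;> rcases abs_cases (3 * n + 1) with h' | h' <;> omega
  exact_mod_cast this

lemma summable_term14 {x : ℝ} (hx : 0 < x) : Summable (term14 x) := by
  refine summable_of_le_quadratic (s := fun n : ℤ => |(n : ℝ)| + 1) (t := fun k : ℤ => |(k : ℝ)| + 1)
    (K := fun k : ℤ => |3 * (k : ℝ) + 1|) (a := 4) (b := x ^ 2) four_pos (by positivity)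
    (fun n => by positivity) (fun n => by positivity) summable_int_rpow summable_int_rpow
    abs_add_one_le_abs_three_mul_add_one fun p => ?_
  obtain ⟨n, k⟩ := p
  have hk := (abs_nonneg (k : ℝ)).trans_lt ((lt_add_one _).trans_le (abs_add_one_le_abs_three_mul_add_one k))
  rw [term14, abs_div, abs_mul, abs_zpow, abs_neg, abs_one, one_zpow, one_mul,
    abs_of_nonneg (a := (4 * (3 * (k : ℝ) + 1) ^ 2 + _) ^ 2) (by positivity)]
  simp only
  rw [← sq_abs (3 * (k : ℝ) + 1), ← sq_abs (6 * (n : ℝ) + 1)]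
  gcongr
  exact abs_add_one_le_abs_six_mul_add_one n

lemma summable_term12 {x : ℝ} (hx : 0 < x) : Summable (term12 x) := by
  -- The row n = 0 has no x² contribution, so half of (2k + 1)² ≥ 1 is spent on it: b(|n| + 1)² ≤
  -- 2bn² + 2b ≤ 4x²n² + 1/2.
  refine summable_of_le_quadratic (s := fun n : ℤ => |(n : ℝ)| + 1) (t := fun k : ℕ => (k : ℝ) + 1)
    (K := fun k : ℕ => 2 * (k : ℝ) + 1) (a := 1 / 2) (b := min (1 / 4) (2 * x ^ 2)) (by norm_num)
    (by positivity)
    (fun n => by positivity) (fun n => by positivity) summable_int_rpow summable_nat_rpow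
    (fun k => by have : (0 : ℝ) ≤ k := k.cast_nonneg; linarith) fun p => ?_
  obtain ⟨n, k⟩ := p
  rw [term12, abs_div, abs_mul, abs_zpow, abs_neg, abs_one, one_zpow, one_mul,
    abs_of_nonneg (by positivity), abs_of_nonneg (by positivity)]
  simp only
  have hb1 := min_le_left (1 / 4) (2 * x ^ 2)
  have hb2 := min_le_right (1 / 4) (2 * x ^ 2)
  have hb : 0 < min (1 / 4) (2 * x ^ 2) := by positivity
  set b := min (1 / 4) (2 * x ^ 2)
  refine div_le_div_of_nonneg_left (by positivity) (by positivity)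
    (pow_le_pow_left₀ (by positivity) ?_ 2)
  have hk : (0 : ℝ) ≤ k := k.cast_nonneg
  have h1 : (|(n : ℝ)| + 1) ^ 2 ≤ 2 * (n : ℝ) ^ 2 + 2 := by
    rw [← sq_abs (n : ℝ)]
    nlinarith [sq_nonneg (|(n : ℝ)| - 1)]
  have h2 : b * (|(n : ℝ)| + 1) ^ 2 ≤ b * (2 * (n : ℝ) ^ 2 + 2) := by gcongr
  have h3 : b * (n : ℝ) ^ 2 ≤ 2 * x ^ 2 * (n : ℝ) ^ 2 := by gcongr
  nlinarith [sq_nonneg (k : ℝ)]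

/-- The inner sum is `tsum_odd_div_sq` at y = x(2n + 1)/√2, and the given q is the one with
e^(-πy/2) = q^(2n+1). The signs over n form χ₈. -/
lemma F22_eq_tsum_dualTerm {x q : ℝ} (hx : 0 < x) (hq : q = Real.exp (-π * x / √8)) :
    F22 x = 9 * π ^ 2 / (32 * √2 * x) * (2 * ∑' p, dualTerm chiFour chiEight q p) := by
  have hs2 : √2 ^ 2 = 2 := Real.sq_sqrt zero_le_two
  have hs2' : (0 : ℝ) < √2 := by positivity
  have hs8 : √8 = 2 * √2 := by
    rw [show (8 : ℝ) = 2 ^ 2 * 2 by norm_num, Real.sqrt_mul (by norm_num),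
      Real.sqrt_sq zero_le_two]
  have hq0 : 0 ≤ q := hq ▸ (Real.exp_pos _).le
  have hq1 : q < 1 := by
    rw [hq, Real.exp_lt_one_iff, neg_mul, neg_div]
    exact neg_neg_of_pos (by positivity)
  rw [F22, (summable_term22 hx).tsum_prod,
    tsum_dualTerm abs_chiFour_le abs_chiEight_le chiEight_zero hq0 hq1,
    ← tsum_neg_one_pow_triangular_mul_odd fun m : ℕ => (∑' J : ℕ, (chiFour J : ℝ) * J * q ^ (J * m)) / m,
    ← tsum_mul_left, ← tsum_mul_left, ← tsum_mul_left]
  refine tsum_congr fun n => ?_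
  have hy : 0 < x * (2 * n + 1) / √2 := by positivity
  have h := tsum_odd_div_sq hy
  have h1 (k : ℕ) : term22 x (n, k) = (-1) ^ (n * (n + 1) / 2) / 4 *
      ((-1 : ℝ) ^ k * (2 * k + 1) / ((2 * k + 1) ^ 2 + (x * (2 * n + 1) / √2) ^ 2) ^ 2) := by
    have e : 2 * (2 * (k : ℝ) + 1) ^ 2 + x ^ 2 * (2 * n + 1) ^ 2 =
        2 * ((2 * k + 1) ^ 2 + (x * (2 * n + 1) / √2) ^ 2) := by
      rw [div_pow, hs2]
      ring
    simp only [term22]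
    rw [e, pow_add, mul_pow]
    have : (2 * (k : ℝ) + 1) ^ 2 + (x * (2 * n + 1) / √2) ^ 2 ≠ 0 := by positivity
    field_simp
    norm_num
  have h2 (J : ℕ) : Real.exp (-π * (x * (2 * n + 1) / √2) / 2) ^ J = q ^ (J * (2 * n + 1)) := by
    rw [hq, ← Real.exp_nat_mul, ← Real.exp_nat_mul, hs8]
    congr 1
    push_cast
    field_simp
  simp_rw [h1, tsum_mul_left, h, h2]
  push_cast
  generalize ∑' J : ℕ, (chiFour J : ℝ) * J * q ^ (J * (2 * n + 1)) = S
  field_simp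
  rw [hs2]
  ring

/-- Here y = 2x|n|, so e^(-πy/2) = q^|n|; the row n = 0 is the series for π³/32. -/
lemma F12_eq_tsum_dualTerm {x q : ℝ} (hx : 0 < x) (hq : q = Real.exp (-π * x)) :
    F12 x = π ^ 3 / 32 + π ^ 2 / (8 * x) * ∑' p, dualTerm chiFour altSign q p := by
  have hq0 : 0 ≤ q := hq ▸ (Real.exp_pos _).le
  have hq1 : q < 1 := by
    rw [hq, Real.exp_lt_one_iff, neg_mul]
    exact neg_neg_of_pos (by positivity)
  have h1 (n : ℤ) (k : ℕ) : term12 x (n, k) = (-1) ^ n *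
      ((-1 : ℝ) ^ k * (2 * k + 1) / ((2 * k + 1) ^ 2 + (2 * x * |(n : ℝ)|) ^ 2) ^ 2) := by
    simp only [term12]
    rw [zpow_add₀ (by norm_num), zpow_natCast, mul_pow _ |(n : ℝ)|, sq_abs]
    ring
  have hsum := (summable_term12 hx).prod
  rw [F12, (summable_term12 hx).tsum_prod, tsum_neg_one_zpow_mul_even hsum (G := fun m : ℕ =>
    π ^ 2 / (16 * x) * ((∑' J : ℕ, (chiFour J : ℝ) * J * q ^ (J * m)) / m)),
    tsum_dualTerm abs_chiFour_le abs_altSign_le altSign_zero hq0 hq1]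
  · congr 1
    · rw [← tsum_odd_div_cube]
      refine tsum_congr fun k => ?_
      rw [h1]
      simp
    · rw [← tsum_mul_left, ← tsum_mul_left]
      refine tsum_congr fun m => ?_
      ring
  · intro n
    refine tsum_congr fun k => ?_
    rw [h1, h1, zpow_neg, ← inv_zpow]
    simp [inv_neg]
  · intro n hn
    have hn' : (0 : ℝ) < n := by positivity
    simp_rw [h1, tsum_mul_left]
    have hy : 0 < 2 * x * |((n : ℤ) : ℝ)| := by simpa using by positivity
    rw [tsum_odd_div_sq hy, zpow_natCast]
    have h2 (J : ℕ) : Real.exp (-π * (2 * x * |((n : ℤ) : ℝ)|) / 2) ^ J = q ^ (J * n) := by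
      rw [hq, ← Real.exp_nat_mul, ← Real.exp_nat_mul, Int.cast_natCast, Nat.abs_cast]
      congr 1
      push_cast
      ring
    simp_rw [h2]
    generalize ∑' J : ℕ, (chiFour J : ℝ) * J * q ^ (J * n) = S
    rw [Int.cast_natCast, Nat.abs_cast]
    field_simp
    ring

/-- Here y = xm/2 with m = |6n + 1|, so e^(-2πy/3) = q^m; the progression modulo 3 supplies χ₃ and
the factor √3/2. -/
lemma F14_eq_tsum_dualTerm {x q : ℝ} (hx : 0 < x) (hq : q = Real.exp (-π * x / 3)) :
    F14 x = 25 * π ^ 2 / (36 * x) * (√3 / 2 * ∑' p, dualTerm chiThree chiTwelve q p) := by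
  have hq0 : 0 ≤ q := hq ▸ (Real.exp_pos _).le
  have hq1 : q < 1 := by
    rw [hq, Real.exp_lt_one_iff, neg_mul, neg_div]
    exact neg_neg_of_pos (by positivity)
  rw [F14, (summable_term14 hx).tsum_prod,
    tsum_dualTerm abs_chiThree_le abs_chiTwelve_le chiTwelve_zero hq0 hq1,
    ← tsum_neg_one_zpow_mul_natAbs fun m : ℕ => (∑' J : ℕ, (chiThree J : ℝ) * J * q ^ (J * m)) / m,
    ← tsum_mul_left, ← tsum_mul_left, ← tsum_mul_left]
  refine tsum_congr fun n => ?_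
  have hm : ((6 * n + 1).natAbs : ℝ) = |6 * (n : ℝ) + 1| := by
    rw [Nat.cast_natAbs]
    push_cast
    rfl
  have hm0 : 0 < ((6 * n + 1).natAbs : ℝ) := by
    rw [hm]
    exact (abs_nonneg (n : ℝ)).trans_lt ((lt_add_one _).trans_le (abs_add_one_le_abs_six_mul_add_one n))
  have hsq : (6 * (n : ℝ) + 1) ^ 2 = ((6 * n + 1).natAbs : ℝ) ^ 2 := by rw [hm, sq_abs]
  generalize (6 * n + 1).natAbs = m at *
  have hy : 0 < x * m / 2 := by positivity
  have h := tsum_three_mul_add_one hy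
  have h1 (k : ℤ) : term14 x (n, k) = (-1) ^ n / 16 *
      ((3 * k + 1) / ((3 * k + 1) ^ 2 + (x * m / 2) ^ 2) ^ 2) := by
    have e : 4 * (3 * (k : ℝ) + 1) ^ 2 + x ^ 2 * (6 * n + 1) ^ 2 =
        4 * ((3 * k + 1) ^ 2 + (x * m / 2) ^ 2) := by
      rw [hsq]
      ring
    simp only [term14]
    rw [e, mul_pow]
    have : (3 * (k : ℝ) + 1) ^ 2 + (x * m / 2) ^ 2 ≠ 0 := by positivity
    field_simp
    norm_num
  have h2 (J : ℕ) : Real.exp (-2 * π * (x * m / 2) / 3) ^ J = q ^ (J * m) := by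
    rw [hq, ← Real.exp_nat_mul, ← Real.exp_nat_mul]
    congr 1
    push_cast
    ring
  simp_rw [h1, tsum_mul_left, h, h2]
  generalize ∑' J : ℕ, (chiThree J : ℝ) * J * q ^ (J * m) = S
  field_simp
  ring

/-! ### The absolutely convergent form of the four-dimensional sum -/

/-- The terms of the double series for the four-dimensional lattice sum. -/
noncomputable def latticeTerm (x : ℝ) (p : ℤ × ℕ) : ℝ :=
  (-1 : ℝ) ^ p.1 * ((-1) ^ p.2 * (2 * p.2 + 1)) /
    (3 * (2 * p.2 + 1) ^ 2 + x ^ 2 * (6 * p.1 + 1) ^ 2) ^ 2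

lemma summable_latticeTerm {x : ℝ} (hx : 0 < x) : Summable (latticeTerm x) := by
  refine summable_of_le_quadratic (s := fun n : ℤ => |(n : ℝ)| + 1) (t := fun k : ℕ => (k : ℝ) + 1)
    (K := fun k : ℕ => 2 * (k : ℝ) + 1) (a := 3) (b := x ^ 2) three_pos (by positivity)
    (fun n => by positivity) (fun n => by positivity) summable_int_rpow summable_nat_rpow
    (fun k => by have : (0 : ℝ) ≤ k := k.cast_nonneg; linarith) fun p => ?_
  obtain ⟨n, k⟩ := p
  rw [latticeTerm, abs_div, abs_mul, abs_mul, abs_pow, abs_zpow, abs_neg, abs_one, one_zpow,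
    one_mul, one_pow, one_mul, abs_of_nonneg (by positivity), abs_of_nonneg (by positivity)]
  simp only
  rw [← sq_abs (6 * (n : ℝ) + 1)]
  gcongr
  exact abs_add_one_le_abs_six_mul_add_one n

lemma tsum_latticeTerm {x q : ℝ} (hx : 0 < x) (hq : q = Real.exp (-π * x / √12)) :
    ∑' p, latticeTerm x p = π ^ 2 / (24 * √3 * x) * ∑' p, dualTerm chiFour chiTwelve q p := by
  have hs3 : √3 ^ 2 = 3 := Real.sq_sqrt zero_le_three
  have hs3' : (0 : ℝ) < √3 := by positivity
  have hs12 : √12 = 2 * √3 := by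
    rw [show (12 : ℝ) = 2 ^ 2 * 3 by norm_num, Real.sqrt_mul (by norm_num),
      Real.sqrt_sq zero_le_two]
  have hq0 : 0 ≤ q := hq ▸ (Real.exp_pos _).le
  have hq1 : q < 1 := by
    rw [hq, Real.exp_lt_one_iff, neg_mul, neg_div]
    exact neg_neg_of_pos (by positivity)
  rw [(summable_latticeTerm hx).tsum_prod,
    tsum_dualTerm abs_chiFour_le abs_chiTwelve_le chiTwelve_zero hq0 hq1,
    ← tsum_neg_one_zpow_mul_natAbs fun m : ℕ => (∑' J : ℕ, (chiFour J : ℝ) * J * q ^ (J * m)) / m,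
    ← tsum_mul_left]
  refine tsum_congr fun n => ?_
  have hm : ((6 * n + 1).natAbs : ℝ) = |6 * (n : ℝ) + 1| := by
    rw [Nat.cast_natAbs]
    push_cast
    rfl
  have hm0 : 0 < ((6 * n + 1).natAbs : ℝ) := by
    rw [hm]
    exact (abs_nonneg (n : ℝ)).trans_lt ((lt_add_one _).trans_le (abs_add_one_le_abs_six_mul_add_one n))
  have hsq : (6 * (n : ℝ) + 1) ^ 2 = ((6 * n + 1).natAbs : ℝ) ^ 2 := by rw [hm, sq_abs]
  generalize (6 * n + 1).natAbs = m at *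
  have hy : 0 < x * m / √3 := by positivity
  have h := tsum_odd_div_sq hy
  have h1 (k : ℕ) : latticeTerm x (n, k) = (-1) ^ n / 9 *
      ((-1 : ℝ) ^ k * (2 * k + 1) / ((2 * k + 1) ^ 2 + (x * m / √3) ^ 2) ^ 2) := by
    have e : 3 * (2 * (k : ℝ) + 1) ^ 2 + x ^ 2 * (6 * n + 1) ^ 2 =
        3 * ((2 * k + 1) ^ 2 + (x * m / √3) ^ 2) := by
      rw [hsq, div_pow, hs3]
      ring
    simp only [latticeTerm]
    rw [e, mul_pow]
    have : (2 * (k : ℝ) + 1) ^ 2 + (x * m / √3) ^ 2 ≠ 0 := by positivity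
    field_simp
    norm_num
  have h2 (J : ℕ) : Real.exp (-π * (x * m / √3) / 2) ^ J = q ^ (J * m) := by
    rw [hq, ← Real.exp_nat_mul, ← Real.exp_nat_mul, hs12]
    congr 1
    push_cast
    field_simp
  simp_rw [h1, tsum_mul_left, h, h2]
  generalize ∑' J : ℕ, (chiFour J : ℝ) * J * q ^ (J * m) = S
  field_simp
  rw [hs3]
  ring

/-! ### Termwise integration -/

/-- Absolute summability of the coefficients gives uniform convergence on the closed interval, hence
a continuous integrand there and termwise integration. The value of F at 0 plays no role. -/
lemma hasSum_integral_power_series {ι : Type*} [Countable ι] {c : ι → ℂ} {N : ι → ℕ}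
    (hc : Summable fun i => ‖c i‖) (hN : ∀ i, N i = 0 → c i = 0) {F : ℝ → ℂ}
    (hF : ∀ t : ℝ, 0 < t → t ≤ 1 → t * F t = ∑' i, c i * (t : ℂ) ^ N i) :
    IntervalIntegrable F volume 0 1 ∧ ∫ t in (0 : ℝ)..1, F t = ∑' i, c i / N i := by
  -- The truncated exponent is harmless: where it would be -1 the coefficient vanishes.
  let f (i : ι) : C(ℝ, ℂ) := ⟨fun t => c i * (t : ℂ) ^ (N i - 1), by fun_prop⟩
  have hbound (i : ι) (t : ℝ) (ht : t ∈ Set.uIcc (0 : ℝ) 1) : ‖f i t‖ ≤ ‖c i‖ := by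
    rw [Set.uIcc_of_le zero_le_one] at ht
    simp only [f, ContinuousMap.coe_mk, norm_mul, norm_pow, Complex.norm_real]
    refine mul_le_of_le_one_right (norm_nonneg _) (pow_le_one₀ (norm_nonneg _) ?_)
    rw [Real.norm_of_nonneg ht.1]
    exact ht.2
  have heq : Set.EqOn (fun t => ∑' i, f i t) F (Set.uIoc (0 : ℝ) 1) := by
    intro t ht
    rw [Set.uIoc_of_le zero_le_one] at ht
    have ht0 : (t : ℂ) ≠ 0 := by exact_mod_cast ht.1.ne'
    refine mul_left_cancel₀ ht0 ?_
    rw [hF t ht.1 ht.2, ← tsum_mul_left]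
    refine tsum_congr fun i => ?_
    simp only [f, ContinuousMap.coe_mk]
    rcases Nat.eq_zero_or_pos (N i) with h | h
    · simp [hN i h]
    · obtain ⟨k, hk⟩ := Nat.exists_eq_succ_of_ne_zero h.ne'
      rw [hk, Nat.succ_sub_one, pow_succ]
      ring
  constructor
  · have hcont : ContinuousOn (fun t => ∑' i, f i t) (Set.uIcc (0 : ℝ) 1) :=
      continuousOn_tsum (fun i => (f i).continuous.continuousOn) hc hbound
    exact (intervalIntegrable_congr heq).mp hcont.intervalIntegrable
  · have h := intervalIntegral.hasSum_intervalIntegral_of_summable_norm (a := 0) (b := 1) (f := f) <|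
      .of_nonneg_of_le (fun i => norm_nonneg _) (fun i => by
        rw [ContinuousMap.norm_le _ (norm_nonneg _)]
        exact fun t => hbound i t t.2) hc
    rw [← intervalIntegral.integral_congr_ae (.of_forall fun t ht => heq ht), ← h.tsum_eq]
    refine tsum_congr fun i => ?_
    rcases Nat.eq_zero_or_pos (N i) with h0 | h0
    · simp [f, h0, hN i h0]
    · simp only [f, ContinuousMap.coe_mk]
      rw [intervalIntegral.integral_const_mul]
      have e : ∫ t in (0 : ℝ)..1, (t : ℂ) ^ (N i - 1) = ((∫ t in (0 : ℝ)..1, t ^ (N i - 1) : ℝ) : ℂ) := by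
        rw [← intervalIntegral.integral_ofReal]
        push_cast
        rfl
      obtain ⟨k, hk⟩ := Nat.exists_eq_succ_of_ne_zero h0.ne'
      rw [e, integral_pow, hk, Nat.succ_sub_one]
      push_cast
      simp [div_eq_mul_inv]

/-- On the segment u = bt the monomial J² b^(Jm) t^(Jm-1) integrates to (J/m) b^(Jm). -/
lemma integral_lambert {α ε : ℕ → ℤ} (hα : ∀ m, |α m| ≤ 1) (hε : ∀ m, |ε m| ≤ 1)
    (h0 : ε 0 = 0) (c : ℂ) {g : ℂ → ℂ}
    (hg : ∀ u : ℂ, u ≠ 0 → ‖u‖ < 1 → u * g u = c * ∑' p, lambertTerm α ε u p) {b : ℂ}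
    (hb0 : b ≠ 0) (hb : ‖b‖ < 1) :
    IntervalIntegrable (fun t : ℝ => b * g (b * t)) volume 0 1 ∧
      ∫ t in (0 : ℝ)..1, b * g (b * t) =
        c * ∑' p : ℕ × ℕ, α p.1 * ε p.2 * ((p.1 : ℂ) / p.2) * b ^ (p.1 * p.2) := by
  have h := hasSum_integral_power_series (c := fun p => c * lambertTerm α ε b p)
    (N := fun p : ℕ × ℕ => p.1 * p.2) (F := fun t => b * g (b * t))
    (((summable_lambertTerm hα hε h0 hb).mul_left ‖c‖).congr fun p => (norm_mul _ _).symm)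
    (fun p hp => by
      rcases mul_eq_zero.mp hp with h | h <;> simp [lambertTerm, h, h0])
    (fun t ht0 ht1 => by
      have hbt : ‖b * (t : ℂ)‖ < 1 := by
        rw [norm_mul, Complex.norm_real, Real.norm_of_nonneg ht0.le]
        exact (mul_le_of_le_one_right (norm_nonneg b) ht1).trans_lt hb
      have e := hg (b * t) (mul_ne_zero hb0 (by exact_mod_cast ht0.ne')) hbt
      rw [← mul_assoc, mul_comm (t : ℂ) b, e, ← tsum_mul_left]
      refine tsum_congr fun p => ?_
      rw [lambertTerm, lambertTerm, mul_pow]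
      ring)
  refine ⟨h.1, h.2.trans ?_⟩
  rw [← tsum_mul_left]
  refine tsum_congr fun p => ?_
  obtain ⟨J, m⟩ := p
  simp only [lambertTerm]
  rcases J.eq_zero_or_pos with rfl | hJ
  · simp
  rcases m.eq_zero_or_pos with rfl | hm
  · simp
  have : (J : ℂ) ≠ 0 := by exact_mod_cast hJ.ne'
  have : (m : ℂ) ≠ 0 := by exact_mod_cast hm.ne'
  push_cast
  field_simp

lemma segmentIntegral_lambert {α ε : ℕ → ℤ} (hα : ∀ m, |α m| ≤ 1) (hε : ∀ m, |ε m| ≤ 1)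
    (h0 : ε 0 = 0) {g : ℂ → ℂ}
    (hg : ∀ u : ℂ, u ≠ 0 → ‖u‖ < 1 → u * g u = ∑' p, lambertTerm α ε u p) {b : ℂ}
    (hb0 : b ≠ 0) (hb : ‖b‖ < 1) :
    SegmentIntegrable g 0 b ∧ segmentIntegral g 0 b =
      ∑' p : ℕ × ℕ, α p.1 * ε p.2 * ((p.1 : ℂ) / p.2) * b ^ (p.1 * p.2) := by
  have h := integral_lambert hα hε h0 1 (by simpa only [one_mul] using hg) hb0 hb
  have e (t : ℝ) : complexForm g (AffineMap.lineMap 0 b t) (b - 0) = b * g (b * t) := by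
    simp [complexForm, AffineMap.lineMap_apply, mul_comm]
  rw [SegmentIntegrable, curveIntegrable_segment, segmentIntegral, curveIntegral_segment]
  simp_rw [e]
  exact ⟨h.1, by rw [h.2, one_mul]⟩

lemma im_tsum_dual {α ε : ℕ → ℤ} (hα : ∀ m, |α m| ≤ 1) (hε : ∀ m, |ε m| ≤ 1)
    (h0 : ε 0 = 0) {b : ℂ} (hb : ‖b‖ < 1) :
    (∑' p : ℕ × ℕ, α p.1 * ε p.2 * ((p.1 : ℂ) / p.2) * b ^ (p.1 * p.2)).im =
      ∑' p : ℕ × ℕ, α p.1 * ε p.2 * ((p.1 : ℝ) / p.2) * (b ^ (p.1 * p.2)).im := by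
  have hs : Summable fun p : ℕ × ℕ => (α p.1 * ε p.2 * ((p.1 : ℂ) / p.2) * b ^ (p.1 * p.2) : ℂ) := by
    have h := (summable_dualTerm hα hε h0 (norm_nonneg b) hb).abs
    refine .of_norm (h.congr fun p => ?_)
    have : |((p.1 : ℝ) / p.2)| = p.1 / p.2 := abs_of_nonneg (by positivity)
    simp [dualTerm, abs_mul, Complex.norm_intCast, this]
  rw [Complex.im_tsum hs]
  refine tsum_congr fun p => ?_
  have e : (α p.1 * ε p.2 * ((p.1 : ℂ) / p.2) : ℂ) = ((α p.1 * ε p.2 * ((p.1 : ℝ) / p.2) : ℝ) : ℂ) := by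
    push_cast
    rfl
  rw [e, Complex.im_ofReal_mul]

lemma norm_ofReal_lt_one {q : ℝ} (hq0 : 0 < q) (hq : q < 1) : ‖(q : ℂ)‖ < 1 := by
  rwa [Complex.norm_real, Real.norm_of_nonneg hq0.le]

lemma I_pow_im (N : ℕ) : (Complex.I ^ N).im = chiFour N := by
  induction N using Nat.twoStepInduction with
  | zero => simp [chiFour_zero]
  | one => simp [chiFour_one]
  | more n ih _ =>
    rw [pow_add, Complex.I_sq, chiFour_add, mul_neg_one, Complex.neg_im, ih]
    simp

lemma exp_two_pi_div_three_pow_im (N : ℕ) :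
    (Complex.exp (2 * π * Complex.I / 3) ^ N).im = √3 / 2 * chiThree N := by
  rw [← sin_two_pi_mul_div_three, ← Complex.exp_nat_mul,
    show (N : ℂ) * (2 * π * Complex.I / 3) = ((2 * π * N / 3 : ℝ) : ℂ) * Complex.I by
      push_cast; ring, Complex.exp_ofReal_mul_I_im]

/-- The integral of the eta quotient along `[0, iq]`. -/
theorem segmentIntegral_etaQuotient {q : ℝ} (hq0 : 0 < q) (hq : q < 1) :
    SegmentIntegrable (fun u : ℂ => ramanujanF (-u ^ 3) ^ 9 / ramanujanF (-u) ^ 3)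
        0 (Complex.I * q) ∧
      (segmentIntegral (fun u : ℂ => ramanujanF (-u ^ 3) ^ 9 / ramanujanF (-u) ^ 3)
        0 (Complex.I * q)).im = ∑' p, dualTerm chiFour chiTwelve q p := by
  have hb : ‖Complex.I * (q : ℂ)‖ < 1 := by
    rw [norm_mul, Complex.norm_I, one_mul]
    exact norm_ofReal_lt_one hq0 hq
  have hb0 : Complex.I * (q : ℂ) ≠ 0 :=
    mul_ne_zero Complex.I_ne_zero (by exact_mod_cast hq0.ne')
  have h := segmentIntegral_lambert abs_constOne_le abs_chiThree_le chiThree_zero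
    (fun u => lambert_etaQuotient) hb0 hb
  refine ⟨h.1, ?_⟩
  rw [h.2, im_tsum_dual abs_constOne_le abs_chiThree_le chiThree_zero hb]
  refine tsum_congr fun p => ?_
  -- Im i^(Jm) = χ₄(J) χ₄(m) turns the pair (1, χ₃) into (χ₄, χ₁₂).
  rw [mul_pow, ← Complex.ofReal_pow, Complex.im_mul_ofReal, I_pow_im, chiFour_mul, dualTerm,
    chiTwelve, constOne]
  push_cast
  ring

/-- The integral of `φ²(u) ψ⁴(u²)` along `[0, ρq]`. -/
theorem segmentIntegral_phi_sq_mul_psi_pow {q : ℝ} (hq0 : 0 < q) (hq : q < 1) {ρ : ℂ}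
    (hρ : ρ = Complex.exp (2 * π * Complex.I / 3)) :
    SegmentIntegrable (fun u : ℂ => ramanujanPhi u ^ 2 * ramanujanPsi (u ^ 2) ^ 4) 0 (ρ * q) ∧
      (segmentIntegral (fun u : ℂ => ramanujanPhi u ^ 2 * ramanujanPsi (u ^ 2) ^ 4)
        0 (ρ * q)).im = √3 / 2 * ∑' p, dualTerm chiThree chiTwelve q p := by
  have hb : ‖ρ * (q : ℂ)‖ < 1 := by
    rw [norm_mul, hρ, show (2 * π * Complex.I / 3 : ℂ) = ((2 * π / 3 : ℝ) : ℂ) * Complex.I by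
      push_cast; ring, Complex.norm_exp_ofReal_mul_I, one_mul]
    exact norm_ofReal_lt_one hq0 hq
  have hb0 : ρ * (q : ℂ) ≠ 0 :=
    mul_ne_zero (hρ ▸ Complex.exp_ne_zero _) (by exact_mod_cast hq0.ne')
  have h := segmentIntegral_lambert abs_constOne_le abs_chiFour_le chiFour_zero
    (fun u => lambert_phi_sq_mul_psi_pow) hb0 hb
  refine ⟨h.1, ?_⟩
  rw [h.2, im_tsum_dual abs_constOne_le abs_chiFour_le chiFour_zero hb, ← tsum_mul_left]
  refine tsum_congr fun p => ?_
  -- Im ρ^(Jm) = (√3/2) χ₃(J) χ₃(m) turns the pair (1, χ₄) into (χ₃, χ₁₂).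
  rw [mul_pow, ← Complex.ofReal_pow, Complex.im_mul_ofReal, hρ, exp_two_pi_div_three_pow_im,
    chiThree_mul, dualTerm, chiTwelve, constOne]
  push_cast
  ring

/-! ### Real integrals -/

lemma ofReal_ramanujanPhi (q : ℝ) : ((ramanujanPhi q : ℝ) : ℂ) = ramanujanPhi (q : ℂ) := by
  simp [ramanujanPhi, Complex.ofReal_tsum]

lemma ofReal_ramanujanPsi (q : ℝ) : ((ramanujanPsi q : ℝ) : ℂ) = ramanujanPsi (q : ℂ) := by
  simp [ramanujanPsi, Complex.ofReal_tsum]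

lemma intervalIntegral_lambert {α ε : ℕ → ℤ} (hα : ∀ m, |α m| ≤ 1) (hε : ∀ m, |ε m| ≤ 1)
    (h0 : ε 0 = 0) (c : ℝ) {g : ℂ → ℂ}
    (hg : ∀ u : ℂ, u ≠ 0 → ‖u‖ < 1 → u * g u = c * ∑' p, lambertTerm α ε u p) {h : ℝ → ℝ}
    (hh : ∀ t : ℝ, (h t : ℂ) = g t) {q : ℝ} (hq0 : 0 < q) (hq : q < 1) :
    IntervalIntegrable h volume 0 q ∧
      ∫ u in (0 : ℝ)..q, h u = c * ∑' p, dualTerm α ε q p := by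
  have key := integral_lambert hα hε h0 c hg (b := (q : ℂ)) (by exact_mod_cast hq0.ne')
    (norm_ofReal_lt_one hq0 hq)
  have e (t : ℝ) : (q : ℂ) * g (q * t) = ((q * h (q * t) : ℝ) : ℂ) := by
    rw [Complex.ofReal_mul, hh, Complex.ofReal_mul]
  simp_rw [e] at key
  constructor
  · have h1 : IntervalIntegrable (fun t : ℝ => q * h (q * t)) volume 0 1 := by
      have := key.1
      rw [intervalIntegrable_iff] at this ⊢
      exact this.re
    have h2 : IntervalIntegrable (fun t : ℝ => h (q * t)) volume (0 / q) (q / q) := by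
      rw [zero_div, div_self hq0.ne']
      refine (h1.const_mul q⁻¹).congr fun t _ => ?_
      field_simp
    exact (IntervalIntegrable.comp_mul_left_iff hq0.ne').mp h2
  · have h1 := key.2
    rw [intervalIntegral.integral_ofReal, intervalIntegral.integral_const_mul,
      intervalIntegral.mul_integral_comp_mul_left, mul_zero, mul_one] at h1
    apply Complex.ofReal_injective
    rw [h1, Complex.ofReal_mul, Complex.ofReal_tsum]
    congr 1
    refine tsum_congr fun p => ?_
    simp [dualTerm]

theorem integral_phi_neg_sq_mul_phi_pow {q : ℝ} (hq0 : 0 < q) (hq : q < 1) :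
    IntervalIntegrable
        (fun u : ℝ => (ramanujanPhi (-u) ^ 2 * ramanujanPhi u ^ 4 - 1) / u) volume 0 q ∧
      ∫ u in (0 : ℝ)..q, (ramanujanPhi (-u) ^ 2 * ramanujanPhi u ^ 4 - 1) / u =
        -4 * ∑' p, dualTerm chiFour altSign q p := by
  refine intervalIntegral_lambert abs_chiFour_le abs_altSign_le altSign_zero (-4)
    (g := fun u : ℂ => (ramanujanPhi (-u) ^ 2 * ramanujanPhi u ^ 4 - 1) / u) (fun u hu0 hu => ?_)
    (fun t => ?_) hq0 hq
  · rw [lambert_phi_neg_sq_mul_phi_pow hu0 hu, mul_div_cancel₀ _ hu0]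
    push_cast
    ring
  · push_cast
    rw [ofReal_ramanujanPhi, ofReal_ramanujanPhi]
    push_cast
    rfl

theorem integral_phi_mul_phi_mul_psi {q : ℝ} (hq0 : 0 < q) (hq : q < 1) :
    IntervalIntegrable
        (fun u : ℝ => ramanujanPhi (-u ^ 2) * ramanujanPhi (u ^ 4) *
          (3 * ramanujanPsi (-u ^ 2) ^ 4 - ramanujanPsi (u ^ 2) ^ 4)) volume 0 q ∧
      ∫ u in (0 : ℝ)..q, ramanujanPhi (-u ^ 2) * ramanujanPhi (u ^ 4) *
          (3 * ramanujanPsi (-u ^ 2) ^ 4 - ramanujanPsi (u ^ 2) ^ 4) =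
        2 * ∑' p, dualTerm chiFour chiEight q p := by
  refine intervalIntegral_lambert abs_chiFour_le abs_chiEight_le chiEight_zero 2
    (g := fun u : ℂ => ramanujanPhi (-u ^ 2) * ramanujanPhi (u ^ 4) *
          (3 * ramanujanPsi (-u ^ 2) ^ 4 - ramanujanPsi (u ^ 2) ^ 4)) (fun u hu0 hu => ?_)
    (fun t => ?_) hq0 hq
  · rw [lambert_phi_mul_phi_mul_psi hu0 hu]
    push_cast
    ring
  · push_cast
    rw [ofReal_ramanujanPhi, ofReal_ramanujanPhi, ofReal_ramanujanPsi, ofReal_ramanujanPsi]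
    push_cast
    rfl

/-! ### The alternating theta function -/

lemma alternating_sum_mem (n : ℕ) : ∀ f : ℕ → ℝ, Antitone f → (∀ i, 0 ≤ f i) →
    0 ≤ ∑ i ∈ Finset.range n, (-1) ^ i * f i ∧ ∑ i ∈ Finset.range n, (-1) ^ i * f i ≤ f 0 := by
  induction n with
  | zero => intro f _ h0; simpa using h0 0
  | succ n ih =>
    intro f hf h0
    have h := ih (fun i => f (i + 1)) (fun a b hab => hf (by omega)) (fun i => h0 _)
    have e : ∑ i ∈ Finset.range (n + 1), (-1) ^ i * f i =
        f 0 - ∑ i ∈ Finset.range n, (-1) ^ i * f (i + 1) := by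
      rw [Finset.sum_range_succ', pow_zero, one_mul, add_comm, sub_eq_add_neg, ← Finset.sum_neg_distrib]
      congr 1
      refine Finset.sum_congr rfl fun i _ => ?_
      ring
    have h1 : f (0 + 1) ≤ f 0 := hf (by omega)
    rw [e]
    constructor <;> linarith [h.1, h.2]

/-- The symmetric partial sums of `∑ (-1)^n e^{-(6n+1)² s}`. -/
noncomputable def altThetaPartial (v : ℕ) (s : ℝ) : ℝ :=
  ∑ n ∈ Finset.Icc (-(v : ℤ)) v, (-1 : ℝ) ^ n * Real.exp (-((6 * n + 1) ^ 2 * s))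

/-- The function `∑ (-1)^n e^{-(6n+1)² s}`. -/
noncomputable def altTheta (s : ℝ) : ℝ :=
  ∑' n : ℤ, (-1 : ℝ) ^ n * Real.exp (-((6 * n + 1) ^ 2 * s))

lemma sum_Icc_neg_eq (g : ℤ → ℝ) (v : ℕ) : ∑ n ∈ Finset.Icc (-(v : ℤ)) v, g n =
    ∑ i ∈ Finset.range (v + 1), g i + ∑ i ∈ Finset.range v, g (-(i + 1)) := by
  induction v with
  | zero => simp
  | succ v ih =>
    rw [Nat.cast_add, Nat.cast_one, Finset.Icc_succ_succ, Finset.sum_union (by simp),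
      Finset.sum_pair (by omega), ih, Finset.sum_range_succ _ (v + 1), Finset.sum_range_succ (fun i : ℕ => g (-(i + 1))) v]
    push_cast
    ring

/-- The indices n ≥ 0 and n < 0 give two alternating sums of decreasing terms, in (6i + 1)² and (6i
+ 5)², each between 0 and e^(-s). Uniformity in v, even as s → 0, is what handles the conditional
convergence. -/
lemma abs_altThetaPartial_le (v : ℕ) {s : ℝ} (hs : 0 ≤ s) :
    |altThetaPartial v s| ≤ 2 * Real.exp (-s) := by
  have h1 := alternating_sum_mem (v + 1) (fun i => Real.exp (-((6 * (i : ℝ) + 1) ^ 2 * s)))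
    (fun a b hab => by simp only; gcongr) (fun i => (Real.exp_pos _).le)
  have h2 := alternating_sum_mem v (fun i => Real.exp (-((6 * (i : ℝ) + 5) ^ 2 * s)))
    (fun a b hab => by simp only; gcongr) (fun i => (Real.exp_pos _).le)
  have e : altThetaPartial v s =
      ∑ i ∈ Finset.range (v + 1), (-1) ^ i * Real.exp (-((6 * (i : ℝ) + 1) ^ 2 * s)) -
        ∑ i ∈ Finset.range v, (-1) ^ i * Real.exp (-((6 * (i : ℝ) + 5) ^ 2 * s)) := by
    rw [altThetaPartial, sum_Icc_neg_eq, sub_eq_add_neg, ← Finset.sum_neg_distrib]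
    congr 1
    refine Finset.sum_congr rfl fun i _ => ?_
    have : (-1 : ℝ) ^ (-((i : ℤ) + 1)) = -(-1) ^ i := by
      rw [neg_one_zpow_eq_pow_natAbs, Int.natAbs_neg, show ((i : ℤ) + 1).natAbs = i + 1 by omega,
        pow_succ]
      ring
    rw [this]
    push_cast
    rw [show (6 * (-((i : ℝ) + 1)) + 1) ^ 2 = (6 * (i : ℝ) + 5) ^ 2 by ring]
    ring
  have h3 : Real.exp (-((6 * ((0 : ℕ) : ℝ) + 5) ^ 2 * s)) ≤ Real.exp (-s) := by
    gcongr
    push_cast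
    linarith
  have h4 : Real.exp (-((6 * ((0 : ℕ) : ℝ) + 1) ^ 2 * s)) = Real.exp (-s) := by simp
  have h5 := Real.exp_pos (-s)
  rw [e, abs_le]
  constructor <;> linarith [h1.1, h1.2, h2.1, h2.2]

/-- Pentagonal number theorem at q = e^(-24s), because (6n + 1)² = 1 + 24 · n(3n + 1)/2. -/
lemma hasSum_altTheta_complex {s : ℝ} (hs : 0 < s) :
    HasSum (fun n : ℤ => (((-1 : ℝ) ^ n * Real.exp (-((6 * n + 1) ^ 2 * s)) : ℝ) : ℂ))
      (Complex.exp (-s) * qProd (Complex.exp (-24 * s)) (Complex.exp (-24 * s))) := by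
  have hq0 : Complex.exp (-24 * s) ≠ 0 := Complex.exp_ne_zero _
  have hq : ‖Complex.exp (-24 * s)‖ < 1 := by
    rw [Complex.norm_exp, Real.exp_lt_one_iff]
    simpa using hs
  have h := ((entireLaurent_thetaCoeff (pow_ne_zero 3 hq0)
    (norm_pow_lt_one hq three_ne_zero)).summable (pow_ne_zero 2 hq0)).hasSum
  rw [← thetaSeries, thetaSeries_cube_sq hq0 hq] at h
  refine (h.mul_left (Complex.exp (-s))).congr_fun fun n => ?_
  have h1 : (((n * (n - 1) / 2 : ℤ) : ℂ)) * 2 = n * (n - 1) := by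
    exact_mod_cast Int.ediv_mul_cancel (Int.even_mul_pred_self n).two_dvd
  rw [thetaCoeff, ← Complex.exp_nat_mul, ← Complex.exp_nat_mul, ← Complex.exp_int_mul,
    ← Complex.exp_int_mul, mul_assoc, ← Complex.exp_add, mul_left_comm, ← Complex.exp_add]
  push_cast
  congr 2
  linear_combination (36 * s : ℂ) * h1

lemma summable_altTheta {s : ℝ} (hs : 0 < s) :
    Summable fun n : ℤ => (-1 : ℝ) ^ n * Real.exp (-((6 * n + 1) ^ 2 * s)) :=
  Complex.summable_ofReal.mp (hasSum_altTheta_complex hs).summable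

lemma tendsto_altThetaPartial {s : ℝ} (hs : 0 < s) :
    Tendsto (fun v => altThetaPartial v s) atTop (𝓝 (altTheta s)) :=
  (summable_altTheta hs).hasSum.comp
    (Finset.tendsto_Icc_neg_atTop_atTop.comp tendsto_natCast_atTop_atTop)

lemma summable_altTheta_cube {s : ℝ} (hs : 0 < s) : Summable fun k : ℕ =>
    (-1 : ℝ) ^ k * (2 * k + 1) * Real.exp (-(3 * (2 * k + 1) ^ 2 * s)) := by
  have hr : Real.exp (-(3 * s)) < 1 := by
    rw [Real.exp_lt_one_iff]
    linarith
  have hr' : ‖Real.exp (-(3 * s))‖ < 1 := by rwa [Real.norm_of_nonneg (Real.exp_pos _).le]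
  have hinj : Function.Injective fun k : ℕ => 2 * k + 1 := fun a b h => by simpa using h
  have h := (summable_pow_mul_geometric_of_norm_lt_one 1 hr').comp_injective hinj
  refine .of_norm (.of_nonneg_of_le (fun k => norm_nonneg _) (fun k => ?_) h)
  rw [norm_mul, norm_mul, norm_pow, norm_neg, norm_one, one_pow, one_mul,
    Real.norm_of_nonneg (by positivity), Real.norm_of_nonneg (Real.exp_pos _).le]
  simp only [Function.comp_apply, pow_one, ← Real.exp_nat_mul]
  push_cast
  gcongr
  have hk : (0 : ℝ) ≤ k := k.cast_nonneg
  nlinarith [mul_nonneg hs.le hk, mul_nonneg hs.le (sq_nonneg (k : ℝ))]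

/-- Jacobi's cube formula at q = e^(-24s), with 3 + 24 · k(k + 1)/2 = 3(2k + 1)². Three of the four
lattice variables become one. -/
lemma altTheta_cube {s : ℝ} (hs : 0 < s) : altTheta s ^ 3 =
    ∑' k : ℕ, (-1 : ℝ) ^ k * (2 * k + 1) * Real.exp (-(3 * (2 * k + 1) ^ 2 * s)) := by
  have hq0 : Complex.exp (-24 * s) ≠ 0 := Complex.exp_ne_zero _
  have hq : ‖Complex.exp (-24 * s)‖ < 1 := by
    rw [Complex.norm_exp, Real.exp_lt_one_iff]
    simpa using hs
  apply Complex.ofReal_injective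
  rw [Complex.ofReal_pow, altTheta, Complex.ofReal_tsum, (hasSum_altTheta_complex hs).tsum_eq,
    mul_pow, qProd_cube hq0 hq, Complex.ofReal_tsum, ← tsum_mul_left]
  refine tsum_congr fun k => ?_
  have h1 : (((k * (k + 1) / 2 : ℕ) : ℂ)) * 2 = k * (k + 1) := by
    exact_mod_cast Nat.div_mul_cancel (Nat.even_mul_succ_self k).two_dvd
  rw [← Complex.exp_nat_mul, ← Complex.exp_nat_mul, mul_left_comm, ← Complex.exp_add]
  push_cast
  congr 2
  linear_combination (-12 * s : ℂ) * h1

/-! ### The limit of the cubic partial sums -/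

lemma integral_mul_exp_neg {r : ℝ} (hr : 0 < r) :
    ∫ t in Set.Ioi (0 : ℝ), t * Real.exp (-(r * t)) = 1 / r ^ 2 := by
  have h := Real.integral_rpow_mul_exp_neg_mul_Ioi two_pos hr
  rw [Real.Gamma_two, mul_one, Real.rpow_two, one_div_pow] at h
  rw [← h]
  refine setIntegral_congr_fun measurableSet_Ioi fun t _ => ?_
  rw [show (2 : ℝ) - 1 = 1 by norm_num, Real.rpow_one]

lemma integrableOn_mul_exp_neg {r : ℝ} (hr : 0 < r) :
    IntegrableOn (fun t => t * Real.exp (-(r * t))) (Set.Ioi 0) := by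
  refine MeasureTheory.Integrable.of_integral_ne_zero ?_
  rw [integral_mul_exp_neg hr]
  positivity

/-- Writing 1/r² as the integral of t e^(-rt) makes the summand factor over the four indices, and a
cubic cutoff respects this factorisation. -/
lemma latticePartialSum_eq_integral {x : ℝ} (hx : 0 < x) (v : ℕ) :
    latticePartialSum 1 1 1 (x ^ 2) v = ∫ t in Set.Ioi (0 : ℝ),
      t * (altThetaPartial v t ^ 3 * altThetaPartial v (x ^ 2 * t)) := by
  have hpos (n₁ n₂ n₃ n₄ : ℤ) : (0 : ℝ) < 1 * (6 * n₁ + 1) ^ 2 + 1 * (6 * n₂ + 1) ^ 2 +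
      1 * (6 * n₃ + 1) ^ 2 + x ^ 2 * (6 * n₄ + 1) ^ 2 := by
    have : (6 * (n₁ : ℝ) + 1) ≠ 0 := by
      have : (6 * n₁ + 1) ≠ 0 := by omega
      exact_mod_cast this
    positivity
  have hint (n₁ n₂ n₃ n₄ : ℤ) := (integrableOn_mul_exp_neg (hpos n₁ n₂ n₃ n₄)).const_mul
    ((-1 : ℝ) ^ (n₁ + n₂ + n₃ + n₄))
  have hterm (n₁ n₂ n₃ n₄ : ℤ) : (-1 : ℝ) ^ (n₁ + n₂ + n₃ + n₄) /
      (1 * (6 * n₁ + 1) ^ 2 + 1 * (6 * n₂ + 1) ^ 2 + 1 * (6 * n₃ + 1) ^ 2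
        + x ^ 2 * (6 * n₄ + 1) ^ 2) ^ 2 = ∫ t in Set.Ioi (0 : ℝ),
      (-1 : ℝ) ^ (n₁ + n₂ + n₃ + n₄) * (t * Real.exp (-((1 * (6 * n₁ + 1) ^ 2 +
        1 * (6 * n₂ + 1) ^ 2 + 1 * (6 * n₃ + 1) ^ 2 + x ^ 2 * (6 * n₄ + 1) ^ 2) * t))) := by
    rw [integral_const_mul, integral_mul_exp_neg (hpos n₁ n₂ n₃ n₄)]
    ring
  simp only [latticePartialSum]
  simp_rw [hterm]
  simp only [← Finset.sum_product']
  rw [← integral_finsetSum _ fun p _ => hint _ _ _ _]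
  refine integral_congr_ae (.of_forall fun t => ?_)
  simp only [Finset.sum_product]
  have hexp (n₁ n₂ n₃ n₄ : ℤ) : (-1 : ℝ) ^ (n₁ + n₂ + n₃ + n₄) * (t * Real.exp (-((1 * (6 * n₁ + 1) ^ 2 +
        1 * (6 * n₂ + 1) ^ 2 + 1 * (6 * n₃ + 1) ^ 2 + x ^ 2 * (6 * n₄ + 1) ^ 2) * t))) =
      t * (((-1 : ℝ) ^ n₁ * Real.exp (-((6 * n₁ + 1) ^ 2 * t))) *
        (((-1 : ℝ) ^ n₂ * Real.exp (-((6 * n₂ + 1) ^ 2 * t))) *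
        (((-1 : ℝ) ^ n₃ * Real.exp (-((6 * n₃ + 1) ^ 2 * t))) *
        ((-1 : ℝ) ^ n₄ * Real.exp (-((6 * n₄ + 1) ^ 2 * (x ^ 2 * t))))))) := by
    have e : -((1 * (6 * (n₁ : ℝ) + 1) ^ 2 + 1 * (6 * n₂ + 1) ^ 2 + 1 * (6 * n₃ + 1) ^ 2 +
        x ^ 2 * (6 * n₄ + 1) ^ 2) * t) = -((6 * n₁ + 1) ^ 2 * t) + (-((6 * n₂ + 1) ^ 2 * t) +
        (-((6 * n₃ + 1) ^ 2 * t) + -((6 * n₄ + 1) ^ 2 * (x ^ 2 * t)))) := by ring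
    have h1 : (-1 : ℝ) ≠ 0 := by norm_num
    rw [e, Real.exp_add, Real.exp_add, Real.exp_add, zpow_add₀ h1, zpow_add₀ h1, zpow_add₀ h1]
    ring
  simp_rw [hexp, ← Finset.mul_sum, ← Finset.sum_mul]
  simp only [altThetaPartial]
  ring

lemma tendsto_latticePartialSum_integral {x : ℝ} (hx : 0 < x) :
    Tendsto (latticePartialSum 1 1 1 (x ^ 2)) atTop
      (𝓝 (∫ t in Set.Ioi (0 : ℝ), t * (altTheta t ^ 3 * altTheta (x ^ 2 * t)))) := by
  rw [show latticePartialSum 1 1 1 (x ^ 2) = fun v => _ from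
    funext fun v => latticePartialSum_eq_integral hx v]
  refine tendsto_integral_of_dominated_convergence
    -- The majorant is the product of the four bounds 2e^(-s), so 16 = 2⁴, with total exponent (3 +
    -- x²)t.
    (fun t => 16 * (t * Real.exp (-((3 + x ^ 2) * t)))) (fun v => ?_)
    ((integrableOn_mul_exp_neg (by positivity)).const_mul 16) (fun v => ?_) ?_
  · refine Continuous.aestronglyMeasurable ?_
    simp only [altThetaPartial]
    fun_prop
  · refine (ae_restrict_iff' measurableSet_Ioi).mpr (.of_forall fun t ht => ?_)
    have ht0 : 0 < t := ht
    have h1 := abs_altThetaPartial_le v ht0.le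
    have h2 := abs_altThetaPartial_le v (s := x ^ 2 * t) (by positivity)
    rw [Real.norm_eq_abs, abs_mul, abs_mul, abs_pow, abs_of_pos ht0]
    calc t * (|altThetaPartial v t| ^ 3 * |altThetaPartial v (x ^ 2 * t)|)
        ≤ t * ((2 * Real.exp (-t)) ^ 3 * (2 * Real.exp (-(x ^ 2 * t)))) := by gcongr
      _ = _ := by
        rw [mul_pow, ← Real.exp_nat_mul,
          show -((3 + x ^ 2) * t) = ((3 : ℕ) : ℝ) * -t + -(x ^ 2 * t) by push_cast; ring,
          Real.exp_add]
        ring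
  · refine (ae_restrict_iff' measurableSet_Ioi).mpr (.of_forall fun t ht => ?_)
    have ht0 : 0 < t := ht
    exact (((tendsto_altThetaPartial ht0).pow 3).mul
      (tendsto_altThetaPartial (by positivity))).const_mul t

/-- After Jacobi's formula the integrand is an absolutely convergent double series. The integrals of
the norms of its terms are the absolute values of `latticeTerm`, which are summable, so sum and
integral may be exchanged. -/
lemma integral_altTheta {x : ℝ} (hx : 0 < x) :
    ∫ t in Set.Ioi (0 : ℝ), t * (altTheta t ^ 3 * altTheta (x ^ 2 * t)) =
      ∑' p, latticeTerm x p := by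
  let c (p : ℤ × ℕ) : ℝ := (-1 : ℝ) ^ p.1 * ((-1) ^ p.2 * (2 * p.2 + 1))
  let r (p : ℤ × ℕ) : ℝ := 3 * (2 * p.2 + 1) ^ 2 + x ^ 2 * (6 * p.1 + 1) ^ 2
  have hr (p : ℤ × ℕ) : 0 < r p := by positivity
  have hval (p : ℤ × ℕ) : ∫ t in Set.Ioi (0 : ℝ), c p * (t * Real.exp (-(r p * t))) =
      latticeTerm x p := by
    rw [integral_const_mul, integral_mul_exp_neg (hr p), mul_one_div]
    rfl
  have hnorm (p : ℤ × ℕ) : ∫ t in Set.Ioi (0 : ℝ), ‖c p * (t * Real.exp (-(r p * t)))‖ =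
      |latticeTerm x p| := by
    rw [← hval, integral_const_mul, abs_mul, abs_of_nonneg (setIntegral_nonneg measurableSet_Ioi
      fun t (ht : 0 < t) => by positivity), ← integral_const_mul]
    refine setIntegral_congr_fun measurableSet_Ioi fun t (ht : 0 < t) => ?_
    rw [norm_mul, Real.norm_eq_abs, Real.norm_of_nonneg (by positivity)]
  have h := hasSum_integral_of_summable_integral_norm (μ := volume.restrict (Set.Ioi 0))
    (F := fun p t => c p * (t * Real.exp (-(r p * t))))
    (fun p => (integrableOn_mul_exp_neg (hr p)).const_mul _)
    ((summable_latticeTerm hx).abs.congr fun p => (hnorm p).symm)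
  simp_rw [hval] at h
  rw [h.tsum_eq]
  refine setIntegral_congr_fun measurableSet_Ioi fun t (ht : 0 < t) => ?_
  have hxt : 0 < x ^ 2 * t := by positivity
  rw [altTheta_cube ht, mul_comm (∑' k : ℕ, _) _, altTheta,
    tsum_mul_tsum_of_summable_norm (summable_altTheta hxt).norm (summable_altTheta_cube ht).norm,
    ← tsum_mul_left]
  refine tsum_congr fun p => ?_
  simp only [c, r]
  rw [show -((3 * (2 * (p.2 : ℝ) + 1) ^ 2 + x ^ 2 * (6 * p.1 + 1) ^ 2) * t) =
    -((6 * p.1 + 1) ^ 2 * (x ^ 2 * t)) + -(3 * (2 * p.2 + 1) ^ 2 * t) by ring, Real.exp_add]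
  ring

theorem tendsto_latticePartialSum {x : ℝ} (hx : 0 < x) :
    Tendsto (latticePartialSum 1 1 1 (x ^ 2)) atTop (𝓝 (∑' p, latticeTerm x p)) :=
  integral_altTheta hx ▸ tendsto_latticePartialSum_integral hx

lemma exp_neg_pi_mul_div_lt_one {x d : ℝ} (hx : 0 < x) (hd : 0 < d) :
    Real.exp (-π * x / d) < 1 := by
  rw [Real.exp_lt_one_iff, neg_mul, neg_div]
  exact neg_neg_of_pos (by positivity)

theorem mainTheorem9 (x : ℝ) (hx : 0 < x) :
    (∀ q : ℝ, q = Real.exp (-π * x / √12) →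
      (∃ l : ℝ, Tendsto (latticePartialSum 1 1 1 (x ^ 2)) atTop (𝓝 l)) ∧
      SegmentIntegrable (fun u : ℂ => ramanujanF (-u ^ 3) ^ 9 / ramanujanF (-u) ^ 3)
        0 (Complex.I * q) ∧
      latticeF 1 1 1 (x ^ 2) / (3 + x ^ 2) ^ 2 =
        π ^ 2 / (24 * √3 * x) *
          (segmentIntegral (fun u : ℂ => ramanujanF (-u ^ 3) ^ 9 / ramanujanF (-u) ^ 3)
            0 (Complex.I * q)).im) ∧
    (∀ q : ℝ, q = Real.exp (-π * x) →
      Summable (term12 x) ∧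
      IntervalIntegrable
        (fun u : ℝ => (ramanujanPhi (-u) ^ 2 * ramanujanPhi u ^ 4 - 1) / u) volume 0 q ∧
      F12 x = π ^ 3 / 32 - π ^ 2 / (32 * x) *
        ∫ u in (0 : ℝ)..q, (ramanujanPhi (-u) ^ 2 * ramanujanPhi u ^ 4 - 1) / u) ∧
    (∀ (q : ℝ) (ρ : ℂ), q = Real.exp (-π * x / 3) →
      ρ = Complex.exp (2 * π * Complex.I / 3) →
      Summable (term14 x) ∧
      SegmentIntegrable (fun u : ℂ => ramanujanPhi u ^ 2 * ramanujanPsi (u ^ 2) ^ 4)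
        0 (ρ * q) ∧
      F14 x = 25 * π ^ 2 / (36 * x) *
        (segmentIntegral (fun u : ℂ => ramanujanPhi u ^ 2 * ramanujanPsi (u ^ 2) ^ 4)
          0 (ρ * q)).im) ∧
    (∀ q : ℝ, q = Real.exp (-π * x / √8) →
      Summable (term22 x) ∧
      IntervalIntegrable
        (fun u : ℝ => ramanujanPhi (-u ^ 2) * ramanujanPhi (u ^ 4) *
          (3 * ramanujanPsi (-u ^ 2) ^ 4 - ramanujanPsi (u ^ 2) ^ 4)) volume 0 q ∧
      F22 x = 9 * π ^ 2 / (32 * √2 * x) *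
        ∫ u in (0 : ℝ)..q, ramanujanPhi (-u ^ 2) * ramanujanPhi (u ^ 4) *
          (3 * ramanujanPsi (-u ^ 2) ^ 4 - ramanujanPsi (u ^ 2) ^ 4)) := by
  refine ⟨fun q hq => ?_, fun q hq => ?_, fun q ρ hq hρ => ?_, fun q hq => ?_⟩
  · have hq0 : 0 < q := hq ▸ Real.exp_pos _
    have hq1 : q < 1 := hq ▸ exp_neg_pi_mul_div_lt_one hx (by positivity)
    have hl := tendsto_latticePartialSum hx
    have hs := segmentIntegral_etaQuotient hq0 hq1
    refine ⟨⟨_, hl⟩, hs.1, ?_⟩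
    have h3 : (3 + x ^ 2) ≠ 0 := by positivity
    rw [hs.2, latticeF, hl.limUnder_eq, tsum_latticeTerm hx hq,
      show (1 + 1 + 1 + x ^ 2) = 3 + x ^ 2 by ring, mul_div_cancel_left₀ _ (pow_ne_zero 2 h3)]
  · have hq0 : 0 < q := hq ▸ Real.exp_pos _
    have hq1 : q < 1 := by
      have := exp_neg_pi_mul_div_lt_one hx one_pos
      rwa [div_one, ← hq] at this
    have hs := integral_phi_neg_sq_mul_phi_pow hq0 hq1
    refine ⟨summable_term12 hx, hs.1, ?_⟩
    rw [hs.2, F12_eq_tsum_dualTerm hx hq]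
    field_simp
    ring
  · have hq0 : 0 < q := hq ▸ Real.exp_pos _
    have hq1 : q < 1 := hq ▸ exp_neg_pi_mul_div_lt_one hx three_pos
    have hs := segmentIntegral_phi_sq_mul_psi_pow hq0 hq1 hρ
    exact ⟨summable_term14 hx, hs.1, by rw [hs.2, F14_eq_tsum_dualTerm hx hq]⟩
  · have hq0 : 0 < q := hq ▸ Real.exp_pos _
    have hq1 : q < 1 := hq ▸ exp_neg_pi_mul_div_lt_one hx (by positivity)
    have hs := integral_phi_mul_phi_mul_psi hq0 hq1
    exact ⟨summable_term22 hx, hs.1, by rw [hs.2, F22_eq_tsum_dualTerm hx hq]⟩
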